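/- **Model.** There are $J$ goods; price and quantity vectors lie in $\mathbb R^J$ with the Euclidean norm. Individuals form a measurable space $(\mathcal G,\Theta)$ with $\Theta$ a probability measure; individual $g$ with treatment $w\in\{0,1\}$ facing price $p\in\mathbb R^J$ has outcome $Y_g(w,p)\in\mathbb R$, demand $D_g(w,p)\in\mathbb R^J$, supply $S_g(w,p)\in\mathbb R^J$ (measurable in $g$) and excess demand $Z_g=D_g-S_g$. For $\pi\in(0,1)$ put $y_\pi(p)=\pi\,\mathbb E_\Theta[Y_g(1,p)]+(1-\pi)\,\mathbb E_\Theta[Y_g(0,p)]$ and $z_\pi(p)=\pi\,\mathbb E_\Theta[Z_g(1,p)]+(1-\pi)\,\mathbb E_\Theta[Z_g(0,p)]$. Gradients are $(\nabla_p y)_k=\partial y/\partial p_k$, $(\nabla_p z)_{kj}=\partial z_j/\partial p_k$. **Assumptions.** Fix $\pi\in(0,1)$. 1. There are $l,u\in\mathbb R^J$ with positive coordinates such that for all $g$, $w$, $j$ and $p$: $Z_{g,j}(w,p)\le 0$ if $p_j\ge u_j$, and $Z_{g,j}(w,p)\ge 0$ if $p_j\le l_j$; for each $w,j$ each of the two inequalities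 is strict, for all such $p$, on a measurable set of $g$ of positive $\Theta$-measure. Let $\mathcal S=\{p: l\le p\le u\}$. 2. $Y_g(w,\cdot)$, $D_g(w,\cdot)$, $S_g(w,\cdot)$ are $C^2$ on $\mathbb R^J$, and they and their derivatives of order $1,2$ are bounded on some $\delta$-neighbourhood of $\mathcal S$ ($\delta>0$), uniformly in $g$ and $w$. 3. With $p^*_\rho$ the zero of $z_\rho$ in $\mathcal S$: $\nabla_p z_\pi(p^*_\pi)$ is invertible; the Jacobian of $p\mapsto z_\pi(p)+p$ has operator norm $<1$ at every $p\in\mathcal S$; and $\mathbb E[Z_i(W_i,p^*_\pi)Z_i(W_i,p^*_\pi)^\top]$ has full rank, where $g_i\sim\Theta$ and $W_i\sim\mathrm{Bernoulli}(\pi)$ are independent and $F_i=F_{g_i}$. 4. For some $B>0$ there are $a_n$ with $n a_n\to0$ such that for all large $n$, all $U_1,\dots,U_n\in[-B,B]^J$, almost all $(g_1,\dots,g_n)$ under $\Theta^{\otimes n}$ and all $w\in\{0,1\}^n$, there is $p$ with $\|\frac1n\sum_i Z_{g_i}(w_i,p+U_i)\|\le a_n$. 5. For each $n$, $(g_i,W_i,U_i)_{i\le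 n}$ are i.i.d.; $g_i\sim\Theta$, $W_i\sim\mathrm{Bernoulli}(\pi)$ and the $J$ coordinates of $U_i$, uniform on $\{-h_n,h_n\}$, are mutually independent; $h_n=c\,n^{-\alpha}$ with $c>0$ and $\frac14<\alpha<\frac12$. The market price $\tilde P_n$ is a random vector that almost surely minimizes $p\mapsto\|\frac1n\sum_i Z_{g_i}(W_i,p+U_i)\|$ over $\mathbb R^J$ (any measurable tie-breaking). One observes $W_i$, $U_i$, $Y_i=Y_{g_i}(W_i,\tilde P_n+U_i)$, $Z_i=Z_{g_i}(W_i,\tilde P_n+U_i)$; let $\mathbf U,\mathbf Z$ be the $n\times J$ matrices with rows $U_i^\top,Z_i^\top$ and $\mathbf Y=(Y_1,\dots,Y_n)^\top$. **Estimator and target.** $\hat\Delta_y=(\mathbf U^\top\mathbf U)^{-1}\mathbf U^\top\mathbf Y$, $\hat\Delta_z=(\mathbf U^\top\mathbf U)^{-1}\mathbf U^\top\mathbf Z$, $\hat\tau_z=\frac1n\sum_i\big(\frac{W_iZ_i}{\pi}-\frac{(1-W_i)Z_i}{1-\pi}\big)$, $\hat\gamma=\hat\Delta_z^{-1}\hat\Delta_y$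 and $\hat\tau_{\mathrm{AIE}}=-\hat\gamma^\top\hat\tau_z$ (matrix inverses being set to $0$ for singular matrices); $\tau^*_{\mathrm{AIE}}=\big[\nabla_p y_\pi(p^*_\pi)\big]^\top\frac{d}{d\pi}p^*_\pi$. **Theorem.** Under these assumptions, for every $\rho$ in a neighbourhood of $\pi$ the function $z_\rho$ has exactly one zero $p^*_\rho$ in $\mathcal S$, the map $\rho\mapsto p^*_\rho$ is differentiable at $\pi$, and $$\sqrt n\,h_n\big(\hat\tau_{\mathrm{AIE}}-\tau^*_{\mathrm{AIE}}\big)\ \xrightarrow{d}\ N(0,\sigma_I^2),\qquad \sigma_I^2=\mathbb E\big[(Y_i(W_i,p^*_\pi)-Z_i(W_i,p^*_\pi)^\top\gamma)^2\big]\Big[\frac{d}{d\pi}p^*_\pi\Big]^\top\frac{d}{d\pi}p^*_\pi,$$ where $\gamma=[\nabla_p z_\pi(p^*_\pi)]^{-1}\nabla_p y_\pi(p^*_\pi)$ (and $N(0,0)$ is the point mass at $0$). -/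

import Mathlib

open MeasureTheory ProbabilityTheory Filter Topology
open scoped Matrix

noncomputable section

/-- Price vectors (and quantity vectors) for `J` goods, with the Euclidean norm. -/
abbrev Goods (J : ℕ) : Type := EuclideanSpace ℝ (Fin J)

/-- The indicator of treatment, as a real number. -/
def treat (w : Bool) : ℝ := if w then 1 else 0

/-- The Bernoulli law of a treatment that is assigned (`true`) with probability `π`. -/
abbrev treatmentLaw (π : unitInterval) : Measure Bool := bernoulliMeasure true false π

/-- The uniform law on `{h, -h}`. -/
abbrev signLaw (h : ℝ) : Measure ℝ :=
  bernoulliMeasure h (-h) ⟨1 / 2, by norm_num, by norm_num⟩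

/-- The set of prices between `l` and `u`. -/
def priceBox {J : ℕ} (l u : Fin J → ℝ) : Set (Goods J) := {p | ∀ j, l j ≤ p j ∧ p j ≤ u j}

/-- The outcome, demand and supply functions of the individuals: `𝒢` indexes the possible
individuals, and individual `g` with treatment `w` who faces the price `p` has outcome
`outcome g w p`, demand `demand g w p` and supply `supply g w p`. -/
structure Economy (J : ℕ) (𝒢 : Type*) where
  outcome : 𝒢 → Bool → Goods J → ℝ
  demand : 𝒢 → Bool → Goods J → Goods J
  supply : 𝒢 → Bool → Goods J → Goods J

namespace Economy

section Model

variable {J : ℕ} {𝒢 : Type*} [MeasurableSpace 𝒢] (M : Economy J 𝒢) (Θ : Measure 𝒢)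

/-- Excess demand of an individual. -/
def excess (g : 𝒢) (w : Bool) (p : Goods J) : Goods J := M.demand g w p - M.supply g w p

/-! ### Mean-field quantities -/

/-- `y(w, p)`. -/
def meanOutcome (w : Bool) (p : Goods J) : ℝ := ∫ g, M.outcome g w p ∂Θ

/-- `d(w, p)`. -/
def meanDemand (w : Bool) (p : Goods J) : Goods J := ∫ g, M.demand g w p ∂Θ

/-- `s(w, p)`. -/
def meanSupply (w : Bool) (p : Goods J) : Goods J := ∫ g, M.supply g w p ∂Θ

/-- `y_π(p)`. -/
def mixedOutcome (π : ℝ) (p : Goods J) : ℝ :=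
  π * M.meanOutcome Θ true p + (1 - π) * M.meanOutcome Θ false p

/-- The mean-field excess demand `z_π(p)`. -/
def mixedExcess (π : ℝ) (p : Goods J) : Goods J :=
  π • (M.meanDemand Θ true p - M.meanSupply Θ true p)
    + (1 - π) • (M.meanDemand Θ false p - M.meanSupply Θ false p)

/-- `p` is a mean-field price in the box `[l, u]` for the treatment probability `π`. -/
def IsMeanFieldPrice (l u : Fin J → ℝ) (π : ℝ) (p : Goods J) : Prop :=
  p ∈ priceBox l u ∧ M.mixedExcess Θ π p = 0

/-- The mean-field price `p*_π`, as a function of `π`. -/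
def meanFieldPrice (l u : Fin J → ℝ) (π : ℝ) : Goods J :=
  Classical.epsilon (M.IsMeanFieldPrice Θ l u π)

/-- The gradient `∇_p y_π(p)`: entry `k` is the derivative in the `k`-th price. -/
def gradOutcome (π : ℝ) (p : Goods J) : Fin J → ℝ :=
  fun k => fderiv ℝ (M.mixedOutcome Θ π) p (EuclideanSpace.single k 1)

/-- The gradient `∇_p z_π(p)`: entry `(k, j)` is the derivative of the excess demand for good `j`
in the `k`-th price. -/
def gradExcess (π : ℝ) (p : Goods J) : Matrix (Fin J) (Fin J) ℝ :=
  Matrix.of fun k j => fderiv ℝ (M.mixedExcess Θ π) p (EuclideanSpace.single k 1) j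

/-- `γ = (∇_p z_π)⁻¹ ∇_p y_π` at the mean-field price. -/
def gamma (l u : Fin J → ℝ) (π : ℝ) : Fin J → ℝ :=
  (M.gradExcess Θ π (M.meanFieldPrice Θ l u π))⁻¹ *ᵥ
    M.gradOutcome Θ π (M.meanFieldPrice Θ l u π)

/-- The mean-field average indirect effect `τ*_AIE = (∇_p y_π(p*_π))ᵀ (d p*_π / dπ)`. -/
def meanFieldAIE (l u : Fin J → ℝ) (π : ℝ) : ℝ :=
  M.gradOutcome Θ π (M.meanFieldPrice Θ l u π) ⬝ᵥ (deriv (M.meanFieldPrice Θ l u) π).ofLp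

/-- The asymptotic variance
`σ_I² = E[(Y_i(W_i, p*) - Z_i(W_i, p*)ᵀ γ)²] (d p*_π / dπ)ᵀ (d p*_π / dπ)`. -/
def asympVarAIE (l u : Fin J → ℝ) (π : unitInterval) : ℝ :=
  (∫ x, (M.outcome x.1 x.2 (M.meanFieldPrice Θ l u π)
      - (M.excess x.1 x.2 (M.meanFieldPrice Θ l u π)).ofLp ⬝ᵥ M.gamma Θ l u π) ^ 2
        ∂(Θ.prod (treatmentLaw π)))
    * ((deriv (M.meanFieldPrice Θ l u) π).ofLp ⬝ᵥ (deriv (M.meanFieldPrice Θ l u) π).ofLp)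

/-! ### Assumptions on the economy -/

/-- Excess demand for a good is nonpositive when its price is at least `u` and nonnegative when
its price is at most `l`, strictly so for a set of individuals of positive measure. -/
structure BoundaryCondition (l u : Fin J → ℝ) : Prop where
  lower_pos : ∀ j, 0 < l j
  upper_pos : ∀ j, 0 < u j
  upper : ∀ g w p j, u j ≤ p j → M.excess g w p j ≤ 0
  upper_strict : ∀ w j, ∃ A : Set 𝒢, MeasurableSet A ∧ 0 < Θ A ∧
    ∀ g ∈ A, ∀ p : Goods J, u j ≤ p j → M.excess g w p j < 0
  lower : ∀ g w p j, p j ≤ l j → 0 ≤ M.excess g w p j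
  lower_strict : ∀ w j, ∃ A : Set 𝒢, MeasurableSet A ∧ 0 < Θ A ∧
    ∀ g ∈ A, ∀ p : Goods J, p j ≤ l j → 0 < M.excess g w p j

/-- The random functions are measurable, twice continuously differentiable in prices, and bounded
up to the second derivative, uniformly over the individuals and over the prices in a neighbourhood
of the price box. -/
structure Regular (l u : Fin J → ℝ) : Prop where
  measurable_outcome : ∀ w p, Measurable fun g => M.outcome g w p
  measurable_demand : ∀ w p, Measurable fun g => M.demand g w p
  measurable_supply : ∀ w p, Measurable fun g => M.supply g w p
  contDiff_outcome : ∀ g w, ContDiff ℝ 2 (M.outcome g w)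
  contDiff_demand : ∀ g w, ContDiff ℝ 2 (M.demand g w)
  contDiff_supply : ∀ g w, ContDiff ℝ 2 (M.supply g w)
  bounded : ∃ δ > 0, ∃ C : ℝ, ∀ g w, ∀ r ≤ 2, ∀ p ∈ Metric.cthickening δ (priceBox l u),
    ‖iteratedFDeriv ℝ r (M.outcome g w) p‖ ≤ C ∧
    ‖iteratedFDeriv ℝ r (M.demand g w) p‖ ≤ C ∧
    ‖iteratedFDeriv ℝ r (M.supply g w) p‖ ≤ C

/-- The conditions that make the mean-field price unique, differentiable in `π`, and the limit
distribution of the finite-sample price nondegenerate. -/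
structure Nonsingular (l u : Fin J → ℝ) (π : unitInterval) : Prop where
  jacobian : IsUnit (M.gradExcess Θ π (M.meanFieldPrice Θ l u π))
  contraction : ∀ p ∈ priceBox l u, ‖fderiv ℝ (fun q => M.mixedExcess Θ π q + q) p‖ < 1
  covariance : IsUnit (Matrix.of fun j k : Fin J =>
    ∫ x, M.excess x.1 x.2 (M.meanFieldPrice Θ l u π) j
      * M.excess x.1 x.2 (M.meanFieldPrice Θ l u π) k ∂(Θ.prod (treatmentLaw π)))

/-- Average excess demand of `n` individuals `g` with treatments `w`, when individual `i` faces the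
price `p + U i`. -/
def avgExcess {n : ℕ} (g : Fin n → 𝒢) (w : Fin n → Bool) (U : Fin n → Goods J) (p : Goods J) :
    Goods J :=
  (n : ℝ)⁻¹ • ∑ i, M.excess (g i) (w i) (p + U i)

/-- In large samples some price clears the market up to `a n = o(1 / n)`, for every treatment
vector and every matrix of price perturbations that are bounded by `B`. -/
def ApproxClearing [SigmaFinite Θ] (B : ℝ) : Prop :=
  ∃ a : ℕ → ℝ, Tendsto (fun n : ℕ => (n : ℝ) * a n) atTop (𝓝 0) ∧
    ∀ᶠ n : ℕ in atTop, ∀ U : Fin n → Goods J, (∀ i j, |U i j| ≤ B) →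
      ∀ᵐ g ∂(Measure.pi fun _ : Fin n => Θ), ∀ w : Fin n → Bool,
        ∃ p, ‖M.avgExcess g w U p‖ ≤ a n

/-- `p` is a market price: it comes closest to clearing the market. -/
def IsMarketPrice {n : ℕ} (g : Fin n → 𝒢) (w : Fin n → Bool) (U : Fin n → Goods J)
    (p : Goods J) : Prop :=
  ∀ q, ‖M.avgExcess g w U p‖ ≤ ‖M.avgExcess g w U q‖

end Model

end Economy

/-! ### The experiment -/

/-- `n` individuals drawn i.i.d. from `Θ`, independent treatments that are assigned with
probability `π`, and independent price perturbations whose coordinates are independent and uniform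
on `{-h, h}`. -/
structure Experiment {J : ℕ} {𝒢 : Type*} [MeasurableSpace 𝒢] (Θ : Measure 𝒢) (π : unitInterval)
    (h : ℝ) {Ω : Type*} [MeasurableSpace Ω] (P : Measure Ω) {n : ℕ}
    (G : Fin n → Ω → 𝒢) (W : Fin n → Ω → Bool) (U : Fin n → Ω → Goods J) : Prop where
  indep : iIndepFun (fun i ω => (G i ω, W i ω, U i ω)) P
  law : ∀ i, HasLaw (fun ω => (G i ω, W i ω, (U i ω).ofLp))
    (Θ.prod ((treatmentLaw π).prod (Measure.pi fun _ : Fin J => signLaw h))) P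

/-! ### The estimators, as functions of the observed treatments `W`, perturbations `U`, outcomes
`Y` and excess demands `Z` -/

section Estimators

variable {J n : ℕ}

/-- Regression of outcomes on price perturbations, `(UᵀU)⁻¹ UᵀY`. -/
def deltaY (U : Matrix (Fin n) (Fin J) ℝ) (Y : Fin n → ℝ) : Fin J → ℝ :=
  (Uᵀ * U)⁻¹ *ᵥ (Uᵀ *ᵥ Y)

/-- Regression of excess demands on price perturbations, `(UᵀU)⁻¹ UᵀZ`. -/
def deltaZ (U Z : Matrix (Fin n) (Fin J) ℝ) : Matrix (Fin J) (Fin J) ℝ :=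
  (Uᵀ * U)⁻¹ * (Uᵀ * Z)

/-- Horvitz-Thompson estimator of the direct effect on excess demand. -/
def horvitzThompsonZ (π : ℝ) (W : Fin n → Bool) (Z : Matrix (Fin n) (Fin J) ℝ) : Fin J → ℝ :=
  fun j => (n : ℝ)⁻¹ * ∑ i, (treat (W i) * Z i j / π - (1 - treat (W i)) * Z i j / (1 - π))

/-- The estimator `-γ̂ᵀ τ̂_z` of the average indirect effect, where `γ̂ = Δ̂_z⁻¹ Δ̂_y`. -/
def estimatorAIE (π : ℝ) (W : Fin n → Bool) (U : Matrix (Fin n) (Fin J) ℝ) (Y : Fin n → ℝ)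
    (Z : Matrix (Fin n) (Fin J) ℝ) : ℝ :=
  -(((deltaZ U Z)⁻¹ *ᵥ deltaY U Y) ⬝ᵥ horvitzThompsonZ π W Z)

/-- The estimator of the average indirect effect from the experiment in which individual `i` has
type `g i` and treatment `w i` and faces the price `p + U i`. -/
def Economy.sampleAIE {𝒢 : Type*} (M : Economy J 𝒢) (π : ℝ) (g : Fin n → 𝒢) (w : Fin n → Bool)
    (U : Fin n → Goods J) (p : Goods J) : ℝ :=
  estimatorAIE π w (Matrix.of fun i j => U i j) (fun i => M.outcome (g i) (w i) (p + U i))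
    (Matrix.of fun i j => M.excess (g i) (w i) (p + U i) j)

end Estimators

end

/-! Write `p*` for the mean-field price, `H` for the gradient of `z_π` at `p*`, `d` for the effect
of treatment on mean excess demand at `p*`, and `U_i = h ξ_i` with random signs `ξ_i`. Everything is
a first-order expansion at `p*`, after one algebraic observation. Put `R = Y - Zᵀγ`. Then `UᵀY =
(UᵀZ)γ + UᵀR` holds exactly, so `γ̂ = γ + (UᵀZ)⁻¹UᵀR`: the Gram matrix of the perturbations cancels,
and only the regression of the residual `R` matters (`estimatorAIE_eq`, `sampleAIE_sampleArray_eq`).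

Let `δ` be the market price minus `p*`. Taylor expansion of a random function `F` at `p* + δ + h
ξ_i` gives `n^{-1/2} ∑ ξ_{ik} F = n^{-1/2} ∑ ξ_{ik} F(p*) + √n h E[∂_k F(p*)] + o_p(1)`
(`tendsto_shiftSum_sign`). The quadratic remainder is of order `√n (‖δ‖² + h²)`, which vanishes
because `δ = O_p(n^{-1/2})` and `α > 1/4`; the linear term in `δ` vanishes because the signs are
centred and independent of `F`. For `F` a coordinate of `Z`, division by `√n h → ∞` leaves `H`
(`tendsto_signExcess`). For `F = R` the drift is absent, since `H γ = ∇y` says exactly that `R` has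
mean derivative zero at `p*` (`integral_partialDeriv_residual`), and what remains is a normalized
i.i.d. sum. The Horvitz-Thompson term is `d + O_p(n^{-1/2})`, so its error disappears after
multiplication by `√n h`. The limit is therefore that of `-(dᵀH⁻¹) · n^{-1/2} ∑ ξ_i R_i(p*)`.
Implicit differentiation of `z_ρ(p*_ρ) = 0` identifies `-dᵀH⁻¹` with the derivative of the
mean-field price (`hasDerivAt_meanFieldPrice`), and since the signs are orthonormal and independent
of `R` the variance factors as in `σ_I²`.

The rate of `δ` comes from the contraction hypothesis. With high probability `id` plus the sample
excess demand is a contraction on a neighbourhood of the box (`eventually_avgField_contraction`),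
and it points inwards on the box enlarged by `h`. Hence a zero exists, the market price is a zero
lying in the enlarged box, and its distance from `p*` is at most a constant times the sample excess
demand at `p*` (`eventually_norm_price_sub_le`), which is `O_p(n^{-1/2})`.

Convergence in probability is convergence along the filter `whp`, so that limits can be combined by
the ordinary calculus of `Tendsto`; the rate `O_p(n^{-1/2})` of `δ` is expressed as `b_n √n ‖δ‖ → 0`
for every deterministic `b_n → 0`. -/

/-! ### Convergence in probability along varying probability spaces -/

section ConvergenceInProbability

variable {Ω : ℕ → Type*} [∀ n, MeasurableSpace (Ω n)]

/-- The filter of events, in a sequence of probability spaces, whose probability tends to one.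
Convergence in probability is convergence along this filter. -/
def whp (P : ∀ n, Measure (Ω n)) : Filter (Σ n, Ω n) where
  sets := {A | Tendsto (fun n => P n {ω | (⟨n, ω⟩ : Σ n, Ω n) ∉ A}) atTop (𝓝 0)}
  univ_sets := by simp
  sets_of_superset {A B} hA hAB := by
    refine tendsto_of_tendsto_of_tendsto_of_le_of_le tendsto_const_nhds hA (fun _ => zero_le) ?_
    exact fun n => measure_mono fun ω hω h => hω (hAB h)
  inter_sets {A B} hA hB := by
    have := Tendsto.add hA hB
    rw [add_zero] at this
    refine tendsto_of_tendsto_of_tendsto_of_le_of_le tendsto_const_nhds this (fun _ => zero_le) ?_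
    intro n
    refine (measure_mono fun ω hω => ?_).trans (measure_union_le _ _)
    simp only [Set.mem_ofPred_eq, Set.mem_inter_iff, not_and_or] at hω
    exact hω

variable {P : ∀ n, Measure (Ω n)}

lemma eventually_whp_iff {p : (Σ n, Ω n) → Prop} :
    (∀ᶠ x in whp P, p x) ↔ Tendsto (fun n => P n {ω | ¬ p ⟨n, ω⟩}) atTop (𝓝 0) := Iff.rfl

lemma eventually_whp_of_ae {p : (Σ n, Ω n) → Prop} (hp : ∀ᶠ n in atTop, ∀ᵐ ω ∂(P n), p ⟨n, ω⟩) :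
    ∀ᶠ x in whp P, p x := by
  rw [eventually_whp_iff]
  refine tendsto_const_nhds.congr' ?_
  filter_upwards [hp] with n hn
  exact hn.symm

lemma tendsto_fst_whp : Tendsto (fun x : Σ n, Ω n => x.1) (whp P) atTop := by
  intro A hA
  refine eventually_whp_of_ae (p := fun x => x.1 ∈ A) ?_
  filter_upwards [hA] with n hn
  exact ae_of_all _ fun _ => hn

/-- Boundedness in probability. -/
def BddInProb (P : ∀ n, Measure (Ω n)) (X : (Σ n, Ω n) → ℝ) : Prop :=
  ∀ ε : ENNReal, 0 < ε → ∃ K : ℝ, 0 < K ∧ ∀ᶠ n in atTop, P n {ω | K < |X ⟨n, ω⟩|} ≤ ε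

lemma BddInProb.mul_tendsto {X Y : (Σ n, Ω n) → ℝ} (hX : BddInProb P X)
    (hY : Tendsto Y (whp P) (𝓝 0)) : Tendsto (fun x => X x * Y x) (whp P) (𝓝 0) := by
  rw [Metric.tendsto_nhds]
  intro δ hδ
  rw [eventually_whp_iff, ENNReal.tendsto_nhds_zero]
  intro ε hε
  have hε2 : 0 < ε / 2 := ENNReal.half_pos hε.ne'
  obtain ⟨K, hK, hXK⟩ := hX (ε / 2) hε2
  have hYK := (Metric.tendsto_nhds.1 hY) (δ / K) (by positivity)
  rw [eventually_whp_iff, ENNReal.tendsto_nhds_zero] at hYK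
  filter_upwards [hXK, hYK (ε / 2) hε2] with n h1 h2
  refine (measure_mono (t := {ω | K < |X ⟨n, ω⟩|} ∪ {ω | ¬ dist (Y ⟨n, ω⟩) 0 < δ / K}) ?_).trans
    ((measure_union_le _ _).trans ((add_le_add h1 h2).trans (ENNReal.add_halves ε).le))
  intro ω hω
  by_contra hcon
  simp only [Set.mem_union, Set.mem_ofPred_eq, not_or, not_lt, Real.dist_eq, sub_zero]
    at hcon hω
  rw [abs_mul] at hω
  have := mul_lt_mul' hcon.1 (not_le.1 hcon.2) (abs_nonneg _) hK
  rw [mul_div_cancel₀ _ hK.ne'] at this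
  linarith

/-- Chebyshev's inequality: variables with bounded second moments are bounded in probability. -/
lemma BddInProb.of_sq_integral_le {X : (Σ n, Ω n) → ℝ} {C : ℝ}
    [∀ n, IsProbabilityMeasure (P n)]
    (hint : ∀ᶠ n in atTop, Integrable (fun ω => X ⟨n, ω⟩ ^ 2) (P n))
    (hC : ∀ᶠ n in atTop, ∫ ω, X ⟨n, ω⟩ ^ 2 ∂(P n) ≤ C) : BddInProb P X := by
  intro ε hε
  rcases eq_or_ne ε ⊤ with rfl | htop
  · exact ⟨1, one_pos, Eventually.of_forall fun _ => le_top⟩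
  have hε' : 0 < ε.toReal := ENNReal.toReal_pos hε.ne' htop
  -- Nothing fixes the sign of `C`; `|C| + 1` keeps the threshold in Markov's inequality positive.
  have hD : 0 < |C| + 1 := by positivity
  refine ⟨√((|C| + 1) / ε.toReal), by positivity, ?_⟩
  filter_upwards [hint, hC] with n h1 h2
  have h3 := mul_meas_ge_le_integral_of_nonneg (μ := P n) (f := fun ω => X ⟨n, ω⟩ ^ 2)
    (ae_of_all _ fun _ => sq_nonneg _) h1 ((|C| + 1) / ε.toReal)
  have h4 : (P n).real {ω | √((|C| + 1) / ε.toReal) < |X ⟨n, ω⟩|} ≤ ε.toReal := by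
    refine (measureReal_mono (fun ω hω => ?_)).trans
      (show (P n).real {ω | (|C| + 1) / ε.toReal ≤ X ⟨n, ω⟩ ^ 2} ≤ ε.toReal from ?_)
    · rw [Set.mem_ofPred_eq, ← sq_abs, ← Real.sqrt_le_left (abs_nonneg _)]
      exact le_of_lt hω
    · have h5 : (|C| + 1) / ε.toReal * (P n).real {ω | (|C| + 1) / ε.toReal ≤ X ⟨n, ω⟩ ^ 2}
          ≤ |C| + 1 := h3.trans (h2.trans ((le_abs_self C).trans (by linarith)))
      rw [div_mul_eq_mul_div, div_le_iff₀ hε'] at h5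
      exact le_of_mul_le_mul_left h5 hD
  exact (ENNReal.le_ofReal_iff_toReal_le (measure_ne_top _ _) (by positivity)).2 h4 |>.trans
    (ENNReal.ofReal_toReal htop).le

/-- **Slutsky's theorem** for real random variables on varying probability spaces. -/
lemma TendstoInDistribution.of_tendsto_sub_whp [∀ n, IsProbabilityMeasure (P n)]
    {Ω' : Type*} [MeasurableSpace Ω'] {P' : Measure Ω'} [IsProbabilityMeasure P'] {Z : Ω' → ℝ}
    {X Y : ∀ n, Ω n → ℝ} (hX : TendstoInDistribution X atTop Z P P')
    (hY : ∀ n, AEMeasurable (Y n) (P n))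
    (hXY : Tendsto (fun x : Σ n, Ω n => Y x.1 x.2 - X x.1 x.2) (whp P) (𝓝 0)) :
    TendstoInDistribution Y atTop Z P P' where
  forall_aemeasurable := hY
  aemeasurable_limit := hX.aemeasurable_limit
  tendsto := by
    have hXt := ProbabilityMeasure.tendsto_iff_tendsto_charFun.1 hX.tendsto
    refine ProbabilityMeasure.tendsto_iff_tendsto_charFun.2 fun t => ?_
    -- Where `|Y - X| < ε / (4(|t| + 1))` the two exponentials differ by at most `ε/4`; on the
    -- exceptional set `A`, of probability at most `ε/8`, they differ by at most 2. The `+ 1` covers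
    -- `t = 0`.
    have key : Tendsto (fun n => charFun ((P n).map (Y n)) t - charFun ((P n).map (X n)) t)
        atTop (𝓝 0) := by
      rw [Metric.tendsto_nhds]
      intro ε hε
      have h1 := (Metric.tendsto_nhds.1 hXY) (ε / (4 * (|t| + 1))) (by positivity)
      rw [eventually_whp_iff, ENNReal.tendsto_nhds_zero] at h1
      filter_upwards [h1 (ENNReal.ofReal (ε / 8)) (by simpa using by positivity)] with n hn
      have hYn := hY n
      have hXn := hX.forall_aemeasurable n
      have hmeas : ∀ V : Ω n → ℝ, AEMeasurable V (P n) →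
          charFun ((P n).map V) t = ∫ ω, Complex.exp (t * V ω * Complex.I) ∂(P n) := by
        intro V hV
        rw [charFun_apply_real, integral_map hV (by fun_prop)]
      have hintg : ∀ V : Ω n → ℝ, AEMeasurable V (P n) →
          Integrable (fun ω => Complex.exp (t * V ω * Complex.I)) (P n) := by
        intro V hV
        refine Integrable.of_bound (C := 1) (by fun_prop) (ae_of_all _ fun ω => ?_)
        have := Complex.norm_exp_ofReal_mul_I (t * V ω)
        push_cast at this
        exact this.le
      rw [dist_zero_right, hmeas _ hYn, hmeas _ hXn, ← integral_sub (hintg _ hYn) (hintg _ hXn)]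
      set A : Set (Ω n) := {ω | ¬ dist (Y n ω - X n ω) 0 < ε / (4 * (|t| + 1))} with hA
      have hAm : NullMeasurableSet A (P n) := by
        have : AEMeasurable (fun ω => dist (Y n ω - X n ω) 0) (P n) := by fun_prop
        exact (nullMeasurableSet_lt this aemeasurable_const).compl
      have hbound : ∀ ω, ‖Complex.exp (t * Y n ω * Complex.I) - Complex.exp (t * X n ω * Complex.I)‖
          ≤ ε / 4 + A.indicator (fun _ => 2) ω := by
        intro ω
        by_cases hω : ω ∈ A
        · rw [Set.indicator_of_mem hω]
          refine (norm_sub_le _ _).trans ?_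
          have h1 := Complex.norm_exp_ofReal_mul_I (t * Y n ω)
          have h2 := Complex.norm_exp_ofReal_mul_I (t * X n ω)
          push_cast at h1 h2
          rw [h1, h2]
          linarith
        · rw [Set.indicator_of_notMem hω, add_zero]
          have h3 : |Y n ω - X n ω| < ε / (4 * (|t| + 1)) := by
            simpa [hA] using hω
          have h4 : Complex.exp (t * Y n ω * Complex.I) - Complex.exp (t * X n ω * Complex.I)
              = Complex.exp (t * X n ω * Complex.I) *
                (Complex.exp (Complex.I * ((t * (Y n ω - X n ω) : ℝ) : ℂ)) - 1) := by
            rw [mul_sub, ← Complex.exp_add, mul_one]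
            congr 2
            push_cast
            ring
          have h5 := Complex.norm_exp_ofReal_mul_I (t * X n ω)
          push_cast at h5
          rw [h4, norm_mul, h5, one_mul]
          refine (Real.norm_exp_I_mul_ofReal_sub_one_le).trans ?_
          rw [Real.norm_eq_abs, abs_mul]
          have h6 : |t| * |Y n ω - X n ω| ≤ (|t| + 1) * (ε / (4 * (|t| + 1))) := by
            gcongr
            linarith
          refine h6.trans (le_of_eq ?_)
          field_simp
      have hindint : Integrable (A.indicator (fun _ => (2 : ℝ))) (P n) :=
        (integrable_const 2).indicator₀ hAm
      calc _ ≤ ∫ ω, (ε / 4 + A.indicator (fun _ => (2 : ℝ)) ω) ∂(P n) :=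
            norm_integral_le_of_norm_le ((integrable_const _).add hindint) (ae_of_all _ hbound)
        _ = ε / 4 + 2 * (P n).real A := by
            rw [integral_add (integrable_const _) hindint, integral_indicator₀ hAm]
            simp [mul_comm]
        _ ≤ ε / 4 + 2 * (ε / 8) := by
            have : (P n).real A ≤ ε / 8 := by
              have := ENNReal.toReal_mono ENNReal.ofReal_ne_top hn
              rwa [ENNReal.toReal_ofReal (by positivity)] at this
            linarith
        _ < ε := by linarith
    have := key.add (hXt t)
    rw [zero_add] at this
    refine this.congr fun n => ?_
    simp

end ConvergenceInProbability

/-! ### Triangular arrays with i.i.d. rows of a fixed law -/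

section IIDArray

variable {Ω : ℕ → Type*} [∀ n, MeasurableSpace (Ω n)] {E : Type*} [MeasurableSpace E]

/-- A triangular array whose rows are i.i.d. with law `μ`. -/
structure IIDArray (μ : Measure E) (P : ∀ n, Measure (Ω n)) (X : ∀ n, Fin n → Ω n → E) :
    Prop where
  indep : ∀ n, iIndepFun (X n) (P n)
  law : ∀ n i, HasLaw (X n i) μ (P n)

/-- The sum `n^{-1/2} ∑ i, f (X i)` over a row of an array. -/
noncomputable def normSum (X : ∀ n, Fin n → Ω n → E) (f : E → ℝ) (x : Σ n, Ω n) : ℝ :=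
  (√(x.1 : ℝ))⁻¹ * ∑ i, f (X x.1 i x.2)

/-- The average `n⁻¹ ∑ i, f (X i)` over a row of an array. -/
noncomputable def rowAvg (X : ∀ n, Fin n → Ω n → E) (f : E → ℝ) (x : Σ n, Ω n) : ℝ :=
  (x.1 : ℝ)⁻¹ * ∑ i, f (X x.1 i x.2)

omit [∀ n, MeasurableSpace (Ω n)] [MeasurableSpace E] in
lemma rowAvg_eq (X : ∀ n, Fin n → Ω n → E) (f : E → ℝ) (x : Σ n, Ω n) :
    rowAvg X f x = (√(x.1 : ℝ))⁻¹ * normSum X f x := by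
  rw [rowAvg, normSum, ← mul_assoc, ← mul_inv, Real.mul_self_sqrt (Nat.cast_nonneg _)]

lemma tendsto_inv_sqrt_natCast : Tendsto (fun n : ℕ => (√(n : ℝ))⁻¹) atTop (𝓝 0) :=
  tendsto_inv_atTop_zero.comp (Real.tendsto_sqrt_atTop.comp tendsto_natCast_atTop_atTop)

namespace IIDArray

variable {μ : Measure E} [IsProbabilityMeasure μ] {P : ∀ n, Measure (Ω n)}
  [∀ n, IsProbabilityMeasure (P n)] {X : ∀ n, Fin n → Ω n → E}

omit [IsProbabilityMeasure μ] [∀ n, IsProbabilityMeasure (P n)] in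
lemma ae_all (hX : IIDArray μ P X) {p : E → Prop} (hp : ∀ᵐ y ∂μ, p y) (n : ℕ) :
    ∀ᵐ ω ∂(P n), ∀ i, p (X n i ω) := by
  refine ae_all_iff.2 fun i => ?_
  have := (hX.law n i).map_eq
  exact ae_of_ae_map (hX.law n i).aemeasurable (this ▸ hp)

omit [IsProbabilityMeasure μ] [∀ n, IsProbabilityMeasure (P n)] in
lemma memLp (hX : IIDArray μ P X) {f : E → ℝ} (hf : MemLp f 2 μ) (n : ℕ) (i : Fin n) :
    MemLp (fun ω => f (X n i ω)) 2 (P n) := by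
  have h := (hX.law n i).map_eq
  rw [← h] at hf
  exact hf.comp_of_map (hX.law n i).aemeasurable

omit [IsProbabilityMeasure μ] [∀ n, IsProbabilityMeasure (P n)] in
lemma aemeasurable_sum (hX : IIDArray μ P X) {f : E → ℝ} (hf : Measurable f) (n : ℕ) :
    AEMeasurable (fun ω => ∑ i, f (X n i ω)) (P n) :=
  Finset.aemeasurable_fun_sum _ fun i _ => hf.comp_aemeasurable (hX.law n i).aemeasurable

omit [IsProbabilityMeasure μ] [∀ n, IsProbabilityMeasure (P n)] in
lemma indep_comp (hX : IIDArray μ P X) {f : E → ℝ} (hf : Measurable f) (n : ℕ) :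
    iIndepFun (fun i ω => f (X n i ω)) (P n) := (hX.indep n).comp (fun _ => f) fun _ => hf

-- Independence makes the second moment of the normalized sum equal to `Var[f; μ]` in every nonempty
-- row, so Chebyshev's inequality applies with one constant.
omit [IsProbabilityMeasure μ] in
lemma bddInProb_normSum (hX : IIDArray μ P X) {f : E → ℝ} (hf : Measurable f)
    (hf2 : MemLp f 2 μ) (hf0 : ∫ y, f y ∂μ = 0) : BddInProb P (normSum X f) := by
  have hmem : ∀ n, MemLp (fun ω => normSum X f ⟨n, ω⟩) 2 (P n) := fun n =>
    (memLp_finsetSum Finset.univ fun i _ => hX.memLp hf2 n i).const_mul (√(n : ℝ))⁻¹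
  refine BddInProb.of_sq_integral_le (C := Var[f; μ])
    (Eventually.of_forall fun n => (hmem n).integrable_sq) ?_
  filter_upwards [eventually_ge_atTop 1] with n hn
  have hn0 : (n : ℝ) ≠ 0 := by positivity
  have hmean : ∀ i, ∫ ω, f (X n i ω) ∂(P n) = 0 := fun i =>
    ((hX.law n i).integral_comp hf.aestronglyMeasurable).trans hf0
  have h0 : ∫ ω, normSum X f ⟨n, ω⟩ ∂(P n) = 0 := by
    simp only [normSum]
    rw [integral_const_mul, integral_finsetSum Finset.univ fun i _ =>
      (hX.memLp hf2 n i).integrable one_le_two]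
    simp [hmean]
  rw [← variance_of_integral_eq_zero (hmem n).aemeasurable h0]
  simp only [normSum]
  rw [variance_const_mul, show (fun ω => ∑ i, f (X n i ω)) = ∑ i, fun ω => f (X n i ω) by
    ext; simp, IndepFun.variance_sum (fun i _ => hX.memLp hf2 n i)
      (fun i _ j _ hij => (hX.indep_comp hf n).indepFun hij)]
  have hv : ∀ i, Var[fun ω => f (X n i ω); P n] = Var[f; μ] := fun i => by
    rw [← (hX.law n i).map_eq, variance_map hf.aemeasurable (hX.law n i).aemeasurable]
    rfl
  simp [hv, hn0]

lemma bddInProb_normSum_sub (hX : IIDArray μ P X) {f : E → ℝ} (hf : Measurable f)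
    (hf2 : MemLp f 2 μ) :
    BddInProb P (fun x => normSum X f x - √(x.1 : ℝ) * ∫ y, f y ∂μ) := by
  have h := hX.bddInProb_normSum (f := fun y => f y - ∫ z, f z ∂μ) (hf.sub_const _)
    (hf2.sub (memLp_const _)) (by
      rw [integral_sub (hf2.integrable one_le_two) (integrable_const _)]; simp)
  convert h using 2 with x
  rw [normSum, normSum, Finset.sum_sub_distrib, mul_sub]
  congr 1
  rw [Finset.sum_const, Finset.card_univ, Fintype.card_fin, nsmul_eq_mul, ← mul_assoc]
  congr 1
  rw [inv_mul_eq_div, Real.div_sqrt]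

/-- The weak law of large numbers. -/
lemma tendsto_rowAvg (hX : IIDArray μ P X) {f : E → ℝ} (hf : Measurable f)
    (hf2 : MemLp f 2 μ) : Tendsto (rowAvg X f) (whp P) (𝓝 (∫ y, f y ∂μ)) := by
  have h := ((hX.bddInProb_normSum_sub hf hf2).mul_tendsto
    (tendsto_inv_sqrt_natCast.comp tendsto_fst_whp)).add_const (∫ y, f y ∂μ)
  rw [zero_add] at h
  refine h.congr' ?_
  filter_upwards [tendsto_fst_whp.eventually (eventually_ge_atTop 1)] with x hx
  have : √(x.1 : ℝ) ≠ 0 := by positivity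
  rw [rowAvg_eq, Function.comp_apply]
  field_simp
  ring

/-- The central limit theorem. -/
lemma tendstoInDistribution_normSum (hX : IIDArray μ P X) {f : E → ℝ} (hf : Measurable f)
    (hf2 : MemLp f 2 μ) (hf0 : ∫ y, f y ∂μ = 0) :
    TendstoInDistribution (fun n ω => normSum X f ⟨n, ω⟩) atTop (id : ℝ → ℝ) P
      (gaussianReal 0 (∫ y, f y ^ 2 ∂μ).toNNReal) where
  forall_aemeasurable n := (hX.aemeasurable_sum hf n).const_mul (√(n : ℝ))⁻¹
  tendsto := by
    -- The central limit theorem for one infinite i.i.d. sequence is transferred to the array: a row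
    -- sum has the same characteristic function as the partial sum of a sequence with law `μ`,
    -- namely a power of that of `f` under `μ`.
    obtain ⟨Ω', mΩ', Q, Y, hYm, hYl, hYi, hQ⟩ := exists_iid ℕ μ
    have hvar : Var[fun ω => f (Y 0 ω); Q] = ∫ y, f y ^ 2 ∂μ := by
      have : Var[f; μ] = ∫ y, f y ^ 2 ∂μ := variance_of_integral_eq_zero hf.aemeasurable hf0
      rw [← this, ← (hYl 0).map_eq, variance_map hf.aemeasurable (hYl 0).aemeasurable]
      rfl
    have hmean : ∫ ω, f (Y 0 ω) ∂Q = 0 :=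
      ((hYl 0).integral_comp hf.aestronglyMeasurable).trans hf0
    have hmem : MemLp (fun ω => f (Y 0 ω)) 2 Q := by
      have h := (hYl 0).map_eq
      rw [← h] at hf2
      exact hf2.comp_of_map (hYl 0).aemeasurable
    have hclt := tendstoInDistribution_inv_sqrt_mul_sum_sub (P := Q)
      (X := fun i ω => f (Y i ω)) (Y := (id : ℝ → ℝ))
      (P' := gaussianReal 0 (∫ y, f y ^ 2 ∂μ).toNNReal)
      (by rw [hvar]; exact HasLaw.id) hmem (hYi.comp (fun _ => f) fun _ => hf)
      (fun i => by
        refine ⟨(hf.comp (hYm i)).aemeasurable, (hf.comp (hYm 0)).aemeasurable, ?_⟩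
        change Q.map (f ∘ Y i) = Q.map (f ∘ Y 0)
        rw [← Measure.map_map hf (hYm i), ← Measure.map_map hf (hYm 0), (hYl i).map_eq,
          (hYl 0).map_eq])
    have ht := ProbabilityMeasure.tendsto_iff_tendsto_charFun.1 hclt.tendsto
    refine ProbabilityMeasure.tendsto_iff_tendsto_charFun.2 fun t => ?_
    refine (ht t).congr fun n => ?_
    simp only [ProbabilityMeasure.coe_mk, hmean, mul_zero, sub_zero, normSum]
    have hYi' : iIndepFun (fun i ω => f (Y i ω)) Q := hYi.comp (fun _ => f) fun _ => hf
    have hmX : ∀ i, AEMeasurable (fun ω => f (X n i ω)) (P n) := fun i =>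
      hf.comp_aemeasurable (hX.law n i).aemeasurable
    have hmY : ∀ i, AEMeasurable (fun ω => f (Y i ω)) Q := fun i => (hf.comp (hYm i)).aemeasurable
    rw [charFun_map_mul_comp (by fun_prop), charFun_map_mul_comp (hX.aemeasurable_sum hf n),
      (hX.indep_comp hf n).charFun_map_fun_sum_eq_prod hmX,
      (hYi'.restrict _).charFun_map_fun_finsetSum_eq_prod fun i _ => hmY i]
    have h1 : ∀ i, Q.map (fun ω => f (Y i ω)) = μ.map f := fun i => by
      rw [← (hYl i).map_eq, Measure.map_map hf (hYm i)]
      rfl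
    have h2 : ∀ i, (P n).map (fun ω => f (X n i ω)) = μ.map f := fun i => by
      rw [← (hX.law n i).map_eq, AEMeasurable.map_map_of_aemeasurable hf.aemeasurable
        (hX.law n i).aemeasurable]
      rfl
    simp only [h1, h2, Finset.prod_const, Finset.card_range, Finset.card_univ, Fintype.card_fin]

end IIDArray

end IIDArray

/-! ### Random functions with bounded Lipschitz derivatives -/

section SmoothRandomFunctions

variable {𝒳 : Type*} [MeasurableSpace 𝒳] {E V : Type*} [NormedAddCommGroup E] [NormedSpace ℝ E]
  [NormedAddCommGroup V] [NormedSpace ℝ V] [MeasurableSpace V] [BorelSpace V]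
  [SecondCountableTopology V]

/-- A random function that, on the set `T`, is bounded and has a bounded Lipschitz derivative,
uniformly over the randomness. -/
structure SmoothBdd (F : 𝒳 → E → V) (T : Set E) (C : ℝ) : Prop where
  measurable : ∀ p, Measurable fun x => F x p
  differentiable : ∀ x, Differentiable ℝ (F x)
  norm_le : ∀ x, ∀ p ∈ T, ‖F x p‖ ≤ C
  norm_fderiv_le : ∀ x, ∀ p ∈ T, ‖fderiv ℝ (F x) p‖ ≤ C
  lipschitz_fderiv : ∀ x, ∀ p ∈ T, ∀ q ∈ T,
    ‖fderiv ℝ (F x) q - fderiv ℝ (F x) p‖ ≤ C * ‖q - p‖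

namespace SmoothBdd

variable {F : 𝒳 → E → V} {T : Set E} {C : ℝ}

omit [BorelSpace V] [SecondCountableTopology V] in
lemma of_contDiff (hm : ∀ p, Measurable fun x => F x p) (hF : ∀ x, ContDiff ℝ 2 (F x))
    (hT : Convex ℝ T) (hC : ∀ x, ∀ r ≤ 2, ∀ p ∈ T, ‖iteratedFDeriv ℝ r (F x) p‖ ≤ C) :
    SmoothBdd F T C where
  measurable := hm
  differentiable x := (hF x).differentiable two_ne_zero
  norm_le x p hp := by simpa using hC x 0 (by norm_num) p hp
  norm_fderiv_le x p hp := by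
    simpa [norm_iteratedFDeriv_one] using hC x 1 (by norm_num) p hp
  lipschitz_fderiv x p hp q hq := by
    have hd : Differentiable ℝ (fderiv ℝ (F x)) :=
      ((hF x).fderiv_right (m := 1) (by norm_num)).differentiable one_ne_zero
    refine hT.norm_image_sub_le_of_norm_fderiv_le (𝕜 := ℝ) (fun y _ => hd y) (fun y hy => ?_) hp hq
    rw [← norm_iteratedFDeriv_one, norm_iteratedFDeriv_fderiv]
    exact hC x 2 le_rfl y hy

-- The mean value inequality on the segment from `p` to `q`, where the derivative moves by at most
-- `C * ‖q - p‖`. The constant does not depend on `x`, which is what lets the bound be integrated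
-- and summed.
omit [BorelSpace V] [SecondCountableTopology V] in
lemma taylor (hF : SmoothBdd F T C) (hT : Convex ℝ T) (x : 𝒳) {p q : E} (hp : p ∈ T) (hq : q ∈ T) :
    ‖F x q - F x p - fderiv ℝ (F x) p (q - p)‖ ≤ C * ‖q - p‖ ^ 2 := by
  have hC : 0 ≤ C := (norm_nonneg _).trans (hF.norm_le x p hp)
  have hs : segment ℝ p q ⊆ T := hT.segment_subset hp hq
  rw [pow_two, ← mul_assoc]
  refine (convex_segment p q).norm_image_sub_le_of_norm_hasFDerivWithin_le'
    (f' := fun y => fderiv ℝ (F x) y)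
    (fun y _ => (hF.differentiable x y).hasFDerivAt.hasFDerivWithinAt) (fun y hy => ?_)
    (left_mem_segment ℝ p q) (right_mem_segment ℝ p q)
  refine (hF.lipschitz_fderiv x p hp y (hs hy)).trans ?_
  gcongr
  obtain ⟨a, b, ha, hb, hab, rfl⟩ := hy
  have : a • p + b • q - p = b • (q - p) := by
    have : a = 1 - b := by linarith
    subst this
    module
  rw [this, norm_smul, Real.norm_of_nonneg hb]
  nlinarith [norm_nonneg (q - p)]

/-- A directional derivative is the pointwise limit of difference quotients with step `1/(n+1)`,
each measurable in `x`. -/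
lemma measurable_fderiv (hF : SmoothBdd F T C) (p v : E) :
    Measurable fun x => fderiv ℝ (F x) p v := by
  have hlim : ∀ x, Tendsto (fun n : ℕ => ((n : ℝ) + 1) • (F x (p + ((n : ℝ) + 1)⁻¹ • v) - F x p))
      atTop (𝓝 (fderiv ℝ (F x) p v)) := by
    intro x
    refine (hF.differentiable x p).hasFDerivAt.lim v (c := fun n : ℕ => (n : ℝ) + 1) ?_
    refine tendsto_norm_atTop_atTop.comp ?_
    exact tendsto_atTop_add_const_right _ _ tendsto_natCast_atTop_atTop
  refine measurable_of_tendsto_metrizable (fun n => ?_) (tendsto_pi_nhds.2 hlim)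
  exact ((hF.measurable _).sub (hF.measurable _)).const_smul _

omit [BorelSpace V] [SecondCountableTopology V] in
lemma norm_fderiv_apply_le (hF : SmoothBdd F T C) {p : E} (hp : p ∈ T) (v : E) (x : 𝒳) :
    ‖fderiv ℝ (F x) p v‖ ≤ C * ‖v‖ :=
  (ContinuousLinearMap.le_opNorm _ _).trans
    (mul_le_mul_of_nonneg_right (hF.norm_fderiv_le x p hp) (norm_nonneg _))

section Mean

variable {Λ : Measure 𝒳} [IsProbabilityMeasure Λ]

lemma integrable (hF : SmoothBdd F T C) {p : E} (hp : p ∈ T) : Integrable (fun x => F x p) Λ :=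
  Integrable.of_bound (hF.measurable p).aestronglyMeasurable C
    (ae_of_all _ fun x => hF.norm_le x p hp)

lemma integrable_fderiv (hF : SmoothBdd F T C) {p : E} (hp : p ∈ T) (v : E) :
    Integrable (fun x => fderiv ℝ (F x) p v) Λ :=
  Integrable.of_bound (hF.measurable_fderiv p v).aestronglyMeasurable (C * ‖v‖)
    (ae_of_all _ fun x => hF.norm_fderiv_apply_le hp v x)

omit [BorelSpace V] [SecondCountableTopology V] in
lemma norm_integral_le (hF : SmoothBdd F T C) {p : E} (hp : p ∈ T) : ‖∫ x, F x p ∂Λ‖ ≤ C := by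
  simpa using norm_integral_le_of_norm_le_const (μ := Λ) (ae_of_all _ fun x => hF.norm_le x p hp)

/-- The Taylor remainder is quadratic uniformly in `x`, hence stays quadratic after integration. The
candidate derivative is built one direction at a time, so that only `V`-valued functions, never
operator-valued ones, have to be integrated. -/
lemma exists_hasFDerivAt_integral (hF : SmoothBdd F T C) (hT : Convex ℝ T) (hTo : IsOpen T) {p : E}
    (hp : p ∈ T) : ∃ L : E →L[ℝ] V, HasFDerivAt (fun q => ∫ x, F x q ∂Λ) L p ∧
      ∀ v, L v = ∫ x, fderiv ℝ (F x) p v ∂Λ := by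
  let L₀ : E →ₗ[ℝ] V :=
    { toFun := fun v => ∫ x, fderiv ℝ (F x) p v ∂Λ
      map_add' := fun v w => by
        simp only [map_add]
        exact integral_add (hF.integrable_fderiv hp v) (hF.integrable_fderiv hp w)
      map_smul' := fun c v => by
        simp only [map_smul, RingHom.id_apply]
        exact integral_smul c _ }
  let L : E →L[ℝ] V := L₀.mkContinuous C fun v => by
    change ‖∫ x, fderiv ℝ (F x) p v ∂Λ‖ ≤ _
    simpa using norm_integral_le_of_norm_le_const (μ := Λ)
      (ae_of_all _ fun x => hF.norm_fderiv_apply_le hp v x)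
  refine ⟨L, ?_, fun v => rfl⟩
  refine HasFDerivAt.of_isLittleO ?_
  have hO : (fun q => (∫ x, F x q ∂Λ) - (∫ x, F x p ∂Λ) - L (q - p)) =O[𝓝 p]
      fun q => ‖q - p‖ ^ 2 := by
    refine Asymptotics.IsBigO.of_bound C ?_
    filter_upwards [hTo.mem_nhds hp] with q hq
    have h1 : (∫ x, F x q ∂Λ) - (∫ x, F x p ∂Λ) - L (q - p)
        = ∫ x, (F x q - F x p - fderiv ℝ (F x) p (q - p)) ∂Λ := by
      rw [integral_sub (f := fun x => F x q - F x p)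
        ((hF.integrable hq).sub (hF.integrable hp)) (hF.integrable_fderiv hp _),
        integral_sub (hF.integrable hq) (hF.integrable hp)]
      rfl
    rw [h1, Real.norm_of_nonneg (by positivity)]
    simpa using norm_integral_le_of_norm_le_const (μ := Λ)
      (ae_of_all _ fun x => hF.taylor hT x hp hq)
  refine hO.trans_isLittleO ?_
  have h2 : Tendsto (fun q => q - p) (𝓝 p) (𝓝 0) := by
    simpa using (continuous_id.sub continuous_const).tendsto (x := p) (f := fun q => q - p)
  exact ((Asymptotics.isLittleO_norm_pow_id one_lt_two).comp_tendsto h2)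

lemma differentiableAt_integral (hF : SmoothBdd F T C) (hT : Convex ℝ T) (hTo : IsOpen T) {p : E}
    (hp : p ∈ T) : DifferentiableAt ℝ (fun q => ∫ x, F x q ∂Λ) p :=
  (hF.exists_hasFDerivAt_integral hT hTo hp).choose_spec.1.differentiableAt

lemma fderiv_integral_apply (hF : SmoothBdd F T C) (hT : Convex ℝ T) (hTo : IsOpen T) {p : E}
    (hp : p ∈ T) (v : E) :
    fderiv ℝ (fun q => ∫ x, F x q ∂Λ) p v = ∫ x, fderiv ℝ (F x) p v ∂Λ := by
  obtain ⟨L, hL, hLv⟩ := hF.exists_hasFDerivAt_integral (Λ := Λ) hT hTo hp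
  rw [hL.fderiv, hLv]

lemma taylor_mean (hF : SmoothBdd F T C) (hT : Convex ℝ T) (hTo : IsOpen T) {p q : E}
    (hp : p ∈ T) (hq : q ∈ T) :
    ‖(∫ x, F x q ∂Λ) - (∫ x, F x p ∂Λ) - fderiv ℝ (fun q => ∫ x, F x q ∂Λ) p (q - p)‖
      ≤ C * ‖q - p‖ ^ 2 := by
  rw [hF.fderiv_integral_apply hT hTo hp, ← integral_sub (hF.integrable hq) (hF.integrable hp),
    ← integral_sub (f := fun x => F x q - F x p)
      ((hF.integrable hq).sub (hF.integrable hp)) (hF.integrable_fderiv hp _)]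
  simpa using norm_integral_le_of_norm_le_const (μ := Λ)
    (ae_of_all _ fun x => hF.taylor hT x hp hq)

/-- The mean of a random function with bounded Lipschitz derivative is of the same kind. -/
lemma mean (hF : SmoothBdd F T C) (hT : Convex ℝ T) (hTo : IsOpen T) :
    (∀ p ∈ T, ‖fderiv ℝ (fun q => ∫ x, F x q ∂Λ) p‖ ≤ C) ∧
    ∀ p ∈ T, ∀ q ∈ T, ‖fderiv ℝ (fun q => ∫ x, F x q ∂Λ) q - fderiv ℝ (fun q => ∫ x, F x q ∂Λ) p‖
      ≤ C * ‖q - p‖ := by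
  have hC : ∀ p ∈ T, 0 ≤ C := fun p hp =>
    (norm_nonneg _).trans (hF.norm_integral_le (Λ := Λ) hp)
  refine ⟨fun p hp => ContinuousLinearMap.opNorm_le_bound _ (hC p hp) fun v => ?_,
    fun p hp q hq => ContinuousLinearMap.opNorm_le_bound _
      (mul_nonneg (hC p hp) (norm_nonneg _)) fun v => ?_⟩
  · rw [hF.fderiv_integral_apply hT hTo hp]
    simpa using norm_integral_le_of_norm_le_const (μ := Λ)
      (ae_of_all _ fun x => hF.norm_fderiv_apply_le hp v x)
  · rw [_root_.sub_apply, hF.fderiv_integral_apply hT hTo hp,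
      hF.fderiv_integral_apply hT hTo hq,
      ← integral_sub (hF.integrable_fderiv hq v) (hF.integrable_fderiv hp v)]
    simpa using norm_integral_le_of_norm_le_const (μ := Λ) (ae_of_all _ fun x => by
      rw [← _root_.sub_apply]
      exact (ContinuousLinearMap.le_opNorm _ _).trans
        (mul_le_mul_of_nonneg_right (hF.lipschitz_fderiv x p hp q hq) (norm_nonneg v)))

end Mean

lemma sub {G : 𝒳 → E → V} {C' : ℝ} (hF : SmoothBdd F T C) (hG : SmoothBdd G T C') :
    SmoothBdd (fun x p => F x p - G x p) T (C + C') where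
  measurable p := (hF.measurable p).sub (hG.measurable p)
  differentiable x := (hF.differentiable x).sub (hG.differentiable x)
  norm_le x p hp := (norm_sub_le _ _).trans (add_le_add (hF.norm_le x p hp) (hG.norm_le x p hp))
  norm_fderiv_le x p hp := by
    rw [fderiv_fun_sub (hF.differentiable x p) (hG.differentiable x p)]
    exact (norm_sub_le _ _).trans (add_le_add (hF.norm_fderiv_le x p hp) (hG.norm_fderiv_le x p hp))
  lipschitz_fderiv x p hp q hq := by
    rw [fderiv_fun_sub (hF.differentiable x p) (hG.differentiable x p),
      fderiv_fun_sub (hF.differentiable x q) (hG.differentiable x q), sub_sub_sub_comm, add_mul]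
    exact (norm_sub_le _ _).trans
      (add_le_add (hF.lipschitz_fderiv x p hp q hq) (hG.lipschitz_fderiv x p hp q hq))

omit [SecondCountableTopology V] in
lemma clm_comp {V' : Type*} [NormedAddCommGroup V'] [NormedSpace ℝ V'] [MeasurableSpace V']
    [BorelSpace V'] (hF : SmoothBdd F T C) (L : V →L[ℝ] V') :
    SmoothBdd (fun x p => L (F x p)) T (‖L‖ * C) where
  measurable p := L.continuous.measurable.comp (hF.measurable p)
  differentiable x := L.differentiable.comp (hF.differentiable x)
  norm_le x p hp := (L.le_opNorm _).trans (by gcongr; exact hF.norm_le x p hp)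
  norm_fderiv_le x p hp := by
    rw [show (fun p => L (F x p)) = L ∘ F x from rfl,
      fderiv_comp p L.differentiableAt (hF.differentiable x p), L.fderiv]
    exact (ContinuousLinearMap.opNorm_comp_le _ _).trans
      (by gcongr; exact hF.norm_fderiv_le x p hp)
  lipschitz_fderiv x p hp q hq := by
    rw [show (fun p => L (F x p)) = L ∘ F x from rfl,
      fderiv_comp p L.differentiableAt (hF.differentiable x p),
      fderiv_comp q L.differentiableAt (hF.differentiable x q), L.fderiv, L.fderiv, ← ContinuousLinearMap.comp_sub, mul_assoc]
    exact (ContinuousLinearMap.opNorm_comp_le _ _).trans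
      (by gcongr; exact hF.lipschitz_fderiv x p hp q hq)

lemma smul (hF : SmoothBdd F T C) {a : 𝒳 → ℝ} (ha : Measurable a) {K : ℝ} (hK : ∀ x, |a x| ≤ K) :
    SmoothBdd (fun x p => a x • F x p) T (K * C) where
  measurable p := ha.smul (hF.measurable p)
  differentiable x := (hF.differentiable x).const_smul (a x)
  norm_le x p hp := by
    rw [norm_smul]
    exact mul_le_mul (hK x) (hF.norm_le x p hp) (norm_nonneg _) ((abs_nonneg _).trans (hK x))
  norm_fderiv_le x p hp := by
    rw [fderiv_fun_const_smul (hF.differentiable x p), norm_smul]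
    exact mul_le_mul (hK x) (hF.norm_fderiv_le x p hp) (norm_nonneg _)
      ((abs_nonneg _).trans (hK x))
  lipschitz_fderiv x p hp q hq := by
    rw [fderiv_fun_const_smul (hF.differentiable x p), fderiv_fun_const_smul (hF.differentiable x q),
      ← smul_sub, norm_smul, mul_assoc]
    exact mul_le_mul (hK x) (hF.lipschitz_fderiv x p hp q hq) (norm_nonneg _)
      ((abs_nonneg _).trans (hK x))

omit [BorelSpace V] [SecondCountableTopology V] in
lemma comp_measurable {𝒴 : Type*} [MeasurableSpace 𝒴] (hF : SmoothBdd F T C) {s : 𝒴 → 𝒳}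
    (hs : Measurable s) : SmoothBdd (fun y => F (s y)) T C where
  measurable p := (hF.measurable p).comp hs
  differentiable _ := hF.differentiable _
  norm_le _ := hF.norm_le _
  norm_fderiv_le _ := hF.norm_fderiv_le _
  lipschitz_fderiv _ := hF.lipschitz_fderiv _

end SmoothBdd

end SmoothRandomFunctions

/-! ### Zeros of vector fields on a box -/

section Box

variable {J : ℕ}

lemma isCompact_priceBox (l u : Fin J → ℝ) : IsCompact (priceBox l u) := by
  have h : priceBox l u = WithLp.toLp 2 '' Set.Icc l u := by
    ext p
    constructor
    · exact fun hp => ⟨p.ofLp, ⟨fun j => (hp j).1, fun j => (hp j).2⟩, rfl⟩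
    · rintro ⟨q, hq, rfl⟩
      exact fun j => ⟨hq.1 j, hq.2 j⟩
  rw [h]
  exact isCompact_Icc.image (PiLp.continuous_toLp 2 _)

lemma convex_priceBox (l u : Fin J → ℝ) : Convex ℝ (priceBox l u) := by
  intro p hp q hq a b ha hb hab j
  simp only [PiLp.add_apply, PiLp.smul_apply, smul_eq_mul]
  obtain ⟨h1, h2⟩ := hp j
  obtain ⟨h3, h4⟩ := hq j
  have hb' : b = 1 - a := by linarith
  subst hb'
  constructor <;> nlinarith

/-- The nearest point of a box. -/
noncomputable def clampBox (a b : Fin J → ℝ) (p : Goods J) : Goods J :=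
  WithLp.toLp 2 fun j => max (a j) (min (b j) (p j))

lemma clampBox_mem {a b : Fin J → ℝ} (hab : ∀ j, a j ≤ b j) (p : Goods J) :
    clampBox a b p ∈ priceBox a b :=
  fun j => ⟨le_max_left _ _, max_le (hab j) (min_le_left _ _)⟩

lemma clampBox_of_mem {a b : Fin J → ℝ} {p : Goods J} (hp : p ∈ priceBox a b) :
    clampBox a b p = p := by
  ext j
  simp [clampBox, (hp j).1, (hp j).2]

lemma norm_clampBox_sub_le (a b : Fin J → ℝ) (p q : Goods J) :
    ‖clampBox a b p - clampBox a b q‖ ≤ ‖p - q‖ := by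
  rw [EuclideanSpace.norm_eq, EuclideanSpace.norm_eq]
  refine Real.sqrt_le_sqrt (Finset.sum_le_sum fun j _ => ?_)
  refine pow_le_pow_left₀ (norm_nonneg _) ?_ 2
  simp only [PiLp.sub_apply, Real.norm_eq_abs, clampBox]
  exact (abs_max_sub_max_le_max _ _ _ _).trans (max_le (by simp)
    ((abs_min_sub_min_le_max _ _ _ _).trans (max_le (by simp) le_rfl)))

/-- A vector field `f` that points inwards on the boundary of a box and for which `id + f` is a
contraction of the box has exactly one zero in the box. -/
lemma existsUnique_zero_of_contraction {a b : Fin J → ℝ} (hab : ∀ j, a j ≤ b j)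
    {f : Goods J → Goods J} {q : ℝ} (hq0 : 0 ≤ q) (hq : q < 1)
    (hf : ∀ p ∈ priceBox a b, ∀ p' ∈ priceBox a b, ‖p + f p - (p' + f p')‖ ≤ q * ‖p - p'‖)
    (hup : ∀ p ∈ priceBox a b, ∀ j, p j = b j → f p j ≤ 0)
    (hlow : ∀ p ∈ priceBox a b, ∀ j, p j = a j → 0 ≤ f p j) :
    ∃! p, p ∈ priceBox a b ∧ f p = 0 := by
  -- Clamping before and after `id + f` extends the map to the whole space without increasing its
  -- Lipschitz constant, so Banach's theorem applies to the full space.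
  let g : Goods J → Goods J := fun p => clampBox a b (clampBox a b p + f (clampBox a b p))
  have hg : ContractingWith ⟨q, hq0⟩ g := by
    refine ⟨by exact_mod_cast hq, LipschitzWith.of_dist_le_mul fun p p' => ?_⟩
    rw [dist_eq_norm, dist_eq_norm]
    refine (norm_clampBox_sub_le _ _ _ _).trans
      ((hf _ (clampBox_mem hab p) _ (clampBox_mem hab p')).trans ?_)
    exact mul_le_mul_of_nonneg_left (norm_clampBox_sub_le _ _ _ _) hq0
  set p := ContractingWith.fixedPoint g hg with hpdef
  have hp : g p = p := hg.fixedPoint_isFixedPt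
  have hmem : p ∈ priceBox a b := hp ▸ clampBox_mem hab _
  have hfix : clampBox a b (p + f p) = p := by
    have : g p = clampBox a b (p + f p) := by simp only [g, clampBox_of_mem hmem]
    rw [← this, hp]
  refine ⟨p, ⟨hmem, ?_⟩, ?_⟩
  · ext j
    have hj : max (a j) (min (b j) (p j + f p j)) = p j := by
      conv_rhs => rw [← hfix]
      simp [clampBox]
    have h1 := hup p hmem j
    have h2 := hlow p hmem j
    obtain ⟨h3, h4⟩ := hmem j
    rw [PiLp.zero_apply]
    -- A nonzero `f p j` can leave `p j` fixed only if the clamp is active: a negative value forces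
    -- `p j = a j`, a positive one `p j = b j`. Both contradict the inward-pointing signs.
    rcases lt_trichotomy (f p j) 0 with h | h | h
    · exfalso
      rcases max_choice (a j) (min (b j) (p j + f p j)) with h5 | h5
      · have := h2 (by rw [← hj, h5])
        linarith
      · have h6 : p j ≤ p j + f p j := by
          conv_lhs => rw [← hj, h5]
          exact min_le_right _ _
        linarith
    · exact h
    · exfalso
      rcases min_choice (b j) (p j + f p j) with h5 | h5
      · rw [h5, max_eq_right (hab j)] at hj
        linarith [h1 hj.symm]
      · have h6 := le_max_right (a j) (min (b j) (p j + f p j))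
        rw [hj, h5] at h6
        linarith
  · rintro p' ⟨hp', hz⟩
    have hfix' : Function.IsFixedPt g p' := by
      change clampBox a b (clampBox a b p' + f (clampBox a b p')) = p'
      rw [clampBox_of_mem hp', hz, add_zero, clampBox_of_mem hp']
    exact hg.fixedPoint_unique hfix'

end Box

/-! ### The mean field -/

section MeanField

lemma integral_prod_treatmentLaw {𝒢 V : Type*} [MeasurableSpace 𝒢] [NormedAddCommGroup V]
    [NormedSpace ℝ V] [CompleteSpace V] {Θ : Measure 𝒢} [IsProbabilityMeasure Θ]
    {π : unitInterval} {f : 𝒢 × Bool → V} (hf : Integrable f (Θ.prod (treatmentLaw π))) :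
    ∫ x, f x ∂(Θ.prod (treatmentLaw π))
      = (π : ℝ) • ∫ g, f (g, true) ∂Θ + (1 - π : ℝ) • ∫ g, f (g, false) ∂Θ := by
  rw [integral_prod_symm _ hf, integral_bernoulliMeasure]

variable {J : ℕ} {𝒢 : Type*} [MeasurableSpace 𝒢] {M : Economy J 𝒢}

namespace Economy

/-- The random functions of an economy are smooth, uniformly on an open convex set. -/
structure SmoothOn (M : Economy J 𝒢) (T : Set (Goods J)) (C : ℝ) : Prop where
  isOpen : IsOpen T
  convex : Convex ℝ T
  nonneg : 0 ≤ C
  outcome : SmoothBdd (fun x : 𝒢 × Bool => M.outcome x.1 x.2) T C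
  demand : SmoothBdd (fun x : 𝒢 × Bool => M.demand x.1 x.2) T C
  supply : SmoothBdd (fun x : 𝒢 × Bool => M.supply x.1 x.2) T C

lemma Regular.exists_smoothOn {l u : Fin J → ℝ} (h : M.Regular l u) :
    ∃ T C, priceBox l u ⊆ T ∧ M.SmoothOn T C := by
  obtain ⟨δ, hδ, C, hC⟩ := h.bounded
  have hT : Convex ℝ (Metric.thickening δ (priceBox l u)) := (convex_priceBox l u).thickening δ
  have hsub := Metric.thickening_subset_cthickening δ (priceBox l u)
  have hmeas : ∀ {V : Type} [MeasurableSpace V] (F : 𝒢 → Bool → V),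
      (∀ w, Measurable fun g => F g w) → Measurable fun x : 𝒢 × Bool => F x.1 x.2 := by
    intro V _ F hF
    exact measurable_from_prod_countable_left hF
  -- The open thickening is convex because the box is, and the assumed bounds hold on the closed
  -- thickening containing it. Passing to `|C|` makes the constant nonnegative.
  refine ⟨_, |C|, Metric.self_subset_thickening hδ _, Metric.isOpen_thickening, hT, abs_nonneg C,
    .of_contDiff (fun p => hmeas (fun g w => M.outcome g w p) fun w => h.measurable_outcome w p)
      (fun x => h.contDiff_outcome _ _) hT fun x r hr p hp => ?_,
    .of_contDiff (fun p => hmeas (fun g w => M.demand g w p) fun w => h.measurable_demand w p)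
      (fun x => h.contDiff_demand _ _) hT fun x r hr p hp => ?_,
    .of_contDiff (fun p => hmeas (fun g w => M.supply g w p) fun w => h.measurable_supply w p)
      (fun x => h.contDiff_supply _ _) hT fun x r hr p hp => ?_⟩
  · exact (hC x.1 x.2 r hr p (hsub hp)).1.trans (le_abs_self C)
  · exact (hC x.1 x.2 r hr p (hsub hp)).2.1.trans (le_abs_self C)
  · exact (hC x.1 x.2 r hr p (hsub hp)).2.2.trans (le_abs_self C)

namespace SmoothOn

variable {T : Set (Goods J)} {C : ℝ} {Θ : Measure 𝒢} [IsProbabilityMeasure Θ]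

lemma excess (h : M.SmoothOn T C) :
    SmoothBdd (fun x : 𝒢 × Bool => M.excess x.1 x.2) T (C + C) := h.demand.sub h.supply

lemma excess_of (h : M.SmoothOn T C) (w : Bool) :
    SmoothBdd (fun g : 𝒢 => M.excess g w) T (C + C) :=
  h.excess.comp_measurable (s := fun g => (g, w)) (by fun_prop)

lemma mixedExcess_eq (h : M.SmoothOn T C) (ρ : ℝ) {p : Goods J} (hp : p ∈ T) :
    M.mixedExcess Θ ρ p
      = ρ • ∫ g, M.excess g true p ∂Θ + (1 - ρ) • ∫ g, M.excess g false p ∂Θ := by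
  have key : ∀ w, ∫ g, M.excess g w p ∂Θ = M.meanDemand Θ w p - M.meanSupply Θ w p := fun w =>
    integral_sub
      ((h.demand.comp_measurable (s := fun g => (g, w)) (by fun_prop)).integrable hp)
      ((h.supply.comp_measurable (s := fun g => (g, w)) (by fun_prop)).integrable hp)
  rw [key, key, mixedExcess]

/-- Reading `z_π` as a single mean over pairs (individual, treatment) makes the results on means of
`SmoothBdd` functions available, and these pairs are what the experiment samples. -/
lemma mixedExcess_eq_integral (h : M.SmoothOn T C) (π : unitInterval) {p : Goods J} (hp : p ∈ T) :
    M.mixedExcess Θ π p = ∫ x, M.excess x.1 x.2 p ∂(Θ.prod (treatmentLaw π)) := by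
  rw [h.mixedExcess_eq _ hp, integral_prod_treatmentLaw (h.excess.integrable hp)]

lemma mixedOutcome_eq_integral (h : M.SmoothOn T C) (π : unitInterval) {p : Goods J} (hp : p ∈ T) :
    M.mixedOutcome Θ π p = ∫ x, M.outcome x.1 x.2 p ∂(Θ.prod (treatmentLaw π)) := by
  rw [integral_prod_treatmentLaw (h.outcome.integrable hp)]
  rfl

lemma fderiv_mixedExcess (h : M.SmoothOn T C) (π : unitInterval) {p : Goods J} (hp : p ∈ T) :
    fderiv ℝ (M.mixedExcess Θ π) p
      = fderiv ℝ (fun q => ∫ x, M.excess x.1 x.2 q ∂(Θ.prod (treatmentLaw π))) p := by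
  refine Filter.EventuallyEq.fderiv_eq ?_
  filter_upwards [h.isOpen.mem_nhds hp] with q hq using h.mixedExcess_eq_integral π hq

lemma fderiv_mixedOutcome (h : M.SmoothOn T C) (π : unitInterval) {p : Goods J} (hp : p ∈ T) :
    fderiv ℝ (M.mixedOutcome Θ π) p
      = fderiv ℝ (fun q => ∫ x, M.outcome x.1 x.2 q ∂(Θ.prod (treatmentLaw π))) p := by
  refine Filter.EventuallyEq.fderiv_eq ?_
  filter_upwards [h.isOpen.mem_nhds hp] with q hq using h.mixedOutcome_eq_integral π hq

lemma differentiableAt_mixedExcess (h : M.SmoothOn T C) (π : unitInterval) {p : Goods J}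
    (hp : p ∈ T) : DifferentiableAt ℝ (M.mixedExcess Θ π) p := by
  refine (h.excess.differentiableAt_integral (Λ := Θ.prod (treatmentLaw π)) h.convex h.isOpen
    hp).congr_of_eventuallyEq ?_
  filter_upwards [h.isOpen.mem_nhds hp] with q hq using h.mixedExcess_eq_integral π hq

lemma lipschitz_fderiv_mixedExcess (h : M.SmoothOn T C) (π : unitInterval) {p q : Goods J}
    (hp : p ∈ T) (hq : q ∈ T) :
    ‖fderiv ℝ (M.mixedExcess Θ π) q - fderiv ℝ (M.mixedExcess Θ π) p‖ ≤ (C + C) * ‖q - p‖ := by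
  rw [h.fderiv_mixedExcess π hp, h.fderiv_mixedExcess π hq]
  exact (h.excess.mean h.convex h.isOpen).2 p hp q hq

lemma continuousOn_fderiv_mixedExcess (h : M.SmoothOn T C) (π : unitInterval) :
    ContinuousOn (fun p => fderiv ℝ (M.mixedExcess Θ π) p) T := by
  have : LipschitzOnWith ⟨C + C, add_nonneg h.nonneg h.nonneg⟩
      (fun p => fderiv ℝ (M.mixedExcess Θ π) p) T :=
    LipschitzOnWith.of_dist_le_mul fun p hp q hq => by
      rw [dist_eq_norm, dist_eq_norm]
      exact h.lipschitz_fderiv_mixedExcess π hq hp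
  exact this.continuousOn

end SmoothOn

end Economy

end MeanField

/-! ### Existence, uniqueness and differentiability of the mean-field price. -/

section MeanFieldPrice

variable {J : ℕ} {𝒢 : Type*} [MeasurableSpace 𝒢] {M : Economy J 𝒢}

namespace Economy

variable {T : Set (Goods J)} {C : ℝ} {Θ : Measure 𝒢} [IsProbabilityMeasure Θ]
  {l u : Fin J → ℝ} {π : unitInterval}

-- If `u j < l j`, a price with `j`-th coordinate `u j` would give some individual an excess demand
-- that is both negative and nonnegative.
omit [IsProbabilityMeasure Θ] in
lemma BoundaryCondition.lower_le_upper (hb : M.BoundaryCondition Θ l u) (j : Fin J) :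
    l j ≤ u j := by
  by_contra! hlt
  obtain ⟨A, -, hA, hAj⟩ := hb.upper_strict true j
  obtain ⟨g, hg⟩ := nonempty_of_measure_ne_zero hA.ne'
  have h1 := hAj g hg (WithLp.toLp 2 fun _ => u j) le_rfl
  have h2 := hb.lower g true (WithLp.toLp 2 fun _ => u j) j hlt.le
  linarith

/-- The contraction property of the mean field holds uniformly in a neighbourhood of the box. -/
lemma SmoothOn.exists_contraction (h : M.SmoothOn T C) (hsub : priceBox l u ⊆ T)
    (hlu : ∀ j, l j ≤ u j)
    (hc : ∀ p ∈ priceBox l u, ‖fderiv ℝ (fun q => M.mixedExcess Θ π q + q) p‖ < 1) :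
    ∃ q : ℝ, 0 ≤ q ∧ q < 1 ∧ ∃ η > 0, Metric.cthickening η (priceBox l u) ⊆ T ∧
      ∀ p ∈ Metric.cthickening η (priceBox l u),
        ‖fderiv ℝ (M.mixedExcess Θ π) p + ContinuousLinearMap.id ℝ (Goods J)‖ < q := by
  have hcont : ContinuousOn
      (fun p => ‖fderiv ℝ (M.mixedExcess Θ π) p + ContinuousLinearMap.id ℝ (Goods J)‖) T :=
    ((h.continuousOn_fderiv_mixedExcess π).add continuousOn_const).norm
  have hlt : ∀ p ∈ priceBox l u,
      ‖fderiv ℝ (M.mixedExcess Θ π) p + ContinuousLinearMap.id ℝ (Goods J)‖ < 1 := by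
    intro p hp
    have := hc p hp
    rwa [fderiv_fun_add (h.differentiableAt_mixedExcess π (hsub hp)) differentiableAt_fun_id,
      fderiv_fun_id] at this
  have hcomp := isCompact_priceBox l u
  obtain ⟨p₀, hp₀, hmax⟩ := hcomp.exists_isMaxOn
    ⟨clampBox l u 0, clampBox_mem hlu 0⟩ (hcont.mono hsub)
  set q₀ := ‖fderiv ℝ (M.mixedExcess Θ π) p₀ + ContinuousLinearMap.id ℝ (Goods J)‖
  have hq₀ : q₀ < 1 := hlt p₀ hp₀
  have hq₀' : 0 ≤ q₀ := norm_nonneg _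
  -- The maximum `q₀` over the compact box is below 1, so the midpoint of `q₀` and 1 leaves room for
  -- the open condition to persist on a thickening.
  refine ⟨(q₀ + 1) / 2, by linarith, by linarith, ?_⟩
  have hopen := hcont.isOpen_inter_preimage h.isOpen (isOpen_Iio (a := (q₀ + 1) / 2))
  obtain ⟨η, hη, hηs⟩ := hcomp.exists_cthickening_subset_open hopen (fun p hp =>
    ⟨hsub hp, lt_of_le_of_lt (b := q₀) (hmax hp) (by linarith)⟩)
  exact ⟨η, hη, fun p hp => (hηs hp).1, fun p hp => (hηs hp).2⟩

lemma norm_add_sub_add_le_of_fderiv {f : Goods J → Goods J} {K : Set (Goods J)} {q : ℝ}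
    (hK : Convex ℝ K) (hd : ∀ p ∈ K, DifferentiableAt ℝ f p)
    (hq : ∀ p ∈ K, ‖fderiv ℝ f p + ContinuousLinearMap.id ℝ (Goods J)‖ ≤ q)
    {p p' : Goods J} (hp : p ∈ K) (hp' : p' ∈ K) : ‖p + f p - (p' + f p')‖ ≤ q * ‖p - p'‖ := by
  refine hK.norm_image_sub_le_of_norm_fderiv_le (𝕜 := ℝ) (f := fun x => x + f x)
    (fun x hx => differentiableAt_id.add (hd x hx)) (fun x hx => ?_) hp' hp
  rw [fderiv_fun_add differentiableAt_fun_id (hd x hx), fderiv_fun_id, add_comm]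
  exact hq x hx

lemma SmoothOn.mixedExcess_apply_nonpos (h : M.SmoothOn T C) (hb : M.BoundaryCondition Θ l u)
    {ρ : ℝ} (h0 : 0 ≤ ρ) (h1 : ρ ≤ 1) {p : Goods J} (hp : p ∈ T) {j : Fin J} (hj : u j ≤ p j) :
    M.mixedExcess Θ ρ p j ≤ 0 := by
  have key : ∀ w, (∫ g, M.excess g w p ∂Θ) j ≤ 0 := fun w => by
    have := (EuclideanSpace.proj (𝕜 := ℝ) j).integral_comp_comm ((h.excess_of w).integrable
      (Λ := Θ) hp)
    change ∫ g, M.excess g w p j ∂Θ = _ at this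
    refine this.symm.trans_le ?_
    exact integral_nonpos fun g => hb.upper g w p j hj
  rw [h.mixedExcess_eq ρ hp]
  simp only [PiLp.add_apply, PiLp.smul_apply, smul_eq_mul]
  have h2 : 0 ≤ 1 - ρ := by linarith
  nlinarith [mul_nonneg h0 (neg_nonneg.2 (key true)), mul_nonneg h2 (neg_nonneg.2 (key false))]

lemma SmoothOn.mixedExcess_apply_nonneg (h : M.SmoothOn T C) (hb : M.BoundaryCondition Θ l u)
    {ρ : ℝ} (h0 : 0 ≤ ρ) (h1 : ρ ≤ 1) {p : Goods J} (hp : p ∈ T) {j : Fin J} (hj : p j ≤ l j) :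
    0 ≤ M.mixedExcess Θ ρ p j := by
  have key : ∀ w, 0 ≤ (∫ g, M.excess g w p ∂Θ) j := fun w => by
    have := (EuclideanSpace.proj (𝕜 := ℝ) j).integral_comp_comm ((h.excess_of w).integrable
      (Λ := Θ) hp)
    change ∫ g, M.excess g w p j ∂Θ = _ at this
    refine le_trans ?_ this.le
    exact integral_nonneg fun g => hb.lower g w p j hj
  rw [h.mixedExcess_eq ρ hp]
  simp only [PiLp.add_apply, PiLp.smul_apply, smul_eq_mul]
  have h2 : 0 ≤ 1 - ρ := by linarith
  exact add_nonneg (mul_nonneg h0 (key true)) (mul_nonneg h2 (key false))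

/-- The effect of treatment on mean excess demand at the price `p`. -/
noncomputable def excessEffect (M : Economy J 𝒢) (Θ : Measure 𝒢) (p : Goods J) : Goods J :=
  ∫ g, M.excess g true p ∂Θ - ∫ g, M.excess g false p ∂Θ

/-- `z_ρ` is affine in `ρ`, so every statement about nearby `ρ` reduces to `z_π` plus a small
multiple of the treatment effect. -/
lemma SmoothOn.mixedExcess_sub (h : M.SmoothOn T C) (ρ ρ' : ℝ) {p : Goods J} (hp : p ∈ T) :
    M.mixedExcess Θ ρ p = M.mixedExcess Θ ρ' p + (ρ - ρ') • M.excessEffect Θ p := by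
  rw [h.mixedExcess_eq ρ hp, h.mixedExcess_eq ρ' hp, excessEffect]
  module

lemma SmoothOn.norm_excessEffect_le (h : M.SmoothOn T C) {p : Goods J} (hp : p ∈ T) :
    ‖M.excessEffect Θ p‖ ≤ 4 * C := by
  refine (norm_sub_le _ _).trans ?_
  have h1 := (h.excess_of true).norm_integral_le (Λ := Θ) hp
  have h2 := (h.excess_of false).norm_integral_le (Λ := Θ) hp
  linarith

lemma SmoothOn.norm_excessEffect_sub_le (h : M.SmoothOn T C) {p q : Goods J} (hp : p ∈ T)
    (hq : q ∈ T) : ‖M.excessEffect Θ q - M.excessEffect Θ p‖ ≤ 4 * C * ‖q - p‖ := by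
  have key : ∀ w, ‖∫ g, M.excess g w q ∂Θ - ∫ g, M.excess g w p ∂Θ‖ ≤ (C + C) * ‖q - p‖ :=
    fun w => h.convex.norm_image_sub_le_of_norm_fderiv_le (𝕜 := ℝ)
      (fun x hx => (h.excess_of w).differentiableAt_integral h.convex h.isOpen hx)
      (fun x hx => ((h.excess_of w).mean h.convex h.isOpen).1 x hx) hp hq
  rw [excessEffect, excessEffect, sub_sub_sub_comm]
  refine (norm_sub_le _ _).trans ?_
  linarith [key true, key false]

/-- Changing `π` to `ρ` raises the contraction factor of `id + z` by at most `4C|ρ - π|`, so it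
stays below 1 near `π`; the boundary signs survive because `z_ρ` is a convex combination of the two
treatment means for `ρ` in `[0, 1]`. -/
lemma SmoothOn.eventually_existsUnique (h : M.SmoothOn T C) (hsub : priceBox l u ⊆ T)
    (hb : M.BoundaryCondition Θ l u) (hπ0 : 0 < π) (hπ1 : π < 1)
    (hc : ∀ p ∈ priceBox l u, ‖fderiv ℝ (fun q => M.mixedExcess Θ π q + q) p‖ < 1) :
    ∀ᶠ ρ : ℝ in 𝓝 (π : ℝ), ∃! p, M.IsMeanFieldPrice Θ l u ρ p := by
  obtain ⟨q, hq0, hq1, η, hη, hηT, hηq⟩ := h.exists_contraction hsub hb.lower_le_upper hc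
  have hbox : priceBox l u ⊆ Metric.cthickening η (priceBox l u) :=
    Metric.self_subset_cthickening _
  have hlim : Tendsto (fun ρ : ℝ => q + |ρ - π| * (4 * C)) (𝓝 (π : ℝ)) (𝓝 q) := by
    have : Continuous fun ρ : ℝ => q + |ρ - π| * (4 * C) := by fun_prop
    simpa using this.tendsto (π : ℝ)
  filter_upwards [hlim.eventually (gt_mem_nhds hq1), lt_mem_nhds (show (0 : ℝ) < π from hπ0),
    gt_mem_nhds (show (π : ℝ) < 1 from hπ1)] with ρ hρ hρ0 hρ1
  have hC := h.nonneg
  refine existsUnique_zero_of_contraction hb.lower_le_upper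
    (q := q + |ρ - π| * (4 * C)) (by positivity) hρ (fun p hp p' hp' => ?_)
    (fun p hp j hj => h.mixedExcess_apply_nonpos hb hρ0.le hρ1.le (hsub hp) hj.ge)
    (fun p hp j hj => h.mixedExcess_apply_nonneg hb hρ0.le hρ1.le (hsub hp) hj.le)
  have h1 := norm_add_sub_add_le_of_fderiv (convex_priceBox l u)
    (fun x hx => h.differentiableAt_mixedExcess (Θ := Θ) π (hsub hx))
    (fun x hx => (hηq x (hbox hx)).le) hp hp'
  have h2 := h.norm_excessEffect_sub_le (Θ := Θ) (hsub hp') (hsub hp)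
  rw [h.mixedExcess_sub ρ π (hsub hp), h.mixedExcess_sub ρ π (hsub hp')]
  have h3 : p + (M.mixedExcess Θ π p + (ρ - π) • M.excessEffect Θ p)
      - (p' + (M.mixedExcess Θ π p' + (ρ - π) • M.excessEffect Θ p'))
      = (p + M.mixedExcess Θ π p - (p' + M.mixedExcess Θ π p'))
        + (ρ - π) • (M.excessEffect Θ p - M.excessEffect Θ p') := by
    module
  rw [h3]
  refine (norm_add_le _ _).trans ?_
  rw [norm_smul, Real.norm_eq_abs, add_mul, mul_assoc]
  exact add_le_add h1 (mul_le_mul_of_nonneg_left h2 (abs_nonneg _))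

omit [MeasurableSpace 𝒢] [IsProbabilityMeasure Θ] in
lemma isMeanFieldPrice_meanFieldPrice [MeasurableSpace 𝒢] {Θ : Measure 𝒢} {ρ : ℝ}
    (h : ∃! p, M.IsMeanFieldPrice Θ l u ρ p) :
    M.IsMeanFieldPrice Θ l u ρ (M.meanFieldPrice Θ l u ρ) :=
  Classical.epsilon_spec h.exists

-- `gradExcess` is the transpose of the Jacobian, so the derivative acts by multiplying row vectors
-- from the left.
omit [IsProbabilityMeasure Θ] in
lemma fderiv_mixedExcess_apply (p v : Goods J) :
    (fderiv ℝ (M.mixedExcess Θ π) p v).ofLp = v.ofLp ᵥ* M.gradExcess Θ π p := by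
  ext j
  have hv : v = ∑ k, v k • EuclideanSpace.single k (1 : ℝ) := by
    ext i
    simp [Finset.sum_apply, Pi.single_apply]
  conv_lhs => rw [hv]
  simp [Matrix.vecMul, dotProduct, gradExcess, Finset.sum_apply]

/-- Triangle inequality for `v = (A + id) v - A v`. This quantitative injectivity turns a bound on
`A` applied to an error into a bound on the error. -/
lemma norm_le_of_contraction {A : Goods J →L[ℝ] Goods J} {q : ℝ}
    (hq : ‖A + ContinuousLinearMap.id ℝ (Goods J)‖ ≤ q) (v : Goods J) :
    (1 - q) * ‖v‖ ≤ ‖A v‖ := by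
  have h1 := (A + ContinuousLinearMap.id ℝ (Goods J)).le_of_opNorm_le hq v
  have h2 : ‖v‖ ≤ ‖(A + ContinuousLinearMap.id ℝ (Goods J)) v‖ + ‖A v‖ := by
    have : v = (A + ContinuousLinearMap.id ℝ (Goods J)) v - A v := by simp
    calc ‖v‖ = ‖(A + ContinuousLinearMap.id ℝ (Goods J)) v - A v‖ := by rw [← this]
      _ ≤ _ := norm_sub_le _ _
  linarith

/-- The derivative of the mean-field price in the treatment probability. -/
lemma SmoothOn.hasDerivAt_meanFieldPrice (h : M.SmoothOn T C) (hsub : priceBox l u ⊆ T)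
    (hb : M.BoundaryCondition Θ l u) (hπ0 : 0 < π) (hπ1 : π < 1) (hn : M.Nonsingular Θ l u π) :
    HasDerivAt (M.meanFieldPrice Θ l u)
      (WithLp.toLp 2 (-((M.excessEffect Θ (M.meanFieldPrice Θ l u π)).ofLp ᵥ*
        (M.gradExcess Θ π (M.meanFieldPrice Θ l u π))⁻¹))) (π : ℝ) := by
  have hex := h.eventually_existsUnique hsub hb hπ0 hπ1 hn.contraction
  obtain ⟨q, hq0, hq1, η, hη, hηT, hηq⟩ :=
    h.exists_contraction hsub hb.lower_le_upper hn.contraction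
  have hbox : priceBox l u ⊆ Metric.cthickening η (priceBox l u) :=
    Metric.self_subset_cthickening _
  have hC := h.nonneg
  set ps := M.meanFieldPrice Θ l u π with hps
  obtain ⟨hmem, hzero⟩ := isMeanFieldPrice_meanFieldPrice hex.self_of_nhds
  rw [← hps] at hmem hzero
  set D : Goods J := WithLp.toLp 2 (-((M.excessEffect Θ ps).ofLp ᵥ* (M.gradExcess Θ π ps)⁻¹))
    with hD
  -- `D` solves the equation obtained by formally differentiating `z_ρ(p*_ρ) = 0` at `π`.
  have hAD : fderiv ℝ (M.mixedExcess Θ π) ps D = -M.excessEffect Θ ps := by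
    have hdet := (Matrix.isUnit_iff_isUnit_det _).1 hn.jacobian
    ext j
    rw [fderiv_mixedExcess_apply, hD, Matrix.neg_vecMul, Matrix.vecMul_vecMul,
      Matrix.nonsing_inv_mul _ hdet, Matrix.vecMul_one]
    rfl
  have hA : ∀ v, (1 - q) * ‖v‖ ≤ ‖fderiv ℝ (M.mixedExcess Θ π) ps v‖ :=
    norm_le_of_contraction (hηq ps (hbox hmem)).le
  have hq' : 0 < 1 - q := by linarith
  -- The linearization error is shown to be quadratic in `ρ - π`.
  have key : ∀ᶠ ρ : ℝ in 𝓝 (π : ℝ),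
      ‖M.meanFieldPrice Θ l u ρ - ps - (ρ - π) • D‖
        ≤ (1 - q)⁻¹ * (4 * C * ((1 - q)⁻¹ * (4 * C))
          + (C + C) * ((1 - q)⁻¹ * (4 * C)) ^ 2) * ‖(ρ - π) ^ 2‖ := by
    filter_upwards [hex] with ρ hρ
    obtain ⟨hmemρ, hzeroρ⟩ := isMeanFieldPrice_meanFieldPrice hρ
    set pr := M.meanFieldPrice Θ l u ρ
    have hz : M.mixedExcess Θ π pr = -((ρ - π) • M.excessEffect Θ pr) := by
      rw [h.mixedExcess_sub ρ π (hsub hmemρ)] at hzeroρ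
      exact eq_neg_of_add_eq_zero_left hzeroρ
    -- Lipschitz dependence on `ρ`: compare the two prices by the contraction property of `id +
    -- z_π`, under which `ps` is fixed and `pr` moves by `(ρ - π)` times the effect.
    have hlip : ‖pr - ps‖ ≤ (1 - q)⁻¹ * (4 * C) * |ρ - π| := by
      have h1 := norm_add_sub_add_le_of_fderiv (convex_priceBox l u)
        (fun x hx => h.differentiableAt_mixedExcess (Θ := Θ) π (hsub hx))
        (fun x hx => (hηq x (hbox hx)).le) hmemρ hmem
      rw [hz, hzero, add_zero] at h1
      have h2 : ‖pr - ps‖ ≤ ‖pr + -((ρ - π) • M.excessEffect Θ pr) - ps‖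
          + ‖(ρ - π) • M.excessEffect Θ pr‖ := by
        refine le_trans (le_of_eq ?_) (norm_add_le _ _)
        congr 1
        abel
      rw [norm_smul, Real.norm_eq_abs] at h2
      have h3 := mul_le_mul_of_nonneg_left (h.norm_excessEffect_le (Θ := Θ) (hsub hmemρ))
        (abs_nonneg (ρ - π))
      rw [mul_assoc, ← div_eq_inv_mul, le_div_iff₀ hq']
      linarith
    have ht := h.excess.taylor_mean (Λ := Θ.prod (treatmentLaw π)) h.convex h.isOpen (hsub hmem)
      (hsub hmemρ)
    rw [← h.fderiv_mixedExcess π (hsub hmem), ← h.mixedExcess_eq_integral π (hsub hmem),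
      ← h.mixedExcess_eq_integral π (hsub hmemρ), hzero, sub_zero, hz] at ht
    have he := h.norm_excessEffect_sub_le (Θ := Θ) (hsub hmem) (hsub hmemρ)
    -- Applied to the linearization error, the derivative yields the variation of the treatment
    -- effect between the two prices and a Taylor remainder; by `hlip` both are `O((ρ - π)²)`.
    have hsplit : fderiv ℝ (M.mixedExcess Θ π) ps (pr - ps - (ρ - π) • D)
        = -((ρ - π) • (M.excessEffect Θ pr - M.excessEffect Θ ps))
          - (-((ρ - π) • M.excessEffect Θ pr) - fderiv ℝ (M.mixedExcess Θ π) ps (pr - ps)) := by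
      rw [map_sub, map_smul, hAD]
      module
    have hle : ‖fderiv ℝ (M.mixedExcess Θ π) ps (pr - ps - (ρ - π) • D)‖
        ≤ |ρ - π| * (4 * C * ((1 - q)⁻¹ * (4 * C) * |ρ - π|))
          + (C + C) * ((1 - q)⁻¹ * (4 * C) * |ρ - π|) ^ 2 := by
      rw [hsplit]
      refine (norm_sub_le _ _).trans (add_le_add ?_ (ht.trans ?_))
      · rw [norm_neg, norm_smul, Real.norm_eq_abs]
        gcongr
        exact he.trans (by gcongr)
      · gcongr
    have h5 := (hA _).trans hle
    rw [← le_div_iff₀' hq'] at h5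
    refine h5.trans (le_of_eq ?_)
    rw [norm_pow, Real.norm_eq_abs]
    ring
  rw [hasDerivAt_iff_isLittleO]
  refine (Asymptotics.IsBigO.of_bound _ key).trans_isLittleO ?_
  have h2 : Tendsto (fun ρ : ℝ => ρ - π) (𝓝 (π : ℝ)) (𝓝 0) := by
    simpa using (continuous_id.sub continuous_const).tendsto (x := (π : ℝ))
      (f := fun ρ : ℝ => ρ - π)
  exact (Asymptotics.isLittleO_pow_id one_lt_two).comp_tendsto h2

end Economy

end MeanFieldPrice

/-! ### Independent random signs -/

section Signs

variable {J : ℕ}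

/-- The law of `J` independent random signs. -/
noncomputable abbrev signsLaw (J : ℕ) : Measure (Fin J → ℝ) := Measure.pi fun _ => signLaw 1

lemma integral_signLaw (f : ℝ → ℝ) : ∫ s, f s ∂(signLaw 1) = (f 1 + f (-1)) / 2 := by
  rw [integral_bernoulliMeasure]
  simp only [smul_eq_mul]
  ring

lemma ae_signLaw : ∀ᵐ s ∂(signLaw 1), |s| ≤ 1 := by
  have : MeasurableSet {s : ℝ | |s| ≤ 1}ᶜ := (measurableSet_le (by fun_prop) (by fun_prop)).compl
  refine mem_ae_iff.2 ?_
  exact bernoulliMeasure_apply_of_notMem_of_notMem _ this (by simp) (by simp)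

lemma ae_signsLaw : ∀ᵐ ξ ∂(signsLaw J), ∀ k, |ξ k| ≤ 1 :=
  ae_all_iff.2 fun k => (Measure.quasiMeasurePreserving_eval (μ := fun _ : Fin J => signLaw 1) k).ae ae_signLaw

lemma integral_signsLaw_eval (k : Fin J) {f : ℝ → ℝ} (hf : Measurable f) :
    ∫ ξ, f (ξ k) ∂(signsLaw J) = (f 1 + f (-1)) / 2 := by
  have h := integral_map (μ := signsLaw J) (φ := Function.eval k) (f := f)
    (measurable_pi_apply k).aemeasurable hf.aestronglyMeasurable
  rw [(measurePreserving_eval (fun _ : Fin J => signLaw 1) k).map_eq, integral_signLaw] at h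
  exact h.symm

lemma integral_signsLaw (k : Fin J) : ∫ ξ, ξ k ∂(signsLaw J) = 0 := by
  rw [integral_signsLaw_eval k (f := fun s => s) measurable_id]
  simp

lemma integral_signsLaw_mul (k m : Fin J) :
    ∫ ξ, ξ k * ξ m ∂(signsLaw J) = if k = m then 1 else 0 := by
  split_ifs with hkm
  · subst hkm
    rw [integral_signsLaw_eval k (f := fun s => s * s) (by fun_prop)]
    norm_num
  · have hind : iIndepFun (fun (i : Fin J) (ξ : Fin J → ℝ) => ξ i) (signsLaw J) :=
      iIndepFun_pi (μ := fun _ : Fin J => signLaw 1) (X := fun _ s => s) fun _ => aemeasurable_id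
    have h := (hind.indepFun hkm).integral_fun_mul_eq_mul_integral
      (measurable_pi_apply k).aestronglyMeasurable (measurable_pi_apply m).aestronglyMeasurable
    rw [h, integral_signsLaw, zero_mul]

lemma norm_toLp_le_of_abs_le {ξ : Fin J → ℝ} (hξ : ∀ k, |ξ k| ≤ 1) :
    ‖(WithLp.toLp 2 ξ : Goods J)‖ ≤ √J := by
  rw [EuclideanSpace.norm_eq]
  refine Real.sqrt_le_sqrt ?_
  calc _ ≤ ∑ _k : Fin J, (1 : ℝ) := Finset.sum_le_sum fun k _ => by
        rw [Real.norm_eq_abs]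
        exact pow_le_one₀ (abs_nonneg _) (hξ k)
    _ = J := by simp

variable {𝒳 : Type*} [MeasurableSpace 𝒳] {Λ : Measure 𝒳} [IsProbabilityMeasure Λ]

omit [IsProbabilityMeasure Λ] in
lemma ae_prod_signsLaw : ∀ᵐ y ∂(Λ.prod (signsLaw J)), ∀ k, |y.2 k| ≤ 1 :=
  Measure.quasiMeasurePreserving_snd.ae ae_signsLaw

lemma memLp_mul_of_bound {f : 𝒳 → ℝ} (hf : Measurable f) {C : ℝ} (hC : ∀ x, |f x| ≤ C)
    {φ : (Fin J → ℝ) → ℝ} (hφ : Measurable φ) {K : ℝ}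
    (hK : ∀ ξ : Fin J → ℝ, (∀ k, |ξ k| ≤ 1) → |φ ξ| ≤ K) :
    MemLp (fun y : 𝒳 × (Fin J → ℝ) => f y.1 * φ y.2) 2 (Λ.prod (signsLaw J)) := by
  refine MemLp.of_bound (by fun_prop) (C * K) ?_
  filter_upwards [ae_prod_signsLaw] with y hy
  rw [Real.norm_eq_abs, abs_mul]
  exact mul_le_mul (hC _) (hK _ hy) (abs_nonneg _) ((abs_nonneg _).trans (hC y.1))

end Signs

/-- The rate of the perturbations: it is slower than `n^{-1/2}` and faster than `n^{-1/4}`. -/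
structure PerturbationRate (h : ℕ → ℝ) : Prop where
  pos : ∀ n, 1 ≤ n → 0 < h n
  tendsto_zero : Tendsto h atTop (𝓝 0)
  sqrt_mul_sq : Tendsto (fun n : ℕ => √(n : ℝ) * h n ^ 2) atTop (𝓝 0)
  inv_sqrt_mul : Tendsto (fun n : ℕ => (√(n : ℝ) * h n)⁻¹) atTop (𝓝 0)

/-- `α > 1/4` makes the bias `√n h²` vanish, and `α < 1/2` makes the signal `√n h` diverge. -/
lemma perturbationRate_rpow {c α : ℝ} (hc : 0 < c) (hα0 : 1 / 4 < α) (hα1 : α < 1 / 2) {h : ℕ → ℝ}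
    (hh : ∀ n : ℕ, h n = c * (n : ℝ) ^ (-α)) : PerturbationRate h := by
  have hneg : ∀ β : ℝ, 0 < β → Tendsto (fun n : ℕ => (n : ℝ) ^ (-β)) atTop (𝓝 0) := fun β hβ =>
    (tendsto_rpow_neg_atTop hβ).comp tendsto_natCast_atTop_atTop
  refine ⟨fun n hn => ?_, ?_, ?_, ?_⟩
  · have : (0 : ℝ) < n := by positivity
    rw [hh]
    positivity
  · have := (hneg α (by linarith)).const_mul c
    rw [mul_zero] at this
    exact this.congr fun n => (hh n).symm
  · have := (hneg (2 * α - 1 / 2) (by linarith)).const_mul (c ^ 2)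
    rw [mul_zero] at this
    refine this.congr' ?_
    filter_upwards [eventually_ge_atTop 1] with n hn
    have hn0 : (0 : ℝ) < n := by positivity
    rw [hh, Real.sqrt_eq_rpow, mul_pow, ← Real.rpow_natCast ((n : ℝ) ^ (-α)) 2, ← Real.rpow_mul hn0.le,
      mul_left_comm, ← Real.rpow_add hn0]
    congr 2
    push_cast
    ring
  · have := (hneg (1 / 2 - α) (by linarith)).const_mul c⁻¹
    rw [mul_zero] at this
    refine this.congr' ?_
    filter_upwards [eventually_ge_atTop 1] with n hn
    have hn0 : (0 : ℝ) < n := by positivity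
    rw [hh, Real.sqrt_eq_rpow, mul_left_comm, ← Real.rpow_add hn0, mul_inv, ← Real.rpow_neg hn0.le]
    congr 2

/-! ### Expansion of sums of randomly shifted random functions -/

section Expansion

variable {Ω : ℕ → Type*} [∀ n, MeasurableSpace (Ω n)] {P : ∀ n, Measure (Ω n)}
  [∀ n, IsProbabilityMeasure (P n)] {J : ℕ} {𝒳 : Type*} [MeasurableSpace 𝒳] {Λ : Measure 𝒳}
  [IsProbabilityMeasure Λ] {X : ∀ n, Fin n → Ω n → 𝒳 × (Fin J → ℝ)} {h : ℕ → ℝ} {p : Goods J}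
  {δ : (Σ n, Ω n) → Goods J} {a : (Fin J → ℝ) → ℝ} {F : 𝒳 → Goods J → ℝ} {T : Set (Goods J)}
  {C : ℝ}

/-- The weighted sum of the random function `F` at the points `p + δ + h ξ_i`. -/
noncomputable def shiftSum (X : ∀ n, Fin n → Ω n → 𝒳 × (Fin J → ℝ)) (h : ℕ → ℝ) (p : Goods J)
    (δ : (Σ n, Ω n) → Goods J) (a : (Fin J → ℝ) → ℝ) (F : 𝒳 → Goods J → ℝ) (x : Σ n, Ω n) : ℝ :=
  (√(x.1 : ℝ))⁻¹ * ∑ i, a (X x.1 i x.2).2 *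
    F (X x.1 i x.2).1 (p + (δ x + h x.1 • WithLp.toLp 2 (X x.1 i x.2).2))

/-- The partial derivative of a random function at `p`. -/
noncomputable def partialDeriv (F : 𝒳 → Goods J → ℝ) (p : Goods J) (m : Fin J) (x : 𝒳) : ℝ :=
  fderiv ℝ (F x) p (EuclideanSpace.single m 1)

lemma SmoothBdd.measurable_partialDeriv (hF : SmoothBdd F T C) (p : Goods J) (m : Fin J) :
    Measurable (partialDeriv F p m) := hF.measurable_fderiv p _

lemma SmoothBdd.abs_partialDeriv_le (hF : SmoothBdd F T C) (hp : p ∈ T) (m : Fin J) (x : 𝒳) :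
    |partialDeriv F p m x| ≤ C := by
  simpa [partialDeriv] using hF.norm_fderiv_apply_le hp (EuclideanSpace.single m 1) x

omit [MeasurableSpace 𝒳] in
lemma fderiv_apply_eq_sum (x : 𝒳) (v : Goods J) :
    fderiv ℝ (F x) p v = ∑ m, v m * partialDeriv F p m x := by
  have hv : v = ∑ k, v k • EuclideanSpace.single k (1 : ℝ) := by
    ext i
    simp [Finset.sum_apply, Pi.single_apply]
  conv_lhs => rw [hv]
  simp [partialDeriv]

-- Taylor's bound for each term, with `‖δ + h ξ_i‖² ≤ 2‖δ‖² + 2 J h²`; summing `n` terms against the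
-- factor `n^{-1/2}` produces the `√n`.
omit [∀ n, MeasurableSpace (Ω n)] in
lemma SmoothBdd.abs_shiftSum_sub_le (hF : SmoothBdd F T C) (hT : Convex ℝ T) (hp : p ∈ T)
    (x : Σ n, Ω n) (ha : ∀ i, |a (X x.1 i x.2).2| ≤ 1) (hξ : ∀ i k, |(X x.1 i x.2).2 k| ≤ 1)
    (hmem : ∀ i, p + (δ x + h x.1 • WithLp.toLp 2 (X x.1 i x.2).2) ∈ T) :
    |shiftSum X h p δ a F x - normSum X (fun y => F y.1 p * a y.2) x
      - ∑ m, δ x m * normSum X (fun y => partialDeriv F p m y.1 * a y.2) x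
      - h x.1 * ∑ m, normSum X (fun y => partialDeriv F p m y.1 * (a y.2 * y.2 m)) x|
    ≤ 2 * C * (√(x.1 : ℝ) * ‖δ x‖ ^ 2) + 2 * C * J * (√(x.1 : ℝ) * h x.1 ^ 2) := by
  -- `0 ≤ C` can be read off from any sampled individual. In an empty row there is none, but then
  -- both sides are zero.
  have hC : 0 ≤ C ∨ x.1 = 0 := by
    rcases Nat.eq_zero_or_pos x.1 with h0 | h0
    · exact Or.inr h0
    · exact Or.inl ((norm_nonneg _).trans (hF.norm_le (X x.1 ⟨0, h0⟩ x.2).1 p hp))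
  rcases hC with hC | h0
  swap
  · have : IsEmpty (Fin x.1) := by rw [h0]; infer_instance
    simp [shiftSum, normSum, h0]
  set v : Fin x.1 → Goods J := fun i => δ x + h x.1 • WithLp.toLp 2 (X x.1 i x.2).2 with hv
  have hexp : shiftSum X h p δ a F x - normSum X (fun y => F y.1 p * a y.2) x
      - ∑ m, δ x m * normSum X (fun y => partialDeriv F p m y.1 * a y.2) x
      - h x.1 * ∑ m, normSum X (fun y => partialDeriv F p m y.1 * (a y.2 * y.2 m)) x
      = (√(x.1 : ℝ))⁻¹ * ∑ i, a (X x.1 i x.2).2 * (F (X x.1 i x.2).1 (p + v i)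
        - F (X x.1 i x.2).1 p - fderiv ℝ (F (X x.1 i x.2).1) p (v i)) := by
    have h1 : ∑ m, δ x m * normSum X (fun y => partialDeriv F p m y.1 * a y.2) x
        = (√(x.1 : ℝ))⁻¹ * ∑ i, ∑ m,
          δ x m * (partialDeriv F p m (X x.1 i x.2).1 * a (X x.1 i x.2).2) := by
      simp only [normSum]
      rw [Finset.sum_comm, Finset.mul_sum]
      refine Finset.sum_congr rfl fun m _ => ?_
      rw [← Finset.mul_sum]
      ring
    have h2 : h x.1 * ∑ m, normSum X (fun y => partialDeriv F p m y.1 * (a y.2 * y.2 m)) x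
        = (√(x.1 : ℝ))⁻¹ * ∑ i, ∑ m, h x.1 *
          (partialDeriv F p m (X x.1 i x.2).1 * (a (X x.1 i x.2).2 * (X x.1 i x.2).2 m)) := by
      simp only [normSum]
      rw [Finset.sum_comm, Finset.mul_sum, Finset.mul_sum]
      refine Finset.sum_congr rfl fun m _ => ?_
      rw [← Finset.mul_sum]
      ring
    rw [h1, h2, shiftSum, normSum, ← mul_sub, ← mul_sub, ← mul_sub, ← Finset.sum_sub_distrib,
      ← Finset.sum_sub_distrib, ← Finset.sum_sub_distrib]
    congr 1
    refine Finset.sum_congr rfl fun i _ => ?_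
    rw [fderiv_apply_eq_sum, mul_sub, mul_sub, Finset.mul_sum, mul_comm (F _ p), sub_sub _ _
      (∑ m, h x.1 * _), ← Finset.sum_add_distrib]
    congr 1
    refine Finset.sum_congr rfl fun m _ => ?_
    simp only [hv, PiLp.add_apply, PiLp.smul_apply, smul_eq_mul]
    ring
  rw [hexp, abs_mul, abs_of_nonneg (by positivity : 0 ≤ (√(x.1 : ℝ))⁻¹)]
  have hterm : ∀ i, |a (X x.1 i x.2).2 * (F (X x.1 i x.2).1 (p + v i)
        - F (X x.1 i x.2).1 p - fderiv ℝ (F (X x.1 i x.2).1) p (v i))|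
      ≤ 2 * C * ‖δ x‖ ^ 2 + 2 * C * J * h x.1 ^ 2 := by
    intro i
    have ht := hF.taylor hT (X x.1 i x.2).1 hp (hmem i)
    rw [add_sub_cancel_left, Real.norm_eq_abs] at ht
    have hnv : ‖v i‖ ≤ ‖δ x‖ + |h x.1| * √J := by
      refine (norm_add_le _ _).trans ?_
      rw [norm_smul, Real.norm_eq_abs]
      gcongr
      exact norm_toLp_le_of_abs_le (hξ i)
    have hsq : ‖v i‖ ^ 2 ≤ 2 * ‖δ x‖ ^ 2 + 2 * J * h x.1 ^ 2 := by
      have h1 := pow_le_pow_left₀ (norm_nonneg _) hnv 2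
      have h2 : (|h x.1| * √J) ^ 2 = J * h x.1 ^ 2 := by
        rw [mul_pow, sq_abs, Real.sq_sqrt (Nat.cast_nonneg _), mul_comm]
      nlinarith [sq_nonneg (‖δ x‖ - |h x.1| * √J)]
    rw [abs_mul]
    calc _ ≤ 1 * (C * ‖v i‖ ^ 2) := mul_le_mul (ha i) ht (abs_nonneg _) zero_le_one
      _ ≤ C * (2 * ‖δ x‖ ^ 2 + 2 * J * h x.1 ^ 2) := by
        rw [one_mul]
        exact mul_le_mul_of_nonneg_left hsq hC
      _ = _ := by ring
  refine (mul_le_mul_of_nonneg_left ((Finset.abs_sum_le_sum_abs _ _).trans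
    (Finset.sum_le_sum fun i _ => hterm i)) (by positivity)).trans (le_of_eq ?_)
  rw [Finset.sum_const, Finset.card_univ, Fintype.card_fin, nsmul_eq_mul, ← mul_assoc,
    inv_mul_eq_div, Real.div_sqrt]
  ring

omit [∀ n, IsProbabilityMeasure (P n)] [IsProbabilityMeasure Λ] in
lemma tendsto_zero_of_sqrt_mul_sq {Y : (Σ n, Ω n) → ℝ} (hY0 : ∀ x, 0 ≤ Y x)
    (hY : Tendsto (fun x => √(x.1 : ℝ) * Y x ^ 2) (whp P) (𝓝 0)) : Tendsto Y (whp P) (𝓝 0) := by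
  have h1 : Tendsto (fun x => Y x ^ 2) (whp P) (𝓝 0) := by
    refine squeeze_zero' (Eventually.of_forall fun x => sq_nonneg _) ?_ hY
    filter_upwards [tendsto_fst_whp.eventually (eventually_ge_atTop 1)] with x hx
    have : (1 : ℝ) ≤ √(x.1 : ℝ) := Real.one_le_sqrt.2 (by exact_mod_cast hx)
    nlinarith [sq_nonneg (Y x)]
  have h2 := (Real.continuous_sqrt.tendsto 0).comp h1
  rw [Real.sqrt_zero] at h2
  exact h2.congr fun x => Real.sqrt_sq (hY0 x)

omit [∀ n, IsProbabilityMeasure (P n)] [IsProbabilityMeasure Λ] in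
/-- First-order expansion of a sum of randomly shifted random functions. -/
lemma IIDArray.tendsto_shiftSum_expansion (hX : IIDArray (Λ.prod (signsLaw J)) P X)
    (hr : PerturbationRate h) (hF : SmoothBdd F T C) (hT : Convex ℝ T) (hTo : IsOpen T)
    (hp : p ∈ T) (ha : ∀ ξ : Fin J → ℝ, (∀ k, |ξ k| ≤ 1) → |a ξ| ≤ 1)
    (hδ : Tendsto (fun x => √(x.1 : ℝ) * ‖δ x‖ ^ 2) (whp P) (𝓝 0)) :
    Tendsto (fun x => shiftSum X h p δ a F x - normSum X (fun y => F y.1 p * a y.2) x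
      - ∑ m, δ x m * normSum X (fun y => partialDeriv F p m y.1 * a y.2) x
      - h x.1 * ∑ m, normSum X (fun y => partialDeriv F p m y.1 * (a y.2 * y.2 m)) x)
      (whp P) (𝓝 0) := by
  have hδ0 : Tendsto (fun x => ‖δ x‖) (whp P) (𝓝 0) :=
    tendsto_zero_of_sqrt_mul_sq (fun _ => norm_nonneg _) hδ
  have hh0 : Tendsto (fun x : Σ n, Ω n => h x.1) (whp P) (𝓝 0) := hr.tendsto_zero.comp tendsto_fst_whp
  obtain ⟨r, hr0, hrT⟩ := Metric.isOpen_iff.1 hTo p hp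
  have hsmall : Tendsto (fun x => ‖δ x‖ + |h x.1| * √J) (whp P) (𝓝 0) := by
    simpa using hδ0.add (hh0.abs.mul_const (√J))
  have hbd : Tendsto (fun x : Σ n, Ω n => 2 * C * (√(x.1 : ℝ) * ‖δ x‖ ^ 2)
      + 2 * C * J * (√(x.1 : ℝ) * h x.1 ^ 2)) (whp P) (𝓝 0) := by
    simpa using (hδ.const_mul (2 * C)).add
      ((hr.sqrt_mul_sq.comp tendsto_fst_whp).const_mul (2 * C * J))
  refine squeeze_zero_norm' ?_ hbd
  filter_upwards [hsmall.eventually (gt_mem_nhds hr0),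
    eventually_whp_of_ae (p := fun x => ∀ i k, |(X x.1 i x.2).2 k| ≤ 1)
      (Eventually.of_forall fun n => hX.ae_all ae_prod_signsLaw n)] with x hx hξ
  refine hF.abs_shiftSum_sub_le hT hp x (fun i => ha _ (hξ i)) hξ fun i => hrT ?_
  rw [Metric.mem_ball, dist_eq_norm, add_sub_cancel_left]
  refine lt_of_le_of_lt ((norm_add_le _ _).trans ?_) hx
  rw [norm_smul, Real.norm_eq_abs]
  gcongr
  exact norm_toLp_le_of_abs_le (hξ i)

/-- The sum of randomly shifted random functions, weighted by a coordinate of the signs. -/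
lemma IIDArray.tendsto_shiftSum_sign (hX : IIDArray (Λ.prod (signsLaw J)) P X)
    (hr : PerturbationRate h) (hF : SmoothBdd F T C) (hT : Convex ℝ T) (hTo : IsOpen T)
    (hp : p ∈ T) (hδ : Tendsto (fun x => √(x.1 : ℝ) * ‖δ x‖ ^ 2) (whp P) (𝓝 0)) (k : Fin J) :
    Tendsto (fun x => shiftSum X h p δ (fun ξ => ξ k) F x - normSum X (fun y => F y.1 p * y.2 k) x
      - √(x.1 : ℝ) * h x.1 * ∫ x, partialDeriv F p k x ∂Λ) (whp P) (𝓝 0) := by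
  have hh0 : Tendsto (fun x : Σ n, Ω n => h x.1) (whp P) (𝓝 0) := hr.tendsto_zero.comp tendsto_fst_whp
  have hδm : ∀ m, Tendsto (fun x => δ x m) (whp P) (𝓝 0) := fun m =>
    squeeze_zero_norm (fun x => PiLp.norm_apply_le (δ x) m)
      (tendsto_zero_of_sqrt_mul_sq (fun _ => norm_nonneg _) hδ)
  have hexp := hX.tendsto_shiftSum_expansion hr hF hT hTo hp (a := fun ξ => ξ k)
    (fun ξ hξ => hξ k) hδ
  -- The sign has mean zero and is independent of the derivative, so each sum is bounded in
  -- probability and the factor `δ` sends it to zero.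
  have h1 : Tendsto (fun x => ∑ m, δ x m * normSum X (fun y => partialDeriv F p m y.1 * y.2 k) x)
      (whp P) (𝓝 0) := by
    rw [← Finset.sum_const_zero (s := (Finset.univ : Finset (Fin J)))]
    refine tendsto_finsetSum _ fun m _ => ?_
    have := (hX.bddInProb_normSum (f := fun y => partialDeriv F p m y.1 * y.2 k)
      (((hF.measurable_partialDeriv p m).comp measurable_fst).mul (by fun_prop))
      (memLp_mul_of_bound (hF.measurable_partialDeriv p m) (hF.abs_partialDeriv_le hp m)
        (φ := fun ξ => ξ k) (by fun_prop) (fun ξ hξ => hξ k))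
      (by rw [integral_prod_mul (μ := Λ) (ν := signsLaw J) (partialDeriv F p m) (fun ξ => ξ k),
            integral_signsLaw, mul_zero])).mul_tendsto (hδm m)
    exact this.congr fun x => mul_comm _ _
  have h2 : Tendsto (fun x => h x.1 * ∑ m,
      normSum X (fun y => partialDeriv F p m y.1 * (y.2 k * y.2 m)) x
      - √(x.1 : ℝ) * h x.1 * ∫ x, partialDeriv F p k x ∂Λ) (whp P) (𝓝 0) := by
    -- Since `E[ξ_k ξ_m]` is 1 or 0, only `m = k` has a drift; the fluctuations about it are
    -- `O_p(1)` and are killed by `h`.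
    have h3 : ∀ m, Tendsto (fun x => (normSum X (fun y => partialDeriv F p m y.1 * (y.2 k * y.2 m)) x
        - √(x.1 : ℝ) * (if k = m then ∫ x, partialDeriv F p k x ∂Λ else 0)) * h x.1)
        (whp P) (𝓝 0) := by
      intro m
      have h4 := hX.bddInProb_normSum_sub (f := fun y => partialDeriv F p m y.1 * (y.2 k * y.2 m))
        (((hF.measurable_partialDeriv p m).comp measurable_fst).mul (by fun_prop))
        (memLp_mul_of_bound (hF.measurable_partialDeriv p m) (hF.abs_partialDeriv_le hp m)
          (φ := fun ξ => ξ k * ξ m) (by fun_prop) (K := 1) (fun ξ hξ => by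
            rw [abs_mul]
            exact mul_le_one₀ (hξ k) (abs_nonneg _) (hξ m)))
      rw [integral_prod_mul (μ := Λ) (ν := signsLaw J) (partialDeriv F p m)
        (fun ξ => ξ k * ξ m), integral_signsLaw_mul] at h4
      have h5 : (∫ x, partialDeriv F p m x ∂Λ) * (if k = m then 1 else 0)
          = if k = m then ∫ x, partialDeriv F p k x ∂Λ else 0 := by
        split_ifs with hkm
        · rw [hkm, mul_one]
        · rw [mul_zero]
      rw [h5] at h4
      exact h4.mul_tendsto hh0
    have h6 := tendsto_finsetSum Finset.univ fun m _ => h3 m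
    rw [Finset.sum_const_zero] at h6
    refine h6.congr fun x => ?_
    rw [← Finset.sum_mul, Finset.sum_sub_distrib, ← Finset.mul_sum, Finset.sum_ite_eq]
    simp only [Finset.mem_univ, if_true]
    ring
  have h7 := (hexp.add h1).add h2
  simp only [add_zero] at h7
  refine h7.congr fun x => ?_
  ring

/-- The sum of randomly shifted random functions. -/
lemma IIDArray.tendsto_shiftSum_one (hX : IIDArray (Λ.prod (signsLaw J)) P X)
    (hr : PerturbationRate h) (hF : SmoothBdd F T C) (hT : Convex ℝ T) (hTo : IsOpen T)
    (hp : p ∈ T) (hδ : Tendsto (fun x => √(x.1 : ℝ) * ‖δ x‖ ^ 2) (whp P) (𝓝 0)) {b : ℕ → ℝ}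
    (hb : Tendsto b atTop (𝓝 0))
    (hbδ : Tendsto (fun x => b x.1 * (√(x.1 : ℝ) * ‖δ x‖)) (whp P) (𝓝 0)) :
    Tendsto (fun x => b x.1 * (shiftSum X h p δ (fun _ => 1) F x - √(x.1 : ℝ) * ∫ x, F x p ∂Λ))
      (whp P) (𝓝 0) := by
  have hh0 : Tendsto (fun x : Σ n, Ω n => h x.1) (whp P) (𝓝 0) := hr.tendsto_zero.comp tendsto_fst_whp
  have hb0 : Tendsto (fun x : Σ n, Ω n => b x.1) (whp P) (𝓝 0) := hb.comp tendsto_fst_whp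
  have hexp := hb0.mul (hX.tendsto_shiftSum_expansion hr hF hT hTo hp (a := fun _ => 1)
    (fun ξ _ => by simp) hδ)
  rw [mul_zero] at hexp
  have h0 := (hX.bddInProb_normSum_sub (f := fun y => F y.1 p * 1)
    (((hF.measurable p).comp measurable_fst).mul_const _)
    (memLp_mul_of_bound (hF.measurable p) (fun x => hF.norm_le x p hp) (K := 1)
      (φ := fun _ => 1) (by fun_prop) (fun _ _ => by simp))).mul_tendsto hb0
  rw [integral_prod_mul (μ := Λ) (ν := signsLaw J) (fun x => F x p) (fun _ => 1),
    integral_const, smul_eq_mul, mul_one, probReal_univ, mul_one] at h0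
  -- Without a sign as weight these sums are not centred and grow like `√n`. The `√n` is moved to
  -- `δ`, where `hbδ` absorbs it, leaving an average that converges.
  have h1 : Tendsto (fun x => ∑ m, b x.1 * (δ x m *
      normSum X (fun y => partialDeriv F p m y.1 * 1) x)) (whp P) (𝓝 0) := by
    rw [← Finset.sum_const_zero (s := (Finset.univ : Finset (Fin J)))]
    refine tendsto_finsetSum _ fun m _ => ?_
    have h2 := hX.tendsto_rowAvg (f := fun y => partialDeriv F p m y.1 * 1)
      (((hF.measurable_partialDeriv p m).comp measurable_fst).mul_const _)
      (memLp_mul_of_bound (hF.measurable_partialDeriv p m) (hF.abs_partialDeriv_le hp m)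
        (φ := fun ξ => 1) (by fun_prop) (K := 1) (fun ξ hξ => by simp))
    have h3 : Tendsto (fun x => b x.1 * (√(x.1 : ℝ) * δ x m)) (whp P) (𝓝 0) := by
      refine squeeze_zero_norm (fun x => ?_) (tendsto_norm_zero.comp hbδ)
      simp only [Function.comp_apply, norm_mul, norm_norm]
      gcongr
      exact PiLp.norm_apply_le (δ x) m
    have h4 := h3.mul h2
    rw [zero_mul] at h4
    refine h4.congr' ?_
    filter_upwards [tendsto_fst_whp.eventually (eventually_ge_atTop 1)] with x hx
    have : √(x.1 : ℝ) ≠ 0 := by positivity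
    rw [rowAvg_eq]
    field_simp
  have h2 : Tendsto (fun x => ∑ m, b x.1 *
      (normSum X (fun y => partialDeriv F p m y.1 * (1 * y.2 m)) x * h x.1)) (whp P) (𝓝 0) := by
    rw [← Finset.sum_const_zero (s := (Finset.univ : Finset (Fin J)))]
    refine tendsto_finsetSum _ fun m _ => ?_
    have h3 := (hX.bddInProb_normSum (f := fun y => partialDeriv F p m y.1 * (1 * y.2 m))
      (((hF.measurable_partialDeriv p m).comp measurable_fst).mul (by fun_prop))
      (memLp_mul_of_bound (hF.measurable_partialDeriv p m) (hF.abs_partialDeriv_le hp m)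
        (φ := fun ξ => 1 * ξ m) (by fun_prop) (K := 1) (fun ξ hξ => by simpa using hξ m))
      (by rw [integral_prod_mul (μ := Λ) (ν := signsLaw J) (partialDeriv F p m) (fun ξ => 1 * ξ m)]
          simp only [one_mul]
          rw [integral_signsLaw, mul_zero])).mul_tendsto hh0
    have := hb0.mul h3
    rwa [mul_zero] at this
  have h7 := ((hexp.add h0).add h1).add h2
  simp only [add_zero] at h7
  refine h7.congr fun x => ?_
  rw [← Finset.mul_sum, ← Finset.mul_sum, ← Finset.sum_mul]
  ring

end Expansion

/-! ### Averages of randomly shifted random vector fields -/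

section AverageField

variable {J : ℕ}

lemma tendsto_clm_of_entries {ι : Type*} {𝓕 : Filter ι} {A : ι → Goods J →L[ℝ] Goods J}
    {A₀ : Goods J →L[ℝ] Goods J}
    (hA : ∀ k j, Tendsto (fun x => A x (EuclideanSpace.single k 1) j) 𝓕
      (𝓝 (A₀ (EuclideanSpace.single k 1) j))) : Tendsto A 𝓕 (𝓝 A₀) := by
  have h1 : ∀ k, Tendsto (fun x => A x (EuclideanSpace.single k 1)) 𝓕
      (𝓝 (A₀ (EuclideanSpace.single k 1))) := fun k =>
    ((PiLp.continuous_toLp 2 _).tendsto _).comp (tendsto_pi_nhds.2 (hA k))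
  have h2 : Tendsto (fun x => ∑ k, ‖A x (EuclideanSpace.single k 1)
      - A₀ (EuclideanSpace.single k 1)‖) 𝓕 (𝓝 0) := by
    have := tendsto_finsetSum Finset.univ fun k _ => tendsto_iff_norm_sub_tendsto_zero.1 (h1 k)
    simpa using this
  refine tendsto_iff_norm_sub_tendsto_zero.2 (squeeze_zero (fun _ => norm_nonneg _) (fun x => ?_) h2)
  refine ContinuousLinearMap.opNorm_le_bound _ (Finset.sum_nonneg fun _ _ => norm_nonneg _)
    fun v => ?_
  have hv : v = ∑ k, v k • EuclideanSpace.single k (1 : ℝ) := by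
    ext i
    simp [Finset.sum_apply, Pi.single_apply]
  calc ‖(A x - A₀) v‖ = ‖∑ k, v k • (A x (EuclideanSpace.single k 1)
        - A₀ (EuclideanSpace.single k 1))‖ := by
        conv_lhs => rw [hv]
        simp
    _ ≤ ∑ k, ‖v‖ * ‖A x (EuclideanSpace.single k 1) - A₀ (EuclideanSpace.single k 1)‖ := by
        refine (norm_sum_le _ _).trans (Finset.sum_le_sum fun k _ => ?_)
        rw [norm_smul]
        gcongr
        exact PiLp.norm_apply_le v k
    _ = _ := by rw [← Finset.mul_sum, mul_comm]

variable {Ω : ℕ → Type*} [∀ n, MeasurableSpace (Ω n)] {P : ∀ n, Measure (Ω n)}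
  [∀ n, IsProbabilityMeasure (P n)] {𝒳 : Type*} [MeasurableSpace 𝒳] {Λ : Measure 𝒳}
  [IsProbabilityMeasure Λ] {X : ∀ n, Fin n → Ω n → 𝒳 × (Fin J → ℝ)} {h : ℕ → ℝ}
  {F : 𝒳 → Goods J → Goods J} {T : Set (Goods J)} {C : ℝ}

/-- The average of the random vector field `F` at the points `p + h ξ_i`. -/
noncomputable def avgField (X : ∀ n, Fin n → Ω n → 𝒳 × (Fin J → ℝ)) (h : ℕ → ℝ)
    (F : 𝒳 → Goods J → Goods J) (x : Σ n, Ω n) (p : Goods J) : Goods J :=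
  (x.1 : ℝ)⁻¹ • ∑ i, F (X x.1 i x.2).1 (p + h x.1 • WithLp.toLp 2 (X x.1 i x.2).2)

omit [∀ n, MeasurableSpace (Ω n)] in
lemma SmoothBdd.hasFDerivAt_avgField (hF : SmoothBdd F T C) (x : Σ n, Ω n) (p : Goods J) :
    HasFDerivAt (avgField X h F x) ((x.1 : ℝ)⁻¹ • ∑ i, fderiv ℝ (F (X x.1 i x.2).1)
      (p + h x.1 • WithLp.toLp 2 (X x.1 i x.2).2)) p := by
  have h1 : ∀ i ∈ Finset.univ, HasFDerivAt
      (fun p => F (X x.1 i x.2).1 (p + h x.1 • WithLp.toLp 2 (X x.1 i x.2).2))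
      (fderiv ℝ (F (X x.1 i x.2).1) (p + h x.1 • WithLp.toLp 2 (X x.1 i x.2).2)) p := fun i _ =>
    (hasFDerivAt_comp_add_right _).2 (hF.differentiable _ _).hasFDerivAt
  exact (HasFDerivAt.fun_sum h1).const_smul (x.1 : ℝ)⁻¹

omit [∀ n, IsProbabilityMeasure (P n)] [IsProbabilityMeasure Λ] in
lemma IIDArray.eventually_abs_sign_le (hX : IIDArray (Λ.prod (signsLaw J)) P X) :
    ∀ᶠ x in whp P, ∀ i k, |(X x.1 i x.2).2 k| ≤ 1 :=
  eventually_whp_of_ae (Eventually.of_forall fun n => hX.ae_all ae_prod_signsLaw n)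

lemma SmoothBdd.clm_entry (hF : SmoothBdd F T C) (hT : Convex ℝ T) (hTo : IsOpen T) {s : Goods J}
    (hs : s ∈ T) (v : Goods J) (j : Fin J) :
    fderiv ℝ (fun q => ∫ x, F x q ∂Λ) s v j = ∫ x, fderiv ℝ (F x) s v j ∂Λ := by
  rw [hF.fderiv_integral_apply hT hTo hs]
  exact ((EuclideanSpace.proj (𝕜 := ℝ) j).integral_comp_comm (hF.integrable_fderiv hs v)).symm

/-- The derivatives of the averages converge in probability, locally uniformly. -/
lemma IIDArray.tendsto_fderiv_avgField (hX : IIDArray (Λ.prod (signsLaw J)) P X)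
    (hr : PerturbationRate h) (hF : SmoothBdd F T C) (hT : Convex ℝ T) (hTo : IsOpen T)
    {s : Goods J} (hs : s ∈ T) :
    Tendsto (fun z : (Σ n, Ω n) × Goods J => fderiv ℝ (avgField X h F z.1) z.2) (whp P ×ˢ 𝓝 s)
      (𝓝 (fderiv ℝ (fun q => ∫ x, F x q ∂Λ) s)) := by
  -- At the unshifted point `s` this is the law of large numbers, entry by entry.
  have hcenter : Tendsto (fun x : Σ n, Ω n => (x.1 : ℝ)⁻¹ •
      ∑ i, fderiv ℝ (F (X x.1 i x.2).1) s) (whp P) (𝓝 (fderiv ℝ (fun q => ∫ x, F x q ∂Λ) s)) := by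
    refine tendsto_clm_of_entries fun k j => ?_
    have hm : Measurable fun x => fderiv ℝ (F x) s (EuclideanSpace.single k 1) j :=
      (EuclideanSpace.proj (𝕜 := ℝ) j).continuous.measurable.comp
        (hF.measurable_fderiv s (EuclideanSpace.single k 1))
    have h1 := hX.tendsto_rowAvg
      (f := fun y => fderiv ℝ (F y.1) s (EuclideanSpace.single k 1) j * 1)
      ((hm.comp measurable_fst).mul_const _)
      (memLp_mul_of_bound hm (C := C) (fun x => (PiLp.norm_apply_le _ j).trans (by
          simpa using hF.norm_fderiv_apply_le hs (EuclideanSpace.single k 1) x))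
        (φ := fun _ => 1) (by fun_prop) (K := 1) (fun ξ hξ => by simp))
    rw [integral_prod_mul (μ := Λ) (ν := signsLaw J)
      (fun x => fderiv ℝ (F x) s (EuclideanSpace.single k 1) j) (fun _ => 1),
      integral_const, smul_eq_mul, mul_one, probReal_univ, mul_one,
      ← hF.clm_entry hT hTo hs] at h1
    refine h1.congr fun x => ?_
    simp [rowAvg, Finset.sum_apply]
  have hC : 0 ≤ C := (norm_nonneg _).trans (hF.norm_integral_le (Λ := Λ) hs)
  have hh0 : Tendsto (fun x : Σ n, Ω n => h x.1) (whp P) (𝓝 0) :=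
    hr.tendsto_zero.comp tendsto_fst_whp
  have hsmall : Tendsto (fun z : (Σ n, Ω n) × Goods J => ‖z.2 - s‖ + |h z.1.1| * √J)
      (whp P ×ˢ 𝓝 s) (𝓝 0) := by
    have h1 : Tendsto (fun z : (Σ n, Ω n) × Goods J => ‖z.2 - s‖) (whp P ×ˢ 𝓝 s) (𝓝 0) :=
      (tendsto_iff_norm_sub_tendsto_zero.1 tendsto_id).comp tendsto_snd
    have h2 : Tendsto (fun z : (Σ n, Ω n) × Goods J => |h z.1.1| * √J) (whp P ×ˢ 𝓝 s) (𝓝 0) := by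
      have := (hh0.abs.mul_const (√J)).comp (tendsto_fst (f := whp P) (g := 𝓝 s))
      rw [abs_zero, zero_mul] at this
      exact this
    simpa using h1.add h2
  obtain ⟨r, hr0, hrT⟩ := Metric.isOpen_iff.1 hTo s hs
  -- The Lipschitz bound on the derivatives controls the move from `s` to nearby shifted points. The
  -- product filter `whp P ×ˢ 𝓝 s` encodes local uniformity.
  have hdiff : Tendsto (fun z : (Σ n, Ω n) × Goods J => fderiv ℝ (avgField X h F z.1) z.2
      - (z.1.1 : ℝ)⁻¹ • ∑ i, fderiv ℝ (F (X z.1.1 i z.1.2).1) s) (whp P ×ˢ 𝓝 s) (𝓝 0) := by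
    have hbd := hsmall.const_mul C
    rw [mul_zero] at hbd
    refine squeeze_zero_norm' ?_ hbd
    filter_upwards [hsmall.eventually (gt_mem_nhds hr0),
      tendsto_fst.eventually hX.eventually_abs_sign_le,
      tendsto_fst.eventually (tendsto_fst_whp.eventually (eventually_ge_atTop 1))]
      with z hz hξ hn
    have hsub : fderiv ℝ (avgField X h F z.1) z.2
        - (z.1.1 : ℝ)⁻¹ • ∑ i, fderiv ℝ (F (X z.1.1 i z.1.2).1) s
        = (z.1.1 : ℝ)⁻¹ • ∑ i, (fderiv ℝ (F (X z.1.1 i z.1.2).1)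
          (z.2 + h z.1.1 • WithLp.toLp 2 (X z.1.1 i z.1.2).2)
            - fderiv ℝ (F (X z.1.1 i z.1.2).1) s) := by
      rw [(hF.hasFDerivAt_avgField z.1 z.2).fderiv, Finset.sum_sub_distrib]
      exact (smul_sub _ _ _).symm
    rw [hsub, norm_smul, Real.norm_of_nonneg (by positivity)]
    have hterm : ∀ i, ‖fderiv ℝ (F (X z.1.1 i z.1.2).1)
        (z.2 + h z.1.1 • WithLp.toLp 2 (X z.1.1 i z.1.2).2) - fderiv ℝ (F (X z.1.1 i z.1.2).1) s‖
        ≤ C * (‖z.2 - s‖ + |h z.1.1| * √J) := by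
      intro i
      have hd : ‖z.2 + h z.1.1 • WithLp.toLp 2 (X z.1.1 i z.1.2).2 - s‖
          ≤ ‖z.2 - s‖ + |h z.1.1| * √J := by
        rw [add_sub_right_comm]
        refine (norm_add_le _ _).trans ?_
        rw [norm_smul, Real.norm_eq_abs]
        gcongr
        exact norm_toLp_le_of_abs_le (hξ i)
      refine (hF.lipschitz_fderiv _ s hs _ (hrT ?_)).trans (mul_le_mul_of_nonneg_left hd hC)
      rw [Metric.mem_ball, dist_eq_norm]
      exact hd.trans_lt hz
    have hn0 : (0 : ℝ) < z.1.1 := by exact_mod_cast hn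
    refine (mul_le_mul_of_nonneg_left ((norm_sum_le _ _).trans
      (Finset.sum_le_sum fun i _ => hterm i)) (by positivity)).trans (le_of_eq ?_)
    rw [Finset.sum_const, Finset.card_univ, Fintype.card_fin, nsmul_eq_mul,
      inv_mul_cancel_left₀ hn0.ne']
  have := hdiff.add (hcenter.comp tendsto_fst)
  rw [zero_add] at this
  refine this.congr fun z => ?_
  simp

/-- With high probability, the averages inherit a contraction property of the mean. -/
lemma IIDArray.eventually_avgField_contraction (hX : IIDArray (Λ.prod (signsLaw J)) P X)
    (hr : PerturbationRate h) (hF : SmoothBdd F T C) (hT : Convex ℝ T) (hTo : IsOpen T)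
    {K : Set (Goods J)} (hK : IsCompact K) (hKc : Convex ℝ K) (hKT : K ⊆ T) {q : ℝ}
    (hq : ∀ p ∈ K, ‖fderiv ℝ (fun q => ∫ x, F x q ∂Λ) p + ContinuousLinearMap.id ℝ (Goods J)‖ < q) :
    ∀ᶠ x in whp P, ∀ p ∈ K, ∀ p' ∈ K,
      ‖p + avgField X h F x p - (p' + avgField X h F x p')‖ ≤ q * ‖p - p'‖ := by
  -- Compactness joins the local statements at the points of `K`; currying then gives one event of
  -- high probability that serves all points of `K`.
  have h1 : ∀ᶠ z in whp P ×ˢ 𝓝ˢ K, ‖fderiv ℝ (avgField X h F z.1) z.2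
      + ContinuousLinearMap.id ℝ (Goods J)‖ < q := by
    refine hK.mem_prod_nhdsSet_of_forall fun s hs => ?_
    have h2 := ((hX.tendsto_fderiv_avgField hr hF hT hTo (hKT hs)).add_const
      (ContinuousLinearMap.id ℝ (Goods J))).norm
    exact h2.eventually (gt_mem_nhds (hq s hs))
  filter_upwards [h1.curry] with x hx p hp p' hp'
  have hx' := hx.self_of_nhdsSet
  exact Economy.norm_add_sub_add_le_of_fderiv hKc
    (fun y _ => (hF.hasFDerivAt_avgField x y).differentiableAt) (fun y hy => (hx' y hy).le) hp hp'

/-- With high probability, every event of positive probability is observed in the sample. -/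
lemma IIDArray.eventually_exists_mem (hX : IIDArray (Λ.prod (signsLaw J)) P X) {A : Set 𝒳}
    (hA : MeasurableSet A) (hpos : 0 < Λ A) : ∀ᶠ x in whp P, ∃ i, (X x.1 i x.2).1 ∈ A := by
  have hm : Measurable (A.indicator fun _ => (1 : ℝ)) := measurable_const.indicator hA
  have h1 := hX.tendsto_rowAvg (f := fun y => A.indicator (fun _ => (1 : ℝ)) y.1 * 1)
    ((hm.comp measurable_fst).mul_const _)
    (memLp_mul_of_bound hm (C := 1) (fun x => by
        by_cases hx : x ∈ A <;> simp [hx])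
      (φ := fun _ => 1) (by fun_prop) (K := 1) (fun ξ hξ => by simp))
  rw [integral_prod_mul (μ := Λ) (ν := signsLaw J) (A.indicator fun _ => (1 : ℝ)) (fun _ => 1),
    integral_const, smul_eq_mul, mul_one, probReal_univ, mul_one, integral_indicator_const _ hA,
    smul_eq_mul, mul_one] at h1
  have h2 : 0 < Λ.real A := ENNReal.toReal_pos hpos.ne' (measure_ne_top _ _)
  filter_upwards [h1.eventually (lt_mem_nhds h2)] with x hx
  by_contra! hcon
  have : rowAvg X (fun y => A.indicator (fun _ => (1 : ℝ)) y.1 * 1) x = 0 := by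
    simp [rowAvg, hcon]
  exact hx.ne' this

end AverageField

/-! ### The experiment and the market price -/

section MarketPrice

variable {J : ℕ} {𝒢 : Type*} [MeasurableSpace 𝒢] {M : Economy J 𝒢} {Θ : Measure 𝒢}
  [IsProbabilityMeasure Θ] {l u : Fin J → ℝ} {π : unitInterval} {T : Set (Goods J)} {C : ℝ}
  {h : ℕ → ℝ} {Ω : ℕ → Type*} [∀ n, MeasurableSpace (Ω n)] {P : ∀ n, Measure (Ω n)}
  {G : ∀ n, Fin n → Ω n → 𝒢} {W : ∀ n, Fin n → Ω n → Bool} {U : ∀ n, Fin n → Ω n → Goods J}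

/-- The array of individuals, treatments and signs of the price perturbations. -/
noncomputable def sampleArray (h : ℕ → ℝ) (G : ∀ n, Fin n → Ω n → 𝒢) (W : ∀ n, Fin n → Ω n → Bool)
    (U : ∀ n, Fin n → Ω n → Goods J) (n : ℕ) (i : Fin n) (ω : Ω n) : (𝒢 × Bool) × (Fin J → ℝ) :=
  ((G n i ω, W n i ω), fun k => (h n)⁻¹ * U n i ω k)

lemma map_signLaw {t : ℝ} (ht : t ≠ 0) : (signLaw t).map (fun s => t⁻¹ * s) = signLaw 1 := by
  rw [map_bernoulliMeasure' _ _ (by fun_prop), mul_neg, inv_mul_cancel₀ ht]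

/-- Dividing the perturbations by their size gives signs whose law is free of `n`, as `IIDArray`
requires; the dependence on `n` is carried by the deterministic factor `h n`. -/
lemma measurePreserving_rescale {t : ℝ} (ht : t ≠ 0) :
    MeasurePreserving (fun y : 𝒢 × Bool × (Fin J → ℝ) => ((y.1, y.2.1), fun k => t⁻¹ * y.2.2 k))
      (Θ.prod ((treatmentLaw π).prod (Measure.pi fun _ : Fin J => signLaw t)))
      ((Θ.prod (treatmentLaw π)).prod (signsLaw J)) := by
  have h1 : MeasurePreserving (fun (ξ : Fin J → ℝ) k => t⁻¹ * ξ k)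
      (Measure.pi fun _ : Fin J => signLaw t) (signsLaw J) := by
    refine ⟨by fun_prop, ?_⟩
    have hs : ∀ _ : Fin J, SigmaFinite ((signLaw t).map fun s => t⁻¹ * s) := fun _ => by
      rw [map_signLaw ht]
      infer_instance
    rw [Measure.pi_map_pi (f := fun _ s => t⁻¹ * s) (fun _ => by fun_prop), map_signLaw ht]
  have h2 := (MeasurePreserving.id (Θ.prod (treatmentLaw π))).prod h1
  exact h2.comp (measurePreserving_prodAssoc Θ (treatmentLaw π)
    (Measure.pi fun _ : Fin J => signLaw t)).symm

lemma iidArray_sampleArray (hr : PerturbationRate h)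
    (hexp : ∀ n, Experiment Θ π (h n) (P n) (G n) (W n) (U n)) :
    IIDArray ((Θ.prod (treatmentLaw π)).prod (signsLaw J)) P (sampleArray h G W U) where
  indep n := (hexp n).indep.comp
    (fun _ y => ((y.1, y.2.1), fun k => (h n)⁻¹ * y.2.2 k)) fun _ => by fun_prop
  law n i := (measurePreserving_rescale (hr.pos n (Fin.pos i)).ne').comp_hasLaw ((hexp n).law i)

omit [MeasurableSpace 𝒢] [∀ n, MeasurableSpace (Ω n)] in
lemma smul_sampleArray (hr : PerturbationRate h) (n : ℕ) (i : Fin n) (ω : Ω n) :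
    h n • WithLp.toLp 2 (sampleArray h G W U n i ω).2 = U n i ω := by
  ext k
  simp [sampleArray, mul_inv_cancel_left₀ (hr.pos n (Fin.pos i)).ne']

omit [MeasurableSpace 𝒢] [∀ n, MeasurableSpace (Ω n)] in
lemma avgExcess_eq_avgField (hr : PerturbationRate h) (x : Σ n, Ω n) (p : Goods J) :
    M.avgExcess (fun i => G x.1 i x.2) (fun i => W x.1 i x.2) (fun i => U x.1 i x.2) p
      = avgField (sampleArray h G W U) h (fun y => M.excess y.1 y.2) x p := by
  simp only [Economy.avgExcess, avgField, smul_sampleArray hr]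
  rfl

lemma priceBox_enlarge_subset {t η : ℝ} (hlu : ∀ j, l j ≤ u j) (ht : 0 ≤ t) (htη : √J * t ≤ η) :
    priceBox (fun j => l j - t) (fun j => u j + t) ⊆ Metric.cthickening η (priceBox l u) := by
  intro p hp
  refine Metric.mem_cthickening_of_dist_le p (clampBox l u p) η _ (clampBox_mem hlu p) ?_
  refine le_trans ?_ htη
  rw [dist_eq_norm, EuclideanSpace.norm_eq]
  have hsq : √J * t = √(∑ _j : Fin J, t ^ 2) := by
    rw [Finset.sum_const, Finset.card_univ, Fintype.card_fin, nsmul_eq_mul,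
      Real.sqrt_mul (Nat.cast_nonneg _), Real.sqrt_sq ht]
  rw [hsq]
  refine Real.sqrt_le_sqrt (Finset.sum_le_sum fun j _ => ?_)
  refine pow_le_pow_left₀ (norm_nonneg _) ?_ 2
  obtain ⟨h1, h2⟩ := hp j
  simp only [PiLp.sub_apply, Real.norm_eq_abs, clampBox]
  have h3 := hlu j
  rcases le_total (p j) (u j) with h4 | h4
  · rw [min_eq_right h4]
    rcases le_total (l j) (p j) with h5 | h5
    · rw [max_eq_right h5, sub_self, abs_zero]
      exact ht
    · rw [max_eq_left h5, abs_le]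
      constructor <;> linarith
  · rw [min_eq_left h4, max_eq_right h3, abs_le]
    constructor <;> linarith

variable {X : ∀ n, Fin n → Ω n → (𝒢 × Bool) × (Fin J → ℝ)}

-- A perturbation moves a coordinate by at most `h`, so beyond `u j + h` every sampled individual
-- still faces a price above `u j`. One sampled individual from a set with strict inequality makes
-- the average strict.
omit [∀ n, MeasurableSpace (Ω n)] [IsProbabilityMeasure Θ] in
lemma avgField_excess_nonpos (hb : M.BoundaryCondition Θ l u) {x : Σ n, Ω n} (hh : 0 ≤ h x.1)
    (hξ : ∀ i k, |(X x.1 i x.2).2 k| ≤ 1) {p : Goods J} {j : Fin J} (hj : u j + h x.1 ≤ p j) :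
    avgField X h (fun y => M.excess y.1 y.2) x p j ≤ 0 ∧
    ∀ A : Set (𝒢 × Bool), (∀ y ∈ A, ∀ p : Goods J, u j ≤ p j → M.excess y.1 y.2 p j < 0) →
      (∃ i, (X x.1 i x.2).1 ∈ A) → avgField X h (fun y => M.excess y.1 y.2) x p j < 0 := by
  have hle : ∀ i, u j ≤ (p + h x.1 • WithLp.toLp 2 (X x.1 i x.2).2) j := fun i => by
    have := (abs_le.1 (hξ i j)).1
    simp only [PiLp.add_apply, PiLp.smul_apply, smul_eq_mul]
    nlinarith
  have heq : avgField X h (fun y => M.excess y.1 y.2) x p j = (x.1 : ℝ)⁻¹ * ∑ i,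
      M.excess (X x.1 i x.2).1.1 (X x.1 i x.2).1.2
        (p + h x.1 • WithLp.toLp 2 (X x.1 i x.2).2) j := by
    simp [avgField, Finset.sum_apply]
  have hterm : ∀ i, M.excess (X x.1 i x.2).1.1 (X x.1 i x.2).1.2
      (p + h x.1 • WithLp.toLp 2 (X x.1 i x.2).2) j ≤ 0 := fun i => hb.upper _ _ _ _ (hle i)
  rw [heq]
  refine ⟨mul_nonpos_of_nonneg_of_nonpos (by positivity) (Finset.sum_nonpos fun i _ => hterm i),
    fun A hA ⟨i, hi⟩ => ?_⟩
  have hn : (0 : ℝ) < x.1 := by exact_mod_cast Fin.pos i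
  exact mul_neg_of_pos_of_neg (by positivity) (Finset.sum_neg' (fun i _ => hterm i)
    ⟨i, Finset.mem_univ _, hA _ hi _ (hle i)⟩)

omit [∀ n, MeasurableSpace (Ω n)] [IsProbabilityMeasure Θ] in
lemma avgField_excess_nonneg (hb : M.BoundaryCondition Θ l u) {x : Σ n, Ω n} (hh : 0 ≤ h x.1)
    (hξ : ∀ i k, |(X x.1 i x.2).2 k| ≤ 1) {p : Goods J} {j : Fin J} (hj : p j ≤ l j - h x.1) :
    0 ≤ avgField X h (fun y => M.excess y.1 y.2) x p j ∧
    ∀ A : Set (𝒢 × Bool), (∀ y ∈ A, ∀ p : Goods J, p j ≤ l j → 0 < M.excess y.1 y.2 p j) →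
      (∃ i, (X x.1 i x.2).1 ∈ A) → 0 < avgField X h (fun y => M.excess y.1 y.2) x p j := by
  have hle : ∀ i, (p + h x.1 • WithLp.toLp 2 (X x.1 i x.2).2) j ≤ l j := fun i => by
    have := (abs_le.1 (hξ i j)).2
    simp only [PiLp.add_apply, PiLp.smul_apply, smul_eq_mul]
    nlinarith
  have heq : avgField X h (fun y => M.excess y.1 y.2) x p j = (x.1 : ℝ)⁻¹ * ∑ i,
      M.excess (X x.1 i x.2).1.1 (X x.1 i x.2).1.2
        (p + h x.1 • WithLp.toLp 2 (X x.1 i x.2).2) j := by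
    simp [avgField, Finset.sum_apply]
  have hterm : ∀ i, 0 ≤ M.excess (X x.1 i x.2).1.1 (X x.1 i x.2).1.2
      (p + h x.1 • WithLp.toLp 2 (X x.1 i x.2).2) j := fun i => hb.lower _ _ _ _ (hle i)
  rw [heq]
  refine ⟨mul_nonneg (by positivity) (Finset.sum_nonneg fun i _ => hterm i),
    fun A hA ⟨i, hi⟩ => ?_⟩
  have hn : (0 : ℝ) < x.1 := by exact_mod_cast Fin.pos i
  exact mul_pos (by positivity) (Finset.sum_pos' (fun i _ => hterm i)
    ⟨i, Finset.mem_univ _, hA _ hi _ (hle i)⟩)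

omit [IsProbabilityMeasure Θ] in
lemma prod_treatmentLaw_pos (hπ0 : 0 < π) {A : Set 𝒢} (hA : 0 < Θ A) :
    0 < Θ.prod (treatmentLaw π) (A ×ˢ {true}) := by
  rw [Measure.prod_prod]
  refine ENNReal.mul_pos hA.ne' ?_
  rw [bernoulliMeasure_apply_of_mem_of_notMem _ (measurableSet_singleton _) rfl (by simp)]
  have : (0 : ℝ) < π := hπ0
  simpa [← NNReal.coe_eq_zero] using this.ne'

variable [∀ n, IsProbabilityMeasure (P n)]

/-- With high probability, the distance of the market price from a zero `ps` of the mean field is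
controlled by the average excess demand at `ps`. -/
lemma eventually_norm_price_sub_le (hM : M.SmoothOn T C) (hsub : priceBox l u ⊆ T)
    (hb : M.BoundaryCondition Θ l u) (hπ0 : 0 < π) (hn : M.Nonsingular Θ l u π)
    (hr : PerturbationRate h) (hexp : ∀ n, Experiment Θ π (h n) (P n) (G n) (W n) (U n))
    {price : ∀ n, Ω n → Goods J}
    (hmarket : ∀ n, ∀ᵐ ω ∂(P n),
      M.IsMarketPrice (fun i => G n i ω) (fun i => W n i ω) (fun i => U n i ω) (price n ω))
    {ps : Goods J} (hps : ps ∈ priceBox l u) :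
    ∃ K : ℝ, ∀ᶠ x in whp P, ‖price x.1 x.2 - ps‖
      ≤ K * ‖avgField (sampleArray h G W U) h (fun y => M.excess y.1 y.2) x ps‖ := by
  obtain ⟨q, hq0, hq1, η, hη, hηT, hηq⟩ :=
    hM.exists_contraction hsub hb.lower_le_upper hn.contraction
  have hX := iidArray_sampleArray hr hexp
  set X := sampleArray h G W U with hXdef
  have hcontr := hX.eventually_avgField_contraction hr hM.excess hM.convex hM.isOpen
    (isCompact_priceBox l u).cthickening ((convex_priceBox l u).cthickening η) hηT (q := q)
    (fun p hp => by
      rw [← hM.fderiv_mixedExcess π (hηT hp)]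
      exact hηq p hp)
  have hup : ∀ᶠ x in whp P, ∀ j, ∃ A : Set (𝒢 × Bool),
      (∀ y ∈ A, ∀ p : Goods J, u j ≤ p j → M.excess y.1 y.2 p j < 0) ∧
        ∃ i, (X x.1 i x.2).1 ∈ A := by
    refine eventually_all.2 fun j => ?_
    obtain ⟨A, hAm, hA, hAj⟩ := hb.upper_strict true j
    filter_upwards [hX.eventually_exists_mem (hAm.prod (measurableSet_singleton true))
      (prod_treatmentLaw_pos hπ0 hA)] with x hx
    refine ⟨_, ?_, hx⟩
    rintro ⟨g, w⟩ ⟨hg, hw⟩ p hp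
    rw [Set.mem_singleton_iff] at hw
    subst hw
    exact hAj g hg p hp
  have hlow : ∀ᶠ x in whp P, ∀ j, ∃ A : Set (𝒢 × Bool),
      (∀ y ∈ A, ∀ p : Goods J, p j ≤ l j → 0 < M.excess y.1 y.2 p j) ∧
        ∃ i, (X x.1 i x.2).1 ∈ A := by
    refine eventually_all.2 fun j => ?_
    obtain ⟨A, hAm, hA, hAj⟩ := hb.lower_strict true j
    filter_upwards [hX.eventually_exists_mem (hAm.prod (measurableSet_singleton true))
      (prod_treatmentLaw_pos hπ0 hA)] with x hx
    refine ⟨_, ?_, hx⟩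
    rintro ⟨g, w⟩ ⟨hg, hw⟩ p hp
    rw [Set.mem_singleton_iff] at hw
    subst hw
    exact hAj g hg p hp
  have hsmall : ∀ᶠ x : Σ n, Ω n in whp P, √J * h x.1 < η := by
    have := (hr.tendsto_zero.const_mul (√J)).comp (tendsto_fst_whp (P := P))
    rw [mul_zero] at this
    exact this.eventually (gt_mem_nhds hη)
  refine ⟨(1 - q)⁻¹, ?_⟩
  filter_upwards [hcontr, hup, hlow, hsmall, hX.eventually_abs_sign_le,
    tendsto_fst_whp.eventually (eventually_ge_atTop 1),
    eventually_whp_of_ae (p := fun x => M.IsMarketPrice (fun i => G x.1 i x.2)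
      (fun i => W x.1 i x.2) (fun i => U x.1 i x.2) (price x.1 x.2))
      (Eventually.of_forall hmarket)] with x hc hu hl hs hξ hn1 hmk
  have hh := (hr.pos x.1 hn1).le
  have hbox := priceBox_enlarge_subset hb.lower_le_upper hh hs.le
  -- The sample excess demand has an exact zero in the box enlarged by `h`; a minimizer of the norm
  -- must then be a zero too.
  obtain ⟨p₀, ⟨-, hp₀⟩, -⟩ := existsUnique_zero_of_contraction
    (a := fun j => l j - h x.1) (b := fun j => u j + h x.1)
    (f := avgField X h (fun y => M.excess y.1 y.2) x)
    (fun j => by have := hb.lower_le_upper j; linarith) hq0 hq1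
    (fun p hp p' hp' => hc p (hbox hp) p' (hbox hp'))
    (fun p _ j hj => (avgField_excess_nonpos hb hh hξ hj.ge).1)
    (fun p _ j hj => (avgField_excess_nonneg hb hh hξ hj.le).1)
  have hzero : avgField X h (fun y => M.excess y.1 y.2) x (price x.1 x.2) = 0 := by
    have := hmk p₀
    rw [avgExcess_eq_avgField hr, avgExcess_eq_avgField hr, hp₀, norm_zero] at this
    exact norm_le_zero_iff.1 this
  -- Minimization is over all prices, so the market price has to be located: outside the enlarged
  -- box some coordinate of the sample excess demand is strictly signed.
  have hmem : price x.1 x.2 ∈ priceBox (fun j => l j - h x.1) (fun j => u j + h x.1) := by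
    intro j
    constructor
    · by_contra! hlt
      obtain ⟨A, hA, hi⟩ := hl j
      have := (avgField_excess_nonneg hb hh hξ hlt.le).2 A hA hi
      simp [hzero] at this
    · by_contra! hlt
      obtain ⟨A, hA, hi⟩ := hu j
      have := (avgField_excess_nonpos hb hh hξ hlt.le).2 A hA hi
      simp [hzero] at this
  -- The contraction inequality between a zero and `ps`, rearranged, gives the factor `(1 - q)⁻¹`.
  have hfin := hc _ (hbox hmem) ps (Metric.self_subset_cthickening _ hps)
  rw [hzero, add_zero] at hfin
  set Av := avgField X h (fun y => M.excess y.1 y.2) x ps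
  have htri : ‖price x.1 x.2 - ps‖ ≤ ‖price x.1 x.2 - (ps + Av)‖ + ‖Av‖ := by
    refine le_trans (le_of_eq ?_) (norm_add_le _ _)
    congr 1
    abel
  rw [← div_eq_inv_mul, le_div_iff₀ (by linarith)]
  linarith

/-- The market price is within `O_p(n^{-1/2})` of the mean-field price. -/
lemma tendsto_mul_norm_price_sub (hM : M.SmoothOn T C) (hsub : priceBox l u ⊆ T)
    (hb : M.BoundaryCondition Θ l u) (hπ0 : 0 < π) (hn : M.Nonsingular Θ l u π)
    (hr : PerturbationRate h) (hexp : ∀ n, Experiment Θ π (h n) (P n) (G n) (W n) (U n))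
    {price : ∀ n, Ω n → Goods J}
    (hmarket : ∀ n, ∀ᵐ ω ∂(P n),
      M.IsMarketPrice (fun i => G n i ω) (fun i => W n i ω) (fun i => U n i ω) (price n ω))
    {ps : Goods J} (hps : M.IsMeanFieldPrice Θ l u π ps) {b : ℕ → ℝ}
    (hbl : Tendsto b atTop (𝓝 0)) :
    Tendsto (fun x => b x.1 * (√(x.1 : ℝ) * ‖price x.1 x.2 - ps‖)) (whp P) (𝓝 0) := by
  obtain ⟨K, hK⟩ := eventually_norm_price_sub_le hM hsub hb hπ0 hn hr hexp hmarket hps.1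
  have hX := iidArray_sampleArray hr hexp
  set X := sampleArray h G W U with hXdef
  have hpT := hsub hps.1
  have hcoord : ∀ j, Tendsto (fun x : Σ n, Ω n => b x.1 * √(x.1 : ℝ) *
      avgField X h (fun y => M.excess y.1 y.2) x ps j) (whp P) (𝓝 0) := by
    intro j
    -- With no common shift, `shiftSum` is `√n` times the average at `ps`, whose mean-field value is
    -- zero.
    have h1 := hX.tendsto_shiftSum_one (δ := fun _ => 0) hr
      (hM.excess.clm_comp (EuclideanSpace.proj (𝕜 := ℝ) j)) hM.convex hM.isOpen hpT
      (by simpa using tendsto_const_nhds) hbl (by simpa using tendsto_const_nhds)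
    have h2 : ∫ y : 𝒢 × Bool, (EuclideanSpace.proj (𝕜 := ℝ) j) (M.excess y.1 y.2 ps)
        ∂(Θ.prod (treatmentLaw π)) = 0 := by
      rw [(EuclideanSpace.proj (𝕜 := ℝ) j).integral_comp_comm (hM.excess.integrable hpT),
        ← hM.mixedExcess_eq_integral π hpT, hps.2, map_zero]
    rw [h2] at h1
    refine h1.congr' ?_
    filter_upwards [tendsto_fst_whp.eventually (eventually_ge_atTop 1)] with x hx
    have hs : √(x.1 : ℝ) ≠ 0 := by positivity
    have hss : √(x.1 : ℝ) * (x.1 : ℝ)⁻¹ = (√(x.1 : ℝ))⁻¹ := by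
      rw [← div_eq_mul_inv, Real.sqrt_div_self]
    have heq : avgField X h (fun y => M.excess y.1 y.2) x ps j = (x.1 : ℝ)⁻¹ * ∑ i,
      M.excess (X x.1 i x.2).1.1 (X x.1 i x.2).1.2
        (ps + h x.1 • WithLp.toLp 2 (X x.1 i x.2).2) j := by
      simp [avgField, Finset.sum_apply]
    rw [heq, mul_zero, sub_zero, mul_assoc (b x.1), ← mul_assoc (√(x.1 : ℝ)), hss, shiftSum]
    simp
  have hvec : Tendsto (fun x : Σ n, Ω n => (b x.1 * √(x.1 : ℝ)) •
      avgField X h (fun y => M.excess y.1 y.2) x ps) (whp P) (𝓝 0) :=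
    ((PiLp.continuous_toLp 2 _).tendsto (0 : Fin J → ℝ)).comp
      (tendsto_pi_nhds.2 fun j => by simpa using hcoord j)
  have hbd := hvec.norm.const_mul K
  rw [norm_zero, mul_zero] at hbd
  refine squeeze_zero_norm' ?_ hbd
  filter_upwards [hK] with x hx
  rw [norm_smul, Real.norm_eq_abs, Real.norm_eq_abs, abs_mul, abs_mul, abs_mul, abs_norm]
  calc _ ≤ |b x.1| * (|√(x.1 : ℝ)| * (K * ‖avgField X h (fun y => M.excess y.1 y.2) x ps‖)) := by
        gcongr
    _ = _ := by ring

-- Take `b_n = n^{-1/4}` and square: `(n^{-1/4} √n D)² = √n D²`.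
omit [∀ n, IsProbabilityMeasure (P n)] in
lemma tendsto_sqrt_mul_sq_of_forall {D : (Σ n, Ω n) → ℝ}
    (hD : ∀ b : ℕ → ℝ, Tendsto b atTop (𝓝 0) →
      Tendsto (fun x => b x.1 * (√(x.1 : ℝ) * D x)) (whp P) (𝓝 0)) :
    Tendsto (fun x => √(x.1 : ℝ) * D x ^ 2) (whp P) (𝓝 0) := by
  have hb : Tendsto (fun n : ℕ => √((√(n : ℝ))⁻¹)) atTop (𝓝 0) := by
    have := (Real.continuous_sqrt.tendsto 0).comp tendsto_inv_sqrt_natCast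
    rwa [Real.sqrt_zero] at this
  have h1 := (hD _ hb).mul (hD _ hb)
  rw [mul_zero] at h1
  refine h1.congr' ?_
  filter_upwards [tendsto_fst_whp.eventually (eventually_ge_atTop 1)] with x hx
  have hs : √(x.1 : ℝ) ≠ 0 := by positivity
  have h2 : √((√(x.1 : ℝ))⁻¹) * √((√(x.1 : ℝ))⁻¹) = (√(x.1 : ℝ))⁻¹ :=
    Real.mul_self_sqrt (by positivity)
  calc _ = (√((√(x.1 : ℝ))⁻¹) * √((√(x.1 : ℝ))⁻¹)) * (√(x.1 : ℝ) * √(x.1 : ℝ)) * D x ^ 2 := by ring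
    _ = _ := by
      rw [h2]
      field_simp

end MarketPrice

/-! ### The estimator -/

section EstimatorAlgebra

variable {J n : ℕ}

/-- The factor `(UᵀU)⁻¹` cancels between the two regressions, so `γ̂ = (UᵀZ)⁻¹UᵀY`; the part of
`UᵀY` lying along `γ` returns `γ`, and the rest is the estimation error. -/
lemma estimatorAIE_eq {π s t : ℝ} {W : Fin n → Bool} {U Z : Matrix (Fin n) (Fin J) ℝ}
    {Y : Fin n → ℝ} {γ v : Fin J → ℝ} {Q : Matrix (Fin J) (Fin J) ℝ} (hUU : IsUnit (Uᵀ * U).det)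
    (hQ : IsUnit Q.det) (hs : s ≠ 0) (hZ : Uᵀ * Z = s • Q)
    (hY : Uᵀ *ᵥ Y = (Uᵀ * Z) *ᵥ γ + (s * t) • v) :
    estimatorAIE π W U Y Z = -((γ + t • (Q⁻¹ *ᵥ v)) ⬝ᵥ horvitzThompsonZ π W Z) := by
  have hsu : IsUnit s := isUnit_iff_ne_zero.2 hs
  have hA : IsUnit (Uᵀ * Z).det := by
    rw [hZ, Matrix.det_smul]
    exact (hsu.pow _).mul hQ
  have hinv : (Uᵀ * Z)⁻¹ = s⁻¹ • Q⁻¹ := by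
    refine Matrix.inv_eq_left_inv ?_
    rw [hZ, smul_mul_smul_comm, inv_mul_cancel₀ hs, one_smul, Matrix.nonsing_inv_mul _ hQ]
  have hγ : (deltaZ U Z)⁻¹ *ᵥ deltaY U Y = γ + t • (Q⁻¹ *ᵥ v) := by
    rw [deltaZ, deltaY, Matrix.mul_inv_rev, Matrix.nonsing_inv_nonsing_inv _ hUU,
      Matrix.mulVec_mulVec, Matrix.mul_assoc, Matrix.mul_nonsing_inv _ hUU, Matrix.mul_one, hY,
      Matrix.mulVec_add, Matrix.mulVec_mulVec, Matrix.nonsing_inv_mul _ hA, Matrix.one_mulVec,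
      hinv, Matrix.mulVec_smul, Matrix.smul_mulVec, smul_smul]
    congr 2
    field_simp
  rw [estimatorAIE, hγ]

/-- The formula `det⁻¹ • adjugate` also covers singular matrices, where both sides are zero by
convention. -/
lemma measurable_matrix_inv_apply {α : Type*} [MeasurableSpace α]
    {A : α → Matrix (Fin J) (Fin J) ℝ} (hA : ∀ i j, Measurable fun x => A x i j) (i j : Fin J) :
    Measurable fun x => (A x)⁻¹ i j := by
  have hA' : Measurable fun x i j => A x i j :=
    measurable_pi_lambda _ fun i => measurable_pi_lambda _ fun j => hA i j
  have hdet : Measurable fun B : Fin J → Fin J → ℝ => (Matrix.of B).det :=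
    (show Continuous fun B : Fin J → Fin J → ℝ => (Matrix.of B).det from
      Continuous.matrix_det (A := fun B : Matrix (Fin J) (Fin J) ℝ => B) continuous_id).measurable
  have hadj : Measurable fun B : Fin J → Fin J → ℝ => (Matrix.of B).adjugate i j := by
    have h1 : Continuous fun B : Matrix (Fin J) (Fin J) ℝ => B.adjugate :=
      Continuous.matrix_adjugate continuous_id
    exact (show Continuous fun B : Fin J → Fin J → ℝ => (Matrix.of B).adjugate i j from
      Continuous.matrix_elem h1 i j).measurable
  have h2 : (fun x => (A x)⁻¹ i j) = fun x => ((A x).det)⁻¹ * (A x).adjugate i j := by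
    ext x
    rw [Matrix.inv_def, Ring.inverse_eq_inv', Matrix.smul_apply, smul_eq_mul]
  rw [h2]
  exact (hdet.comp hA').inv.mul (hadj.comp hA')

lemma measurable_estimatorAIE {α : Type*} [MeasurableSpace α] (π : ℝ) {W : α → Fin n → Bool}
    {U Z : α → Matrix (Fin n) (Fin J) ℝ} {Y : α → Fin n → ℝ}
    (hW : ∀ i, Measurable fun x => W x i) (hU : ∀ i j, Measurable fun x => U x i j)
    (hZ : ∀ i j, Measurable fun x => Z x i j) (hY : ∀ i, Measurable fun x => Y x i) :
    Measurable fun x => estimatorAIE π (W x) (U x) (Y x) (Z x) := by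
  have hmul : ∀ {a b c : ℕ} {A : α → Matrix (Fin a) (Fin b) ℝ} {B : α → Matrix (Fin b) (Fin c) ℝ},
      (∀ i j, Measurable fun x => A x i j) → (∀ i j, Measurable fun x => B x i j) →
      ∀ i j, Measurable fun x => (A x * B x) i j := by
    intro a b c A B hA hB i j
    simp only [Matrix.mul_apply]
    exact Finset.measurable_fun_sum _ fun k _ => (hA i k).mul (hB k j)
  have hvec : ∀ {a b : ℕ} {A : α → Matrix (Fin a) (Fin b) ℝ} {v : α → Fin b → ℝ},
      (∀ i j, Measurable fun x => A x i j) → (∀ i, Measurable fun x => v x i) →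
      ∀ i, Measurable fun x => (A x *ᵥ v x) i := by
    intro a b A v hA hv i
    simp only [Matrix.mulVec, dotProduct]
    exact Finset.measurable_fun_sum _ fun k _ => (hA i k).mul (hv k)
  have hUt : ∀ i j, Measurable fun x => (U x)ᵀ i j := fun i j => hU j i
  have hUU := measurable_matrix_inv_apply (hmul hUt hU)
  have hdZ : ∀ i j, Measurable fun x => deltaZ (U x) (Z x) i j := hmul hUU (hmul hUt hZ)
  have hdY : ∀ i, Measurable fun x => deltaY (U x) (Y x) i := hvec hUU (hvec hUt hY)
  have hHT : ∀ j, Measurable fun x => horvitzThompsonZ π (W x) (Z x) j := by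
    intro j
    have htreat : Measurable treat := measurable_of_finite _
    refine Measurable.const_mul (Finset.measurable_fun_sum _ fun i _ => ?_) _
    have h1 := htreat.comp (hW i)
    have h2 := hZ i j
    exact ((h1.mul h2).div_const π).sub (((measurable_const.sub h1).mul h2).div_const _)
  refine Measurable.neg (Finset.measurable_fun_sum _ fun k _ => ?_)
  exact (hvec (measurable_matrix_inv_apply hdZ) hdY k).mul (hHT k)

variable {𝒢 : Type*} [MeasurableSpace 𝒢] {M : Economy J 𝒢} {T : Set (Goods J)} {C : ℝ}

lemma SmoothBdd.measurable_uncurry {𝒳 V : Type*} [MeasurableSpace 𝒳] [NormedAddCommGroup V]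
    [NormedSpace ℝ V] [MeasurableSpace V] [BorelSpace V] {F : 𝒳 → Goods J → V}
    (hF : SmoothBdd F T C) : Measurable fun z : Goods J × 𝒳 => F z.2 z.1 :=
  measurable_uncurry_of_continuous_of_measurable (u := fun p x => F x p)
    (fun x => (hF.differentiable x).continuous) hF.measurable

lemma Economy.SmoothOn.aemeasurable_sampleAIE {Ω : Type*} [MeasurableSpace Ω] {P : Measure Ω}
    (hM : M.SmoothOn T C) {Θ : Measure 𝒢} {π : unitInterval} {h : ℝ} {G : Fin n → Ω → 𝒢}
    {W : Fin n → Ω → Bool} {U : Fin n → Ω → Goods J} (hexp : Experiment Θ π h P G W U)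
    {price : Ω → Goods J} (hprice : AEMeasurable price P) :
    AEMeasurable (fun ω => M.sampleAIE π (fun i => G i ω) (fun i => W i ω) (fun i => U i ω)
      (price ω)) P := by
  have hG : ∀ i, AEMeasurable (G i) P := fun i =>
    measurable_fst.comp_aemeasurable (hexp.law i).aemeasurable
  have hW : ∀ i, AEMeasurable (W i) P := fun i =>
    (measurable_fst.comp measurable_snd).comp_aemeasurable (hexp.law i).aemeasurable
  have hU : ∀ i, AEMeasurable (U i) P := fun i =>
    ((WithLp.measurable_toLp 2 (Fin J → ℝ)).comp
      (measurable_snd.comp measurable_snd)).comp_aemeasurable (hexp.law i).aemeasurable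
  have hvec : AEMeasurable (fun ω => ((fun i => (G i ω, W i ω, U i ω)), price ω)) P :=
    (aemeasurable_pi_lambda _ fun i => (hG i).prodMk ((hW i).prodMk (hU i))).prodMk hprice
  have hshift : ∀ i, Measurable fun z : (Fin n → 𝒢 × Bool × Goods J) × Goods J =>
      (z.2 + (z.1 i).2.2, (z.1 i).1, (z.1 i).2.1) := by
    intro i
    fun_prop
  have hcoord : ∀ j : Fin J, Measurable fun p : Goods J => p j := fun j => by fun_prop
  have hΦ := measurable_estimatorAIE (n := n) (J := J) (π : ℝ)
    (W := fun (z : (Fin n → 𝒢 × Bool × Goods J) × Goods J) i => (z.1 i).2.1)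
    (U := fun z => Matrix.of fun i j => (z.1 i).2.2 j)
    (Z := fun z => Matrix.of fun i j => M.excess (z.1 i).1 (z.1 i).2.1 (z.2 + (z.1 i).2.2) j)
    (Y := fun z i => M.outcome (z.1 i).1 (z.1 i).2.1 (z.2 + (z.1 i).2.2))
    (fun i => by fun_prop)
    (fun i j => (hcoord j).comp (by fun_prop : Measurable fun z :
        (Fin n → 𝒢 × Bool × Goods J) × Goods J => (z.1 i).2.2))
    (fun i j => (hcoord j).comp ((hM.demand.sub hM.supply).measurable_uncurry.comp (hshift i)))
    (fun i => hM.outcome.measurable_uncurry.comp (hshift i))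
  have hcomp := hΦ.comp_aemeasurable hvec
  simp only [Function.comp_def] at hcomp
  simp only [Economy.sampleAIE]
  exact hcomp

end EstimatorAlgebra

/-! ### Asymptotic normality of the estimator -/

section AsymptoticNormality

lemma tendsto_matrix_inv {ι : Type*} {𝓕 : Filter ι} {J : ℕ} {Q : ι → Matrix (Fin J) (Fin J) ℝ}
    {H : Matrix (Fin J) (Fin J) ℝ} (hQ : ∀ k j, Tendsto (fun x => Q x k j) 𝓕 (𝓝 (H k j)))
    (hH : IsUnit H.det) :
    (∀ᶠ x in 𝓕, IsUnit (Q x).det) ∧ ∀ k j, Tendsto (fun x => (Q x)⁻¹ k j) 𝓕 (𝓝 (H⁻¹ k j)) := by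
  have hQ' : Tendsto Q 𝓕 (𝓝 H) := tendsto_pi_nhds.2 fun k => tendsto_pi_nhds.2 fun j => hQ k j
  have hdet : Tendsto (fun x => (Q x).det) 𝓕 (𝓝 H.det) :=
    ((Continuous.matrix_det (A := fun B : Matrix (Fin J) (Fin J) ℝ => B) continuous_id).tendsto
      H).comp hQ'
  have hadj : Tendsto (fun x => (Q x).adjugate) 𝓕 (𝓝 H.adjugate) :=
    ((Continuous.matrix_adjugate (A := fun B : Matrix (Fin J) (Fin J) ℝ => B)
      continuous_id).tendsto H).comp hQ'
  refine ⟨(hdet.eventually_ne hH.ne_zero).mono fun x hx => isUnit_iff_ne_zero.2 hx, fun k j => ?_⟩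
  have h1 : Tendsto (fun x => (Q x).adjugate k j) 𝓕 (𝓝 (H.adjugate k j)) :=
    tendsto_pi_nhds.1 (tendsto_pi_nhds.1 hadj k) j
  simp only [Matrix.inv_def, Ring.inverse_eq_inv', Matrix.smul_apply, smul_eq_mul]
  exact (hdet.inv₀ hH.ne_zero).mul h1

variable {J : ℕ}

lemma integrable_signsLaw_mul (c : ℝ) (k m : Fin J) :
    Integrable (fun ξ : Fin J → ℝ => c * (ξ k * ξ m)) (signsLaw J) := by
  refine Integrable.of_bound (C := |c|) (by fun_prop) ?_
  filter_upwards [ae_signsLaw] with ξ hξ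
  rw [Real.norm_eq_abs, abs_mul, abs_mul]
  exact mul_le_of_le_one_right (abs_nonneg _) (mul_le_one₀ (hξ k) (abs_nonneg _) (hξ m))

lemma integral_signsLaw_dotProduct (b : Fin J → ℝ) : ∫ ξ, ξ ⬝ᵥ b ∂(signsLaw J) = 0 := by
  simp only [dotProduct]
  rw [integral_finsetSum]
  · simp [integral_mul_const, integral_signsLaw]
  · intro k _
    refine Integrable.mul_const (Integrable.of_bound (C := 1)
      (measurable_pi_apply k).aestronglyMeasurable ?_) _
    filter_upwards [ae_signsLaw] with ξ hξ using hξ k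

lemma integral_signsLaw_dotProduct_sq (b : Fin J → ℝ) :
    ∫ ξ, (ξ ⬝ᵥ b) ^ 2 ∂(signsLaw J) = b ⬝ᵥ b := by
  have h1 : ∀ ξ : Fin J → ℝ, (ξ ⬝ᵥ b) ^ 2 = ∑ k, ∑ m, b k * b m * (ξ k * ξ m) := by
    intro ξ
    rw [pow_two, dotProduct, Finset.sum_mul_sum]
    refine Finset.sum_congr rfl fun k _ => Finset.sum_congr rfl fun m _ => ?_
    ring
  simp only [h1]
  rw [integral_finsetSum _ fun k _ => integrable_finsetSum _ fun m _ => integrable_signsLaw_mul _ k m]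
  simp only [integral_finsetSum _ fun m _ => integrable_signsLaw_mul _ _ m, integral_const_mul,
    integral_signsLaw_mul]
  simp [dotProduct]

variable {𝒢 : Type*} [MeasurableSpace 𝒢] {M : Economy J 𝒢} {Θ : Measure 𝒢}
  [IsProbabilityMeasure Θ] {l u : Fin J → ℝ} {π : unitInterval} {T : Set (Goods J)} {C : ℝ}

/-- The linear functional `z ↦ zᵀ γ`. -/
noncomputable def dotRight (γ : Fin J → ℝ) : Goods J →L[ℝ] ℝ :=
  ∑ j, γ j • EuclideanSpace.proj (𝕜 := ℝ) j

lemma dotRight_apply (γ : Fin J → ℝ) (z : Goods J) : dotRight γ z = z.ofLp ⬝ᵥ γ := by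
  simp [dotRight, dotProduct, mul_comm]

/-- The weight of an individual in the Horvitz-Thompson estimator. -/
noncomputable def htWeight (π : ℝ) (w : Bool) : ℝ := treat w / π - (1 - treat w) / (1 - π)

lemma SmoothBdd.integrable_partialDeriv {𝒳 : Type*} [MeasurableSpace 𝒳] {Λ : Measure 𝒳}
    [IsProbabilityMeasure Λ] {F : 𝒳 → Goods J → ℝ} (hF : SmoothBdd F T C) {p : Goods J}
    (hp : p ∈ T) (k : Fin J) : Integrable (partialDeriv F p k) Λ :=
  hF.integrable_fderiv hp _

namespace Economy

/-- The residual outcome `Y - Zᵀ γ`. -/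
noncomputable def residual (M : Economy J 𝒢) (γ : Fin J → ℝ) (x : 𝒢 × Bool) (p : Goods J) : ℝ :=
  M.outcome x.1 x.2 p - dotRight γ (M.excess x.1 x.2 p)

namespace SmoothOn

lemma residual (hM : M.SmoothOn T C) (γ : Fin J → ℝ) :
    SmoothBdd (M.residual γ) T (C + ‖dotRight γ‖ * (C + C)) :=
  hM.outcome.sub (hM.excess.clm_comp _)

lemma integral_partialDeriv_excess (hM : M.SmoothOn T C) {p : Goods J} (hp : p ∈ T)
    (L : Goods J →L[ℝ] ℝ) (k : Fin J) :
    ∫ x, partialDeriv (fun (x : 𝒢 × Bool) p => L (M.excess x.1 x.2 p)) p k x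
        ∂(Θ.prod (treatmentLaw π))
      = L (fderiv ℝ (M.mixedExcess Θ π) p (EuclideanSpace.single k 1)) := by
  have h1 : ∀ x : 𝒢 × Bool, partialDeriv (fun (x : 𝒢 × Bool) p => L (M.excess x.1 x.2 p)) p k x
      = L (fderiv ℝ (M.excess x.1 x.2) p (EuclideanSpace.single k 1)) := by
    intro x
    rw [partialDeriv, show (fun p => L (M.excess x.1 x.2 p)) = L ∘ M.excess x.1 x.2 from rfl,
      fderiv_comp p L.differentiableAt (hM.excess.differentiable x p), L.fderiv]
    rfl
  simp only [h1]
  rw [L.integral_comp_comm (hM.excess.integrable_fderiv hp _), hM.fderiv_mixedExcess π hp,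
    hM.excess.fderiv_integral_apply hM.convex hM.isOpen hp]

lemma integral_partialDeriv_excess_apply (hM : M.SmoothOn T C) {p : Goods J} (hp : p ∈ T)
    (k j : Fin J) :
    ∫ x, partialDeriv (fun (x : 𝒢 × Bool) p => EuclideanSpace.proj (𝕜 := ℝ) j
      (M.excess x.1 x.2 p)) p k x ∂(Θ.prod (treatmentLaw π)) = M.gradExcess Θ π p k j :=
  hM.integral_partialDeriv_excess hp _ k

lemma integral_partialDeriv_outcome (hM : M.SmoothOn T C) {p : Goods J} (hp : p ∈ T) (k : Fin J) :
    ∫ x, partialDeriv (fun (x : 𝒢 × Bool) p => M.outcome x.1 x.2 p) p k x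
      ∂(Θ.prod (treatmentLaw π)) = M.gradOutcome Θ π p k := by
  rw [gradOutcome, hM.fderiv_mixedOutcome π hp,
    hM.outcome.fderiv_integral_apply hM.convex hM.isOpen hp]
  rfl

/-- The mean derivative of the residual outcome vanishes at the mean-field price. -/
lemma integral_partialDeriv_residual (hM : M.SmoothOn T C)
    (hps : M.meanFieldPrice Θ l u π ∈ T)
    (hH : IsUnit (M.gradExcess Θ π (M.meanFieldPrice Θ l u π)).det) (k : Fin J) :
    ∫ x, partialDeriv (M.residual (M.gamma Θ l u π)) (M.meanFieldPrice Θ l u π) k x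
      ∂(Θ.prod (treatmentLaw π)) = 0 := by
  set p := M.meanFieldPrice Θ l u π
  set γ := M.gamma Θ l u π with hγ
  have h1 : ∀ x, partialDeriv (M.residual γ) p k x
      = partialDeriv (fun (x : 𝒢 × Bool) p => M.outcome x.1 x.2 p) p k x
        - partialDeriv (fun (x : 𝒢 × Bool) p => dotRight γ (M.excess x.1 x.2 p)) p k x := by
    intro x
    have h2 := fderiv_fun_sub (hM.outcome.differentiable x p)
      ((hM.excess.clm_comp (dotRight γ)).differentiable x p)
    simp only [partialDeriv]
    exact congrArg (fun L => L (EuclideanSpace.single k 1)) h2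
  simp only [h1]
  rw [integral_sub (hM.outcome.integrable_partialDeriv hps k)
      ((hM.excess.clm_comp (dotRight γ)).integrable_partialDeriv hps k),
    hM.integral_partialDeriv_outcome hps, hM.integral_partialDeriv_excess hps, dotRight_apply]
  -- The defining property of `γ`: residualizing by `Zᵀγ` removes the first-order effect of prices
  -- on the mean outcome.
  have h3 : M.gradExcess Θ π p *ᵥ γ = M.gradOutcome Θ π p := by
    rw [hγ, gamma, Matrix.mulVec_mulVec, Matrix.mul_nonsing_inv _ hH, Matrix.one_mulVec]
  have h4 := congrFun h3 k
  rw [← h4, sub_eq_zero]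
  rfl

lemma htWeight_smul (hM : M.SmoothOn T C) (π : ℝ) (j : Fin J) :
    SmoothBdd (fun (x : 𝒢 × Bool) p => htWeight π x.2 • EuclideanSpace.proj (𝕜 := ℝ) j
      (M.excess x.1 x.2 p)) T ((|htWeight π true| + |htWeight π false|) *
        (‖(EuclideanSpace.proj j : Goods J →L[ℝ] ℝ)‖ * (C + C))) := by
  refine (hM.excess.clm_comp _).smul ((measurable_of_finite (htWeight π)).comp measurable_snd) ?_
  rintro ⟨g, w⟩
  cases w <;> simp

/-- The weights are `1/π` on the treated and `-1/(1 - π)` on the controls, which cancel the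
assignment probabilities. -/
lemma integral_htWeight (hM : M.SmoothOn T C) {p : Goods J} (hp : p ∈ T) (hπ0 : 0 < π) (hπ1 : π < 1)
    (j : Fin J) : ∫ x : 𝒢 × Bool, htWeight π x.2 • EuclideanSpace.proj (𝕜 := ℝ) j
      (M.excess x.1 x.2 p) ∂(Θ.prod (treatmentLaw π)) = M.excessEffect Θ p j := by
  have h0 : (π : ℝ) ≠ 0 := ne_of_gt hπ0
  have h1 : (1 - π : ℝ) ≠ 0 := sub_ne_zero.2 (ne_of_gt hπ1)
  have hj : ∀ w, ∫ g, EuclideanSpace.proj (𝕜 := ℝ) j (M.excess g w p) ∂Θ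
      = (∫ g, M.excess g w p ∂Θ) j := fun w =>
    (EuclideanSpace.proj (𝕜 := ℝ) j).integral_comp_comm ((hM.excess_of w).integrable hp)
  rw [integral_prod_treatmentLaw ((hM.htWeight_smul π j).integrable hp)]
  simp only [integral_smul, hj]
  simp only [excessEffect, PiLp.sub_apply, smul_eq_mul, htWeight, treat]
  field_simp
  simp
  ring

end SmoothOn

end Economy

end AsymptoticNormality

/-! ### Limits of the ingredients of the estimator. -/

section ExperimentLimits

variable {J : ℕ} {𝒢 : Type*} [MeasurableSpace 𝒢] {M : Economy J 𝒢} {Θ : Measure 𝒢}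
  [IsProbabilityMeasure Θ] {l u : Fin J → ℝ} {π : unitInterval} {T : Set (Goods J)} {C : ℝ}
  {h : ℕ → ℝ} {Ω : ℕ → Type*} [∀ n, MeasurableSpace (Ω n)] {P : ∀ n, Measure (Ω n)}
  {X : ∀ n, Fin n → Ω n → (𝒢 × Bool) × (Fin J → ℝ)} {ps : Goods J} {δ : (Σ n, Ω n) → Goods J}
  {γ : Fin J → ℝ}

/-- The average of the products of two signs. -/
noncomputable def signGram (X : ∀ n, Fin n → Ω n → (𝒢 × Bool) × (Fin J → ℝ)) (x : Σ n, Ω n) :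
    Matrix (Fin J) (Fin J) ℝ :=
  Matrix.of fun k m => rowAvg X (fun y => y.2 k * y.2 m) x

/-- The normalized cross moments of signs and excess demands. -/
noncomputable def signExcess (M : Economy J 𝒢) (h : ℕ → ℝ)
    (X : ∀ n, Fin n → Ω n → (𝒢 × Bool) × (Fin J → ℝ)) (ps : Goods J) (δ : (Σ n, Ω n) → Goods J)
    (x : Σ n, Ω n) : Matrix (Fin J) (Fin J) ℝ :=
  Matrix.of fun k j => (√(x.1 : ℝ) * h x.1)⁻¹ * shiftSum X h ps δ (fun ξ => ξ k)
    (fun y p => EuclideanSpace.proj (𝕜 := ℝ) j (M.excess y.1 y.2 p)) x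

/-- The normalized cross moments of signs and residual outcomes. -/
noncomputable def signResidual (M : Economy J 𝒢) (h : ℕ → ℝ)
    (X : ∀ n, Fin n → Ω n → (𝒢 × Bool) × (Fin J → ℝ)) (ps : Goods J) (δ : (Σ n, Ω n) → Goods J)
    (γ : Fin J → ℝ) (x : Σ n, Ω n) : Fin J → ℝ :=
  fun k => shiftSum X h ps δ (fun ξ => ξ k) (M.residual γ) x

/-- The Horvitz-Thompson estimator of the direct effect on excess demand. -/
noncomputable def weightedExcess (M : Economy J 𝒢) (π : ℝ) (h : ℕ → ℝ)
    (X : ∀ n, Fin n → Ω n → (𝒢 × Bool) × (Fin J → ℝ)) (ps : Goods J) (δ : (Σ n, Ω n) → Goods J)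
    (x : Σ n, Ω n) : Fin J → ℝ :=
  fun j => (√(x.1 : ℝ))⁻¹ * shiftSum X h ps δ (fun _ => 1)
    (fun y p => htWeight π y.2 • EuclideanSpace.proj (𝕜 := ℝ) j (M.excess y.1 y.2 p)) x

-- Exact algebra, with no limit taken. Since `U_i = h ξ_i`, both `UᵀU` and `UᵀZ` carry the factor `s
-- = n h²`, and the residual term carries `s / (√n h)`, so the error of `γ̂` appears at scale `(√n
-- h)⁻¹`.
omit [MeasurableSpace 𝒢] [∀ n, MeasurableSpace (Ω n)] in
lemma sampleAIE_sampleArray_eq {G : ∀ n, Fin n → Ω n → 𝒢} {W : ∀ n, Fin n → Ω n → Bool}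
    {U : ∀ n, Fin n → Ω n → Goods J} {price : ∀ n, Ω n → Goods J} (hr : PerturbationRate h)
    {x : Σ n, Ω n} (hx : 1 ≤ x.1) (hUU : IsUnit (signGram (sampleArray h G W U) x).det)
    (hQ : IsUnit (signExcess M h (sampleArray h G W U) ps
      (fun x => price x.1 x.2 - ps) x).det) (π : ℝ) :
    M.sampleAIE π (fun i => G x.1 i x.2) (fun i => W x.1 i x.2) (fun i => U x.1 i x.2)
      (price x.1 x.2)
    = -((γ + (√(x.1 : ℝ) * h x.1)⁻¹ •
        ((signExcess M h (sampleArray h G W U) ps (fun x => price x.1 x.2 - ps) x)⁻¹ *ᵥ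
          signResidual M h (sampleArray h G W U) ps (fun x => price x.1 x.2 - ps) γ x)) ⬝ᵥ
        weightedExcess M π h (sampleArray h G W U) ps (fun x => price x.1 x.2 - ps) x) := by
  have hn : (0 : ℝ) < x.1 := by exact_mod_cast hx
  have hn' : √(x.1 : ℝ) ≠ 0 := (Real.sqrt_pos.2 hn).ne'
  have hnn : √(x.1 : ℝ) * √(x.1 : ℝ) = x.1 := Real.mul_self_sqrt hn.le
  have hh : h x.1 ≠ 0 := (hr.pos x.1 hx).ne'
  have hU : ∀ i k, U x.1 i x.2 k = h x.1 * (sampleArray h G W U x.1 i x.2).2 k := fun i k => by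
    simp [sampleArray, mul_inv_cancel_left₀ hh]
  have hp : ∀ i, ps + ((price x.1 x.2 - ps) + h x.1 •
      WithLp.toLp 2 (sampleArray h G W U x.1 i x.2).2) = price x.1 x.2 + U x.1 i x.2 := fun i => by
    rw [smul_sampleArray hr]
    abel
  have hproj : ∀ j (z : Goods J), EuclideanSpace.proj (𝕜 := ℝ) j z = z j := fun _ _ => rfl
  have hτ : horvitzThompsonZ π (fun i => W x.1 i x.2) (Matrix.of fun i j =>
      M.excess (G x.1 i x.2) (W x.1 i x.2) (price x.1 x.2 + U x.1 i x.2) j)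
      = weightedExcess M π h (sampleArray h G W U) ps (fun x => price x.1 x.2 - ps) x := by
    funext j
    simp only [horvitzThompsonZ, weightedExcess, shiftSum, hp, ← mul_assoc, ← mul_inv, hnn]
    congr 1
    refine Finset.sum_congr rfl fun i _ => ?_
    simp only [htWeight, sampleArray, Matrix.of_apply, hproj, smul_eq_mul]
    ring
  rw [Economy.sampleAIE, estimatorAIE_eq (s := x.1 * h x.1 ^ 2) (t := (√(x.1 : ℝ) * h x.1)⁻¹)
    (γ := γ) ?_ hQ (by positivity) ?_ ?_, hτ]
  · have : (Matrix.of fun i j => U x.1 i x.2 j)ᵀ * (Matrix.of fun i j => U x.1 i x.2 j)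
        = (x.1 * h x.1 ^ 2) • signGram (sampleArray h G W U) x := by
      ext k m
      simp only [Matrix.mul_apply, Matrix.transpose_apply, Matrix.of_apply, Matrix.smul_apply,
        signGram, rowAvg, smul_eq_mul, hU, Finset.mul_sum]
      refine Finset.sum_congr rfl fun i _ => ?_
      field_simp
    rw [this, Matrix.det_smul]
    exact ((isUnit_iff_ne_zero.2 (by positivity)).pow _).mul hUU
  · ext k j
    simp only [Matrix.mul_apply, Matrix.transpose_apply, Matrix.of_apply, Matrix.smul_apply,
      signExcess, shiftSum, smul_eq_mul, hU, hp, Finset.mul_sum]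
    refine Finset.sum_congr rfl fun i _ => ?_
    simp only [sampleArray, hproj]
    field_simp
    rw [Real.sq_sqrt hn.le]
  · funext k
    simp only [Matrix.mulVec, dotProduct, Matrix.mul_apply, Matrix.transpose_apply,
      Matrix.of_apply, Pi.add_apply, Pi.smul_apply, signResidual, shiftSum, smul_eq_mul, hU, hp,
      Finset.mul_sum, Finset.sum_mul, Economy.residual, dotRight_apply]
    rw [Finset.sum_comm, ← Finset.sum_add_distrib]
    refine Finset.sum_congr rfl fun i _ => ?_
    simp only [sampleArray, mul_sub, Finset.mul_sum]
    have h1 : (x.1 * h x.1 ^ 2) * (√(x.1 : ℝ) * h x.1)⁻¹ * (√(x.1 : ℝ))⁻¹ = h x.1 := by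
      field_simp
      rw [Real.sq_sqrt hn.le]
    simp only [← mul_assoc, h1]
    ring

variable [∀ n, IsProbabilityMeasure (P n)]

lemma IIDArray.tendsto_signGram
    (hX : IIDArray ((Θ.prod (treatmentLaw π)).prod (signsLaw J)) P X) (k m : Fin J) :
    Tendsto (fun x => signGram X x k m) (whp P) (𝓝 ((1 : Matrix (Fin J) (Fin J) ℝ) k m)) := by
  have h1 : MemLp (fun y : (𝒢 × Bool) × (Fin J → ℝ) => y.2 k * y.2 m) 2
      ((Θ.prod (treatmentLaw π)).prod (signsLaw J)) := by
    have := memLp_mul_of_bound (Λ := Θ.prod (treatmentLaw π)) (f := fun _ => 1) measurable_const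
      (C := 1) (by simp) (φ := fun ξ : Fin J → ℝ => ξ k * ξ m) (by fun_prop) (K := 1) fun ξ hξ => by
        rw [abs_mul]
        exact mul_le_one₀ (hξ k) (abs_nonneg _) (hξ m)
    simpa only [one_mul] using this
  have h2 := hX.tendsto_rowAvg (by fun_prop) h1
  rw [integral_fun_snd (fun ξ : Fin J → ℝ => ξ k * ξ m), integral_signsLaw_mul] at h2
  simpa [signGram, Matrix.one_apply] using h2

lemma IIDArray.bddInProb_normSum_sign
    (hX : IIDArray ((Θ.prod (treatmentLaw π)).prod (signsLaw J)) P X) {F : 𝒢 × Bool → Goods J → ℝ}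
    (hF : SmoothBdd F T C) (hps : ps ∈ T) (k : Fin J) :
    BddInProb P (normSum X fun y => F y.1 ps * y.2 k) := by
  have hm : Measurable fun x => F x ps := hF.measurable ps
  refine hX.bddInProb_normSum (by fun_prop) (memLp_mul_of_bound hm
    (fun x => hF.norm_le x ps hps) (φ := fun ξ : Fin J → ℝ => ξ k) (by fun_prop) (K := 1)
    fun ξ hξ => hξ k) ?_
  rw [integral_prod_mul (fun x => F x ps) fun ξ : Fin J → ℝ => ξ k, integral_signsLaw, mul_zero]

/-- After division by `√n h → ∞` the centred sum in the expansion disappears and only the drift, the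
mean derivative, remains. -/
lemma IIDArray.tendsto_signExcess
    (hX : IIDArray ((Θ.prod (treatmentLaw π)).prod (signsLaw J)) P X) (hM : M.SmoothOn T C)
    (hr : PerturbationRate h) (hps : ps ∈ T)
    (hδ : Tendsto (fun x => √(x.1 : ℝ) * ‖δ x‖ ^ 2) (whp P) (𝓝 0)) (k j : Fin J) :
    Tendsto (fun x => signExcess M h X ps δ x k j) (whp P) (𝓝 (M.gradExcess Θ π ps k j)) := by
  have hF := hM.excess.clm_comp (EuclideanSpace.proj (𝕜 := ℝ) j)
  have hinv : Tendsto (fun x : Σ n, Ω n => (√(x.1 : ℝ) * h x.1)⁻¹) (whp P) (𝓝 0) :=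
    hr.inv_sqrt_mul.comp tendsto_fst_whp
  have h1 := hinv.mul (hX.tendsto_shiftSum_sign hr hF hM.convex hM.isOpen hps hδ k)
  have h2 := (hX.bddInProb_normSum_sign hF hps k).mul_tendsto hinv
  rw [hM.integral_partialDeriv_excess_apply hps] at h1
  have h3 := (h1.add h2).add_const (M.gradExcess Θ π ps k j)
  rw [mul_zero, zero_add, zero_add] at h3
  refine h3.congr' ?_
  filter_upwards [tendsto_fst_whp.eventually (eventually_ge_atTop 1)] with x hx
  have hn : (0 : ℝ) < x.1 := by exact_mod_cast hx
  have hr0 : √(x.1 : ℝ) * h x.1 ≠ 0 := mul_ne_zero (Real.sqrt_pos.2 hn).ne' (hr.pos x.1 hx).ne'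
  simp only [signExcess, Matrix.of_apply]
  rw [mul_sub, mul_sub, inv_mul_cancel_left₀ hr0]
  ring

/-- The drift `√n h E[∂_k R]` is zero by the choice of `γ`, so without any division the sum agrees
with its value at the fixed mean-field price. -/
lemma IIDArray.tendsto_signResidual
    (hX : IIDArray ((Θ.prod (treatmentLaw π)).prod (signsLaw J)) P X) (hM : M.SmoothOn T C)
    (hr : PerturbationRate h) (hps : M.meanFieldPrice Θ l u π ∈ T)
    (hH : IsUnit (M.gradExcess Θ π (M.meanFieldPrice Θ l u π)).det)
    (hδ : Tendsto (fun x => √(x.1 : ℝ) * ‖δ x‖ ^ 2) (whp P) (𝓝 0)) (k : Fin J) :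
    Tendsto (fun x => signResidual M h X (M.meanFieldPrice Θ l u π) δ (M.gamma Θ l u π) x k
      - normSum X (fun y => M.residual (M.gamma Θ l u π) y.1 (M.meanFieldPrice Θ l u π) * y.2 k) x)
      (whp P) (𝓝 0) := by
  have h1 := hX.tendsto_shiftSum_sign hr (hM.residual (M.gamma Θ l u π)) hM.convex hM.isOpen hps hδ k
  simpa only [hM.integral_partialDeriv_residual hps hH, mul_zero, sub_zero, signResidual] using h1

/-- The Horvitz-Thompson estimator of the direct effect converges faster than `1 / (√n b)` for
every sequence `b` that tends to zero. -/
lemma IIDArray.tendsto_mul_weightedExcess_sub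
    (hX : IIDArray ((Θ.prod (treatmentLaw π)).prod (signsLaw J)) P X) (hM : M.SmoothOn T C)
    (hr : PerturbationRate h) (hπ0 : 0 < π) (hπ1 : π < 1) (hps : ps ∈ T)
    (hδ : Tendsto (fun x => √(x.1 : ℝ) * ‖δ x‖ ^ 2) (whp P) (𝓝 0)) {b : ℕ → ℝ}
    (hb : Tendsto b atTop (𝓝 0))
    (hbδ : Tendsto (fun x => b x.1 * (√(x.1 : ℝ) * ‖δ x‖)) (whp P) (𝓝 0)) (j : Fin J) :
    Tendsto (fun x => b x.1 * (√(x.1 : ℝ) *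
      (weightedExcess M π h X ps δ x j - M.excessEffect Θ ps j))) (whp P) (𝓝 0) := by
  have h1 := hX.tendsto_shiftSum_one hr (hM.htWeight_smul π j) hM.convex hM.isOpen hps hδ hb hbδ
  rw [hM.integral_htWeight hps hπ0 hπ1] at h1
  refine h1.congr' ?_
  filter_upwards [tendsto_fst_whp.eventually (eventually_ge_atTop 1)] with x hx
  have hn : (0 : ℝ) < x.1 := by exact_mod_cast hx
  rw [weightedExcess, mul_sub (√(x.1 : ℝ)), mul_inv_cancel_left₀ (Real.sqrt_pos.2 hn).ne']

end ExperimentLimits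

/-! ### Asymptotic linearity and the limit variance. -/

section CentralLimit

variable {J : ℕ} {𝒢 : Type*} [MeasurableSpace 𝒢] {M : Economy J 𝒢} {Θ : Measure 𝒢}
  [IsProbabilityMeasure Θ] {l u : Fin J → ℝ} {π : unitInterval} {T : Set (Goods J)} {C : ℝ}

namespace Economy.SmoothOn

lemma deriv_meanFieldPrice (hM : M.SmoothOn T C) (hsub : priceBox l u ⊆ T)
    (hb : M.BoundaryCondition Θ l u) (hπ0 : 0 < π) (hπ1 : π < 1) (hn : M.Nonsingular Θ l u π) :
    (deriv (M.meanFieldPrice Θ l u) π).ofLp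
      = -((M.excessEffect Θ (M.meanFieldPrice Θ l u π)).ofLp ᵥ*
          (M.gradExcess Θ π (M.meanFieldPrice Θ l u π))⁻¹) := by
  rw [(hM.hasDerivAt_meanFieldPrice hsub hb hπ0 hπ1 hn).deriv]

/-- Moving `H⁻¹` across the dot product, from the derivative of the price to `∇y`, turns the target
into the same bilinear form as the estimator. -/
lemma meanFieldAIE_eq (hM : M.SmoothOn T C) (hsub : priceBox l u ⊆ T)
    (hb : M.BoundaryCondition Θ l u) (hπ0 : 0 < π) (hπ1 : π < 1) (hn : M.Nonsingular Θ l u π) :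
    M.meanFieldAIE Θ l u π
      = -(M.gamma Θ l u π ⬝ᵥ (M.excessEffect Θ (M.meanFieldPrice Θ l u π)).ofLp) := by
  rw [meanFieldAIE, hM.deriv_meanFieldPrice hsub hb hπ0 hπ1 hn, dotProduct_neg, dotProduct_comm,
    ← Matrix.dotProduct_mulVec, dotProduct_comm, gamma]

lemma measurable_residual_mul (hM : M.SmoothOn T C) (γ b : Fin J → ℝ) (p : Goods J) :
    Measurable fun y : (𝒢 × Bool) × (Fin J → ℝ) => M.residual γ y.1 p * (y.2 ⬝ᵥ b) := by
  have h1 : Measurable fun x => M.residual γ x p := (hM.residual γ).measurable p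
  have h2 : Measurable fun ξ : Fin J → ℝ => ξ ⬝ᵥ b :=
    Finset.measurable_fun_sum _ fun k _ => (measurable_pi_apply k).mul_const _
  exact (h1.comp measurable_fst).mul (h2.comp measurable_snd)

lemma memLp_residual_mul (hM : M.SmoothOn T C) (γ b : Fin J → ℝ) {p : Goods J} (hp : p ∈ T) :
    MemLp (fun y : (𝒢 × Bool) × (Fin J → ℝ) => M.residual γ y.1 p * (y.2 ⬝ᵥ b)) 2
      ((Θ.prod (treatmentLaw π)).prod (signsLaw J)) := by
  refine memLp_mul_of_bound ((hM.residual γ).measurable p)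
    (fun x => (hM.residual γ).norm_le x p hp) (φ := fun ξ : Fin J → ℝ => ξ ⬝ᵥ b)
    (Finset.measurable_fun_sum _ fun k _ => (measurable_pi_apply k).mul_const _)
    (K := ∑ k, |b k|) fun ξ hξ => ?_
  refine (Finset.abs_sum_le_sum_abs _ _).trans (Finset.sum_le_sum fun k _ => ?_)
  rw [abs_mul]
  exact mul_le_of_le_one_left (abs_nonneg _) (hξ k)

lemma integral_residual_mul (γ b : Fin J → ℝ) (p : Goods J) :
    ∫ y : (𝒢 × Bool) × (Fin J → ℝ), M.residual γ y.1 p * (y.2 ⬝ᵥ b)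
      ∂((Θ.prod (treatmentLaw π)).prod (signsLaw J)) = 0 := by
  rw [integral_prod_mul (fun x => M.residual γ x p) fun ξ : Fin J → ℝ => ξ ⬝ᵥ b,
    integral_signsLaw_dotProduct, mul_zero]

/-- The signs are independent of individual and treatment, so the second moment factors, and
orthonormality gives `E[(ξ · b)²] = b · b`. -/
lemma integral_residual_mul_sq :
    ∫ y : (𝒢 × Bool) × (Fin J → ℝ), (M.residual (M.gamma Θ l u π) y.1 (M.meanFieldPrice Θ l u π)
        * (y.2 ⬝ᵥ (deriv (M.meanFieldPrice Θ l u) π).ofLp)) ^ 2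
      ∂((Θ.prod (treatmentLaw π)).prod (signsLaw J)) = M.asympVarAIE Θ l u π := by
  simp only [mul_pow]
  rw [integral_prod_mul (fun x => M.residual (M.gamma Θ l u π) x (M.meanFieldPrice Θ l u π) ^ 2)
    fun ξ : Fin J → ℝ => (ξ ⬝ᵥ (deriv (M.meanFieldPrice Θ l u) π).ofLp) ^ 2,
    integral_signsLaw_dotProduct_sq, asympVarAIE]
  simp only [Economy.residual, dotRight_apply]

variable {h : ℕ → ℝ} {Ω : ℕ → Type*} [∀ n, MeasurableSpace (Ω n)] {P : ∀ n, Measure (Ω n)}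
  {G : ∀ n, Fin n → Ω n → 𝒢} {W : ∀ n, Fin n → Ω n → Bool} {U : ∀ n, Fin n → Ω n → Goods J}
  {price : ∀ n, Ω n → Goods J} [∀ n, IsProbabilityMeasure (P n)]

/-- The estimation error of the average indirect effect is asymptotically linear. -/
lemma tendsto_sampleAIE_sub_normSum (hM : M.SmoothOn T C) (hsub : priceBox l u ⊆ T)
    (hb : M.BoundaryCondition Θ l u) (hπ0 : 0 < π) (hπ1 : π < 1) (hn : M.Nonsingular Θ l u π)
    (hr : PerturbationRate h) (hexp : ∀ n, Experiment Θ π (h n) (P n) (G n) (W n) (U n))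
    (hmarket : ∀ n, ∀ᵐ ω ∂(P n),
      M.IsMarketPrice (fun i => G n i ω) (fun i => W n i ω) (fun i => U n i ω) (price n ω)) :
    Tendsto (fun x : Σ n, Ω n => √(x.1 : ℝ) * h x.1 *
        (M.sampleAIE π (fun i => G x.1 i x.2) (fun i => W x.1 i x.2) (fun i => U x.1 i x.2)
          (price x.1 x.2) - M.meanFieldAIE Θ l u π)
        - normSum (sampleArray h G W U) (fun y =>
            M.residual (M.gamma Θ l u π) y.1 (M.meanFieldPrice Θ l u π)
              * (y.2 ⬝ᵥ (deriv (M.meanFieldPrice Θ l u) π).ofLp)) x) (whp P) (𝓝 0) := by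
  have hX := iidArray_sampleArray hr hexp
  have hmf : M.IsMeanFieldPrice Θ l u π (M.meanFieldPrice Θ l u π) :=
    isMeanFieldPrice_meanFieldPrice
      (hM.eventually_existsUnique hsub hb hπ0 hπ1 hn.contraction).self_of_nhds
  have hps := hsub hmf.1
  have hdet := (Matrix.isUnit_iff_isUnit_det _).1 hn.jacobian
  have hAIE := hM.meanFieldAIE_eq hsub hb hπ0 hπ1 hn
  have hderiv := hM.deriv_meanFieldPrice hsub hb hπ0 hπ1 hn
  set ps := M.meanFieldPrice Θ l u π with hps_def
  set H := M.gradExcess Θ π ps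
  set γ := M.gamma Θ l u π with hγ
  set d := M.excessEffect Θ ps
  set p' := (deriv (M.meanFieldPrice Θ l u) π).ofLp
  set X := sampleArray h G W U
  set δ : (Σ n, Ω n) → Goods J := fun x => price x.1 x.2 - ps
  have hbδ : ∀ b : ℕ → ℝ, Tendsto b atTop (𝓝 0) →
      Tendsto (fun x => b x.1 * (√(x.1 : ℝ) * ‖δ x‖)) (whp P) (𝓝 0) := fun b hb0 =>
    tendsto_mul_norm_price_sub hM hsub hb hπ0 hn hr hexp hmarket hmf hb0
  have hδ : Tendsto (fun x => √(x.1 : ℝ) * ‖δ x‖ ^ 2) (whp P) (𝓝 0) :=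
    tendsto_sqrt_mul_sq_of_forall hbδ
  have hUU := (tendsto_matrix_inv hX.tendsto_signGram (by simp)).1
  obtain ⟨hQ, hQinv⟩ := tendsto_matrix_inv (hX.tendsto_signExcess hM hr hps hδ) hdet
  have hv := hX.tendsto_signResidual hM hr hps hdet hδ
  have hL : ∀ k, BddInProb P (normSum X fun y => M.residual γ y.1 ps * y.2 k) :=
    hX.bddInProb_normSum_sign (hM.residual γ) hps
  have hτh := fun j => hX.tendsto_mul_weightedExcess_sub hM hr hπ0 hπ1 hps hδ hr.tendsto_zero
    (hbδ _ hr.tendsto_zero) j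
  have hone : ∀ᶠ x : Σ n, Ω n in whp P, 1 ≤ x.1 :=
    tendsto_fst_whp.eventually (eventually_ge_atTop 1)
  have hτ : ∀ j, Tendsto (fun x => weightedExcess M π h X ps δ x j) (whp P) (𝓝 (d j)) := by
    intro j
    -- The choice `b = n^{-1/2}` cancels the `√n` and gives plain consistency.
    have h1 := (hX.tendsto_mul_weightedExcess_sub (b := fun n => (√(n : ℝ))⁻¹) hM hr hπ0 hπ1 hps hδ
      tendsto_inv_sqrt_natCast (hbδ (fun n => (√(n : ℝ))⁻¹) tendsto_inv_sqrt_natCast) j).add_const (d j)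
    rw [zero_add] at h1
    refine h1.congr' ?_
    filter_upwards [hone] with x hx
    have hx0 : (0 : ℝ) < x.1 := by exact_mod_cast hx
    rw [inv_mul_cancel_left₀ (Real.sqrt_pos.2 hx0).ne']
    ring
  -- The coefficient `τ̂ᵀQ⁻¹` tends to `dᵀH⁻¹`, which is minus the derivative of the mean-field
  -- price.
  have hc : ∀ k, Tendsto (fun x => (weightedExcess M π h X ps δ x ᵥ*
      (signExcess M h X ps δ x)⁻¹) k) (whp P) (𝓝 (-p' k)) := by
    intro k
    rw [hderiv, Pi.neg_apply, neg_neg]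
    have h1 := tendsto_finsetSum Finset.univ fun j (_ : j ∈ Finset.univ) => (hτ j).mul (hQinv j k)
    simpa only [Matrix.vecMul, dotProduct] using h1
  -- Contribution of the error in the direct effect: the extra factor `h` makes an `O_p(1)` quantity
  -- vanish.
  have hfirst : Tendsto (fun x => ∑ j, γ j * (h x.1 * (√(x.1 : ℝ) *
      (weightedExcess M π h X ps δ x j - d j)))) (whp P) (𝓝 0) := by
    have := tendsto_finsetSum Finset.univ fun j _ => (hτh j).const_mul (γ j)
    simpa only [mul_zero, Finset.sum_const_zero] using this
  -- With `a` for this coefficient, `v` for the residual sums and `L` for the i.i.d. sums, `a·v +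
  -- L·p'` is split as `(v - L)·a + L·(a + p')`. In the first product `v - L → 0` and `a` converges;
  -- in the second `L = O_p(1)` and `a + p' → 0`.
  have hsecond : Tendsto (fun x => ∑ k, ((signResidual M h X ps δ γ x k
      - normSum X (fun y => M.residual γ y.1 ps * y.2 k) x)
        * (weightedExcess M π h X ps δ x ᵥ* (signExcess M h X ps δ x)⁻¹) k
      + normSum X (fun y => M.residual γ y.1 ps * y.2 k) x
        * ((weightedExcess M π h X ps δ x ᵥ* (signExcess M h X ps δ x)⁻¹) k + p' k)))
      (whp P) (𝓝 0) := by
    have := tendsto_finsetSum Finset.univ fun k (_ : k ∈ Finset.univ) =>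
      ((hv k).mul (hc k)).add ((hL k).mul_tendsto (by simpa using (hc k).add_const (p' k)))
    simpa only [zero_mul, add_zero, Finset.sum_const_zero] using this
  have hsum := (hfirst.add hsecond).neg
  rw [add_zero, neg_zero] at hsum
  refine hsum.congr' ?_
  filter_upwards [hone, hUU, hQ] with x hx hUx hQx
  have hx0 : (0 : ℝ) < x.1 := by exact_mod_cast hx
  have hrne : √(x.1 : ℝ) * h x.1 ≠ 0 := mul_ne_zero (Real.sqrt_pos.2 hx0).ne' (hr.pos x.1 hx).ne'
  rw [sampleAIE_sampleArray_eq (γ := γ) hr hx hUx hQx, hAIE]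
  change _ = √(x.1 : ℝ) * h x.1 * (-((γ + (√(x.1 : ℝ) * h x.1)⁻¹ •
    ((signExcess M h X ps δ x)⁻¹ *ᵥ signResidual M h X ps δ γ x)) ⬝ᵥ
      weightedExcess M π h X ps δ x) - -(γ ⬝ᵥ d.ofLp)) - _
  have hlin : normSum X (fun y => M.residual γ y.1 ps * (y.2 ⬝ᵥ p')) x
      = ∑ k, normSum X (fun y => M.residual γ y.1 ps * y.2 k) x * p' k := by
    simp only [normSum, dotProduct, Finset.mul_sum, Finset.sum_mul]
    rw [Finset.sum_comm]
    exact Finset.sum_congr rfl fun k _ => Finset.sum_congr rfl fun i _ => by ring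
  rw [hlin, add_dotProduct, smul_dotProduct, dotProduct_comm (_ *ᵥ _), Matrix.dotProduct_mulVec]
  set τ := weightedExcess M π h X ps δ x
  set a := τ ᵥ* (signExcess M h X ps δ x)⁻¹
  set v := signResidual M h X ps δ γ x
  have e1 : ∑ j, γ j * (h x.1 * (√(x.1 : ℝ) * (τ j - d j)))
      = √(x.1 : ℝ) * h x.1 * (γ ⬝ᵥ τ - γ ⬝ᵥ d.ofLp) := by
    rw [← dotProduct_sub, dotProduct, Finset.mul_sum]
    exact Finset.sum_congr rfl fun j _ => by simp only [Pi.sub_apply]; ring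
  have e2 : ∑ k, ((v k - normSum X (fun y => M.residual γ y.1 ps * y.2 k) x) * a k
      + normSum X (fun y => M.residual γ y.1 ps * y.2 k) x * (a k + p' k))
      = a ⬝ᵥ v + ∑ k, normSum X (fun y => M.residual γ y.1 ps * y.2 k) x * p' k := by
    rw [dotProduct, ← Finset.sum_add_distrib]
    exact Finset.sum_congr rfl fun k _ => by ring
  rw [e1, e2, smul_eq_mul]
  linear_combination (a ⬝ᵥ v) * mul_inv_cancel₀ hrne

end Economy.SmoothOn

end CentralLimit

theorem theorem4 {J : ℕ} {𝒢 : Type*} [MeasurableSpace 𝒢] (M : Economy J 𝒢)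
    (Θ : Measure 𝒢) [IsProbabilityMeasure Θ] (l u : Fin J → ℝ)
    (π : unitInterval) (hπ0 : 0 < π) (hπ1 : π < 1)
    (hbound : M.BoundaryCondition Θ l u) (hreg : M.Regular l u)
    (hnonsing : M.Nonsingular Θ l u π)
    (B : ℝ) (hB : 0 < B) (hclear : M.ApproxClearing Θ B)
    (c α : ℝ) (hc : 0 < c) (hα0 : 1 / 4 < α) (hα1 : α < 1 / 2)
    (h : ℕ → ℝ) (hh : ∀ n : ℕ, h n = c * (n : ℝ) ^ (-α))
    {Ω : ℕ → Type*} [∀ n, MeasurableSpace (Ω n)]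
    (P : ∀ n, Measure (Ω n)) [∀ n, IsProbabilityMeasure (P n)]
    (G : ∀ n, Fin n → Ω n → 𝒢) (W : ∀ n, Fin n → Ω n → Bool) (U : ∀ n, Fin n → Ω n → Goods J)
    (hexp : ∀ n, Experiment Θ π (h n) (P n) (G n) (W n) (U n))
    (price : ∀ n, Ω n → Goods J) (hprice : ∀ n, AEMeasurable (price n) (P n))
    (hmarket : ∀ n, ∀ᵐ ω ∂(P n),
      M.IsMarketPrice (fun i => G n i ω) (fun i => W n i ω) (fun i => U n i ω) (price n ω)) :
    (∀ᶠ ρ : ℝ in 𝓝 (π : ℝ), ∃! p, M.IsMeanFieldPrice Θ l u ρ p) ∧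
    DifferentiableAt ℝ (M.meanFieldPrice Θ l u) (π : ℝ) ∧
    TendstoInDistribution
      (fun (n : ℕ) (ω : Ω n) => Real.sqrt (n : ℝ) * h n *
        (M.sampleAIE π (fun i => G n i ω) (fun i => W n i ω) (fun i => U n i ω) (price n ω)
          - M.meanFieldAIE Θ l u π))
      atTop (id : ℝ → ℝ) P (gaussianReal 0 (M.asympVarAIE Θ l u π).toNNReal) := by

  obtain ⟨T, C, hsub, hM⟩ := hreg.exists_smoothOn
  have hr : PerturbationRate h := perturbationRate_rpow hc hα0 hα1 hh
  have hps : M.meanFieldPrice Θ l u π ∈ T := hsub (Economy.isMeanFieldPrice_meanFieldPrice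
    (hM.eventually_existsUnique hsub hbound hπ0 hπ1 hnonsing.contraction).self_of_nhds).1
  refine ⟨hM.eventually_existsUnique hsub hbound hπ0 hπ1 hnonsing.contraction,
    (hM.hasDerivAt_meanFieldPrice hsub hbound hπ0 hπ1 hnonsing).differentiableAt, ?_⟩
  have hclt := (iidArray_sampleArray hr hexp).tendstoInDistribution_normSum
    (hM.measurable_residual_mul (M.gamma Θ l u π) (deriv (M.meanFieldPrice Θ l u) π).ofLp
      (M.meanFieldPrice Θ l u π))
    (hM.memLp_residual_mul _ _ hps) (Economy.SmoothOn.integral_residual_mul _ _ _)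
  rw [Economy.SmoothOn.integral_residual_mul_sq] at hclt
  exact TendstoInDistribution.of_tendsto_sub_whp hclt
    (fun n => ((hM.aemeasurable_sampleAIE (hexp n) (hprice n)).sub_const _).const_mul _)
    (hM.tendsto_sampleAIE_sub_normSum hsub hbound hπ0 hπ1 hnonsing hr hexp hmarket)
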